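/- Let $d>0$, let $\Omega=\mathbb{R}\times(0,d)$, and let $\alpha\in W^{1,\infty}(\mathbb{R})$ be real-valued with $\alpha(x)>0$ for all $x\in\mathbb{R}$. Let $H_\alpha$ be the Robin Laplacian in the complex Hilbert space $L^2(\Omega)$, that is, $H_\alpha\psi=-\Delta\psi$ on the domain of all $\psi\in W^{2,2}(\Omega)$ that satisfy $$-\partial_y\psi(x,0)+\alpha(x)\psi(x,0)=0,\qquad \partial_y\psi(x,d)+\alpha(x)\psi(x,d)=0\qquad\text{for a.e. } x\in\mathbb{R}$$ in the sense of traces. Suppose that $\alpha(x)\to\alpha_0$ as $|x|\to\infty$ for some $\alpha_0\in\mathbb{R}$. Then the transversal Robin problem $$-u''=Eu\ \text{ on }[0,d],\qquad -u'(0)+\alpha_0u(0)=0,\qquad u'(d)+\alpha_0u(d)=0$$ has a lowest eigenvalue $E_1(\alpha_0)$, and the essential spectrum of $H_\alpha$ is $$\sigma_{\mathrm{ess}}(H_\alpha)=[E_1(\alpha_0),\infty).$$ Here the essential spectrum is the spectrum with the isolated eigenvalues of finite multiplicity removed. -/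

import Mathlib

open MeasureTheory Set Filter Topology
open scoped ContDiff

noncomputable section

/-! ## Spectrum, discrete spectrum and essential spectrum of an unbounded operator -/

section Spectrum

variable {E : Type*} [NormedAddCommGroup E] [InnerProductSpace ℂ E]

/-- The resolvent set of an unbounded operator `A`: those `z` for which `A - z : D(A) → E` is a
bijection with bounded inverse `R`. -/
def unboundedResolventSet (A : E →ₗ.[ℂ] E) : Set ℂ :=
  {z | ∃ R : E →L[ℂ] E,
    (∀ f : E, ∃ h : R f ∈ A.domain, A ⟨R f, h⟩ - z • R f = f) ∧
    (∀ u : A.domain, R (A u - z • (u : E)) = u)}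

/-- The spectrum of an unbounded operator. -/
def unboundedSpectrum (A : E →ₗ.[ℂ] E) : Set ℂ :=
  (unboundedResolventSet A)ᶜ

/-- The kernel of `A - z`, as a subspace of the domain of `A`. -/
def unboundedEigenspace (A : E →ₗ.[ℂ] E) (z : ℂ) : Submodule ℂ A.domain :=
  LinearMap.ker (A.toFun - z • A.domain.subtype)

/-- The discrete spectrum (of a self-adjoint operator): the isolated points of the spectrum which
are eigenvalues of finite multiplicity. -/
def discreteSpectrum (A : E →ₗ.[ℂ] E) : Set ℂ :=
  {z | z ∈ unboundedSpectrum A ∧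
    (∃ U ∈ 𝓝 z, U ∩ unboundedSpectrum A = {z}) ∧
    unboundedEigenspace A z ≠ ⊥ ∧
    FiniteDimensional ℂ (unboundedEigenspace A z)}

/-- The essential spectrum (of a self-adjoint operator): the complement of the discrete spectrum
in the spectrum. -/
def essentialSpectrum (A : E →ₗ.[ℂ] E) : Set ℂ :=
  unboundedSpectrum A \ discreteSpectrum A

end Spectrum

/-! ## The Sobolev space `W^{1,∞}(ℝ)` -/

/-- `α ∈ W^{1,∞}(ℝ)`: `α` is essentially bounded and has an essentially bounded weak derivative. -/
def MemW1Infty (α : ℝ → ℝ) : Prop :=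
  MemLp α ⊤ volume ∧
    ∃ β : ℝ → ℝ, MemLp β ⊤ volume ∧
      ∀ φ : ℝ → ℝ, ContDiff ℝ ∞ φ → HasCompactSupport φ →
        ∫ x, deriv φ x * α x = -∫ x, φ x * β x

/-! ## Sobolev spaces on the strip and boundary traces -/

/-- The open strip `ℝ × (0, d)`. -/
def strip (d : ℝ) : Set (ℝ × ℝ) := univ ×ˢ Ioo 0 d

lemma isOpen_strip (d : ℝ) : IsOpen (strip d) := isOpen_univ.prod isOpen_Ioo

/-- The Hilbert space `L²(ℝ × (0, d); ℂ)`. -/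
abbrev L2Strip (d : ℝ) : Type :=
  Lp ℂ 2 ((volume : Measure (ℝ × ℝ)).restrict (strip d))

/-- `w ∈ L²` is the weak derivative of `u ∈ L²` on the strip in the direction `v`. -/
def IsWeakDeriv (d : ℝ) (v : ℝ × ℝ) (u w : L2Strip d) : Prop :=
  ∀ φ : ℝ × ℝ → ℝ, ContDiff ℝ ∞ φ → HasCompactSupport φ → tsupport φ ⊆ strip d →
    ∫ p in strip d, fderiv ℝ φ p v • u p = -∫ p in strip d, φ p • w p

/-- `ux` and `uy` are the weak partial derivatives of `u`. -/
def IsWeakGrad (d : ℝ) (u ux uy : L2Strip d) : Prop :=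
  IsWeakDeriv d (1, 0) u ux ∧ IsWeakDeriv d (0, 1) u uy

/-- The Sobolev space `W^{1,2}` of the strip. -/
def W12 (d : ℝ) : Set (L2Strip d) :=
  {u | ∃ ux uy, IsWeakGrad d u ux uy}

/-- The Sobolev space `W^{2,2}` of the strip. -/
def W22 (d : ℝ) : Set (L2Strip d) :=
  {u | ∃ ux uy, IsWeakGrad d u ux uy ∧ ux ∈ W12 d ∧ uy ∈ W12 d}

/-- `g ∈ L²(ℝ)` is the trace of `u ∈ W^{1,2}` on the line `y = c` (used for `c = 0` and `c = d`).
The trace operator is the continuous extension to `W^{1,2}` of the restriction `φ ↦ φ(·, c)` from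
the dense set of smooth functions with compact support in the plane. -/
def IsTrace (d c : ℝ) (u : L2Strip d) (g : Lp ℂ 2 (volume : Measure ℝ)) : Prop :=
  ∃ ux uy, IsWeakGrad d u ux uy ∧
    ∃ φ : ℕ → ℝ × ℝ → ℂ, (∀ n, ContDiff ℝ ∞ (φ n) ∧ HasCompactSupport (φ n)) ∧
      Tendsto (fun n => eLpNorm (fun p => φ n p - u p) 2 (volume.restrict (strip d)))
        atTop (𝓝 0) ∧
      Tendsto (fun n => eLpNorm (fun p => fderiv ℝ (φ n) p (1, 0) - ux p) 2
        (volume.restrict (strip d))) atTop (𝓝 0) ∧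
      Tendsto (fun n => eLpNorm (fun p => fderiv ℝ (φ n) p (0, 1) - uy p) 2
        (volume.restrict (strip d))) atTop (𝓝 0) ∧
      Tendsto (fun n => eLpNorm (fun x => φ n (x, c) - g x) 2 volume) atTop (𝓝 0)

/-- The Robin boundary conditions `-∂_y ψ(x,0) + α(x) ψ(x,0) = 0` and
`∂_y ψ(x,d) + α(x) ψ(x,d) = 0`, in the sense of traces. -/
def RobinBC (d : ℝ) (α : ℝ → ℝ) (ψ : L2Strip d) : Prop :=
  ∃ ψy, IsWeakDeriv d (0, 1) ψ ψy ∧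
    (∃ g h, IsTrace d 0 ψ g ∧ IsTrace d 0 ψy h ∧
      ∀ᵐ x ∂(volume : Measure ℝ), -h x + (α x : ℂ) * g x = 0) ∧
    (∃ g h, IsTrace d d ψ g ∧ IsTrace d d ψy h ∧
      ∀ᵐ x ∂(volume : Measure ℝ), h x + (α x : ℂ) * g x = 0)

/-- `F = ∂_x ∂_x ψ + ∂_y ∂_y ψ` with weak derivatives in `L²`. -/
def IsWeakLaplacian (d : ℝ) (ψ F : L2Strip d) : Prop :=
  ∃ ψx ψy ψxx ψyy, IsWeakGrad d ψ ψx ψy ∧ IsWeakDeriv d (1, 0) ψx ψxx ∧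
    IsWeakDeriv d (0, 1) ψy ψyy ∧ F = ψxx + ψyy

/-! ### Linearity and uniqueness facts needed to define the operator -/

section Helpers

variable {d c : ℝ} {v : ℝ × ℝ}

lemma integrable_smul_strip {φ : ℝ × ℝ → ℝ} (hc : Continuous φ) (hs : HasCompactSupport φ)
    (u : L2Strip d) : Integrable (fun p => φ p • u p) (volume.restrict (strip d)) := by
  have h1 : MemLp φ 2 (volume.restrict (strip d)) := hc.memLp_of_hasCompactSupport hs
  exact memLp_one_iff_integrable.1 ((Lp.memLp u).smul h1)

lemma continuous_fderiv_dir {F : Type*} [NormedAddCommGroup F] [NormedSpace ℝ F]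
    {φ : ℝ × ℝ → F} (h : ContDiff ℝ ∞ φ) (v : ℝ × ℝ) :
    Continuous (fun p => fderiv ℝ φ p v) :=
  (h.continuous_fderiv (by simp)).clm_apply continuous_const

lemma IsWeakDeriv.zero : IsWeakDeriv d v 0 0 := by
  intro φ _ _ _
  have h := Lp.coeFn_zero ℂ 2 ((volume : Measure (ℝ × ℝ)).restrict (strip d))
  have hz (f : ℝ × ℝ → ℝ) : ∫ p in strip d, f p • (0 : L2Strip d) p = 0 :=
    integral_eq_zero_of_ae (h.mono fun p hp => by simp only [hp, Pi.zero_apply, smul_zero])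
  rw [hz, hz, neg_zero]

lemma IsWeakDeriv.add {u w u' w' : L2Strip d} (h : IsWeakDeriv d v u w)
    (h' : IsWeakDeriv d v u' w') : IsWeakDeriv d v (u + u') (w + w') := by
  intro φ hφ hc hs
  have hD := continuous_fderiv_dir hφ v
  have hDc : HasCompactSupport (fun p => fderiv ℝ φ p v) := hc.fderiv_apply ℝ v
  have e (f : ℝ × ℝ → ℝ) (a b : L2Strip d) :
      ∫ p in strip d, f p • (a + b) p = ∫ p in strip d, (f p • a p + f p • b p) :=
    integral_congr_ae
      ((Lp.coeFn_add a b).mono fun p hp => by simp only [hp, Pi.add_apply, smul_add])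
  rw [e, e,
    integral_add (integrable_smul_strip hD hDc u) (integrable_smul_strip hD hDc u'),
    integral_add (integrable_smul_strip hφ.continuous hc w)
      (integrable_smul_strip hφ.continuous hc w'), h φ hφ hc hs, h' φ hφ hc hs]
  ring

lemma IsWeakDeriv.smul {u w : L2Strip d} (a : ℂ) (h : IsWeakDeriv d v u w) :
    IsWeakDeriv d v (a • u) (a • w) := by
  intro φ hφ hc hs
  have e (f : ℝ × ℝ → ℝ) (b : L2Strip d) :
      ∫ p in strip d, f p • (a • b) p = a • ∫ p in strip d, f p • b p := by
    rw [← integral_smul]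
    refine integral_congr_ae ((Lp.coeFn_smul a b).mono fun p hp => ?_)
    simp only [hp, Pi.smul_apply]
    exact smul_comm (f p) a (b p)
  rw [e, e, h φ hφ hc hs, smul_neg]

/-- Weak derivatives are unique. -/
lemma IsWeakDeriv.unique {u w w' : L2Strip d} (h : IsWeakDeriv d v u w)
    (h' : IsWeakDeriv d v u w') : w = w' := by
  have hz : IsWeakDeriv d v 0 (w + (-1 : ℂ) • w') := by
    have := h.add (h'.smul (-1))
    simpa using this
  have hloc : LocallyIntegrableOn (fun p => (w + (-1 : ℂ) • w') p) (strip d) volume := by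
    refine (locallyIntegrableOn_iff (isOpen_strip d).isLocallyClosed).2 fun k hk hc => ?_
    have hm := (Lp.memLp (w + (-1 : ℂ) • w')).locallyIntegrable (by norm_num)
    have := hm.integrableOn_isCompact hc
    rwa [IntegrableOn, Measure.restrict_restrict_of_subset hk] at this
  have key := (isOpen_strip d).ae_eq_zero_of_integral_contDiff_smul_eq_zero hloc (by
    intro g hg hgc hgs
    have h1 := hz g hg hgc hgs
    have h0 := Lp.coeFn_zero ℂ 2 ((volume : Measure (ℝ × ℝ)).restrict (strip d))
    rw [integral_congr_ae (g := fun _ => (0 : ℂ))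
      (h0.mono fun p hp => by simp only [hp, Pi.zero_apply, smul_zero])] at h1
    rw [integral_zero, eq_comm, neg_eq_zero] at h1
    rw [← h1, setIntegral_eq_integral_of_forall_compl_eq_zero]
    intro p hp
    rw [image_eq_zero_of_notMem_tsupport (fun hh => hp (hgs hh)), zero_smul])
  have h2 : w + (-1 : ℂ) • w' = 0 := by
    apply Lp.ext
    have h0 := Lp.coeFn_zero ℂ 2 ((volume : Measure (ℝ × ℝ)).restrict (strip d))
    have h3 := (ae_restrict_iff' (isOpen_strip d).measurableSet).2 key
    filter_upwards [h0, h3] with p hp hp'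
    rw [hp, hp', Pi.zero_apply]
  simpa [← sub_eq_add_neg, sub_eq_zero] using h2

lemma IsWeakGrad.zero : IsWeakGrad d 0 0 0 := ⟨.zero, .zero⟩

lemma IsWeakGrad.add {u ux uy u' ux' uy' : L2Strip d} (h : IsWeakGrad d u ux uy)
    (h' : IsWeakGrad d u' ux' uy') : IsWeakGrad d (u + u') (ux + ux') (uy + uy') :=
  ⟨h.1.add h'.1, h.2.add h'.2⟩

lemma IsWeakGrad.smul {u ux uy : L2Strip d} (a : ℂ) (h : IsWeakGrad d u ux uy) :
    IsWeakGrad d (a • u) (a • ux) (a • uy) :=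
  ⟨h.1.smul a, h.2.smul a⟩

lemma W12.zero : (0 : L2Strip d) ∈ W12 d := ⟨0, 0, .zero⟩

lemma W12.add {u u' : L2Strip d} : u ∈ W12 d → u' ∈ W12 d → u + u' ∈ W12 d := by
  rintro ⟨_, _, h⟩ ⟨_, _, h'⟩
  exact ⟨_, _, h.add h'⟩

lemma W12.smul {u : L2Strip d} (a : ℂ) : u ∈ W12 d → a • u ∈ W12 d := by
  rintro ⟨_, _, h⟩
  exact ⟨_, _, h.smul a⟩

lemma tendsto_eLpNorm_add_aux {X : Type*} [MeasurableSpace X] {μ : Measure X}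
    {f f' : ℕ → X → ℂ} {g : ℕ → X → ℂ}
    (hm : ∀ n, AEStronglyMeasurable (f n) μ) (hm' : ∀ n, AEStronglyMeasurable (f' n) μ)
    (hg : ∀ n, g n =ᵐ[μ] f n + f' n)
    (h : Tendsto (fun n => eLpNorm (f n) 2 μ) atTop (𝓝 0))
    (h' : Tendsto (fun n => eLpNorm (f' n) 2 μ) atTop (𝓝 0)) :
    Tendsto (fun n => eLpNorm (g n) 2 μ) atTop (𝓝 0) := by
  have hs : Tendsto (fun n => eLpNorm (f n) 2 μ + eLpNorm (f' n) 2 μ) atTop (𝓝 0) := by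
    simpa using h.add h'
  refine tendsto_of_tendsto_of_tendsto_of_le_of_le tendsto_const_nhds hs
    (fun _ => zero_le) (fun n => ?_)
  simp only
  rw [eLpNorm_congr_ae (hg n)]
  exact eLpNorm_add_le (hm n) (hm' n) (by norm_num)

lemma tendsto_eLpNorm_smul_aux {X : Type*} [MeasurableSpace X] {μ : Measure X}
    {f : ℕ → X → ℂ} {g : ℕ → X → ℂ} (a : ℂ)
    (hg : ∀ n, g n =ᵐ[μ] a • f n)
    (h : Tendsto (fun n => eLpNorm (f n) 2 μ) atTop (𝓝 0)) :
    Tendsto (fun n => eLpNorm (g n) 2 μ) atTop (𝓝 0) := by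
  have hs : Tendsto (fun n => ‖a‖ₑ * eLpNorm (f n) 2 μ) atTop (𝓝 0) := by
    simpa using ENNReal.Tendsto.const_mul h (Or.inr enorm_ne_top)
  refine hs.congr (fun n => ?_)
  rw [eLpNorm_congr_ae (hg n), eLpNorm_const_smul]

lemma IsTrace.zero : IsTrace d c 0 0 := by
  have h0 := Lp.coeFn_zero ℂ 2 ((volume : Measure (ℝ × ℝ)).restrict (strip d))
  have h1 := Lp.coeFn_zero ℂ 2 (volume : Measure ℝ)
  refine ⟨0, 0, .zero, fun _ _ => 0, fun n => ⟨contDiff_const, .zero⟩, ?_, ?_, ?_, ?_⟩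
  · refine tendsto_const_nhds.congr fun n => ?_
    rw [eLpNorm_congr_ae (g := 0) 
      (h0.mono fun p hp => by simp only [hp, Pi.zero_apply, sub_self, fderiv_fun_const,
        _root_.zero_apply]), eLpNorm_zero]
  · refine tendsto_const_nhds.congr fun n => ?_
    rw [eLpNorm_congr_ae (g := 0) 
      (h0.mono fun p hp => by simp only [hp, Pi.zero_apply, sub_self, fderiv_fun_const,
        _root_.zero_apply]), eLpNorm_zero]
  · refine tendsto_const_nhds.congr fun n => ?_
    rw [eLpNorm_congr_ae (g := 0) 
      (h0.mono fun p hp => by simp only [hp, Pi.zero_apply, sub_self, fderiv_fun_const,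
        _root_.zero_apply]), eLpNorm_zero]
  · refine tendsto_const_nhds.congr fun n => ?_
    rw [eLpNorm_congr_ae (g := 0) 
      (h1.mono fun p hp => by simp only [hp, Pi.zero_apply, sub_self, fderiv_fun_const,
        _root_.zero_apply]), eLpNorm_zero]

lemma IsTrace.add {u u' : L2Strip d} {g g' : Lp ℂ 2 (volume : Measure ℝ)}
    (h : IsTrace d c u g) (h' : IsTrace d c u' g') : IsTrace d c (u + u') (g + g') := by
  obtain ⟨ux, uy, hu, φ, hφ, h1, h2, h3, h4⟩ := h
  obtain ⟨ux', uy', hu', φ', hφ', h1', h2', h3', h4'⟩ := h'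
  have hd (n : ℕ) (p v : ℝ × ℝ) : fderiv ℝ (φ n + φ' n) p v =
      fderiv ℝ (φ n) p v + fderiv ℝ (φ' n) p v := by
    rw [fderiv_add ((hφ n).1.differentiable (by simp) p) ((hφ' n).1.differentiable (by simp) p)]
    rfl
  have m0 (n : ℕ) (w : L2Strip d) := (hφ n).1.continuous.aestronglyMeasurable.sub
    (Lp.aestronglyMeasurable w)
  have m0' (n : ℕ) (w : L2Strip d) := (hφ' n).1.continuous.aestronglyMeasurable.sub
    (Lp.aestronglyMeasurable w)
  have m1 (n : ℕ) (v : ℝ × ℝ) (w : L2Strip d) :=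
    (continuous_fderiv_dir (hφ n).1 v).aestronglyMeasurable.sub (Lp.aestronglyMeasurable w)
  have m1' (n : ℕ) (v : ℝ × ℝ) (w : L2Strip d) :=
    (continuous_fderiv_dir (hφ' n).1 v).aestronglyMeasurable.sub (Lp.aestronglyMeasurable w)
  have e (n : ℕ) : Continuous (fun x : ℝ => φ n (x, c)) :=
    (hφ n).1.continuous.comp (by fun_prop)
  have e' (n : ℕ) : Continuous (fun x : ℝ => φ' n (x, c)) :=
    (hφ' n).1.continuous.comp (by fun_prop)
  refine ⟨ux + ux', uy + uy', hu.add hu', fun n => φ n + φ' n,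
    fun n => ⟨(hφ n).1.add (hφ' n).1, (hφ n).2.add (hφ' n).2⟩, ?_, ?_, ?_, ?_⟩
  · refine tendsto_eLpNorm_add_aux (fun n => m0 n u) (fun n => m0' n u') (fun n => ?_) h1 h1'
    filter_upwards [Lp.coeFn_add u u'] with p hp
    simp only [hp, Pi.add_apply, Pi.sub_apply]
    ring
  · refine tendsto_eLpNorm_add_aux (fun n => m1 n _ ux) (fun n => m1' n _ ux')
      (fun n => ?_) h2 h2'
    filter_upwards [Lp.coeFn_add ux ux'] with p hp
    simp only [hp, hd, Pi.add_apply, Pi.sub_apply]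
    ring
  · refine tendsto_eLpNorm_add_aux (fun n => m1 n _ uy) (fun n => m1' n _ uy')
      (fun n => ?_) h3 h3'
    filter_upwards [Lp.coeFn_add uy uy'] with p hp
    simp only [hp, hd, Pi.add_apply, Pi.sub_apply]
    ring
  · refine tendsto_eLpNorm_add_aux
      (fun n => (e n).aestronglyMeasurable.sub (Lp.aestronglyMeasurable g))
      (fun n => (e' n).aestronglyMeasurable.sub (Lp.aestronglyMeasurable g'))
      (fun n => ?_) h4 h4'
    filter_upwards [Lp.coeFn_add g g'] with p hp
    simp only [hp, Pi.add_apply, Pi.sub_apply]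
    ring

lemma IsTrace.smul {u : L2Strip d} {g : Lp ℂ 2 (volume : Measure ℝ)} (a : ℂ)
    (h : IsTrace d c u g) : IsTrace d c (a • u) (a • g) := by
  obtain ⟨ux, uy, hu, φ, hφ, h1, h2, h3, h4⟩ := h
  have hd (n : ℕ) (p v : ℝ × ℝ) : fderiv ℝ (a • φ n) p v = a • fderiv ℝ (φ n) p v := by
    rw [fderiv_const_smul ((hφ n).1.differentiable (by simp) p)]
    rfl
  refine ⟨a • ux, a • uy, hu.smul a, fun n => a • φ n,
    fun n => ⟨contDiff_const.smul (hφ n).1, (hφ n).2.smul_left (f := fun _ => a)⟩, ?_, ?_, ?_, ?_⟩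
  · refine tendsto_eLpNorm_smul_aux a (fun n => ?_) h1
    filter_upwards [Lp.coeFn_smul a u] with p hp
    simp only [hp, Pi.smul_apply, smul_sub]
  · refine tendsto_eLpNorm_smul_aux a (fun n => ?_) h2
    filter_upwards [Lp.coeFn_smul a ux] with p hp
    simp only [hp, hd, Pi.smul_apply, smul_sub]
  · refine tendsto_eLpNorm_smul_aux a (fun n => ?_) h3
    filter_upwards [Lp.coeFn_smul a uy] with p hp
    simp only [hp, hd, Pi.smul_apply, smul_sub]
  · refine tendsto_eLpNorm_smul_aux a (fun n => ?_) h4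
    filter_upwards [Lp.coeFn_smul a g] with p hp
    simp only [hp, Pi.smul_apply, smul_sub]

lemma RobinBC.zero {α : ℝ → ℝ} : RobinBC d α 0 := by
  have h1 := Lp.coeFn_zero ℂ 2 (volume : Measure ℝ)
  refine ⟨0, .zero, ⟨0, 0, .zero, .zero, ?_⟩, ⟨0, 0, .zero, .zero, ?_⟩⟩ <;>
  · filter_upwards [h1] with x hx
    simp only [hx, Pi.zero_apply, mul_zero, neg_zero, add_zero]

lemma RobinBC.add {α : ℝ → ℝ} {u u' : L2Strip d} (h : RobinBC d α u) (h' : RobinBC d α u') :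
    RobinBC d α (u + u') := by
  obtain ⟨w, hw, ⟨g, k, hg, hk, e⟩, ⟨g1, k1, hg1, hk1, e1⟩⟩ := h
  obtain ⟨w', hw', ⟨g', k', hg', hk', e'⟩, ⟨g1', k1', hg1', hk1', e1'⟩⟩ := h'
  refine ⟨w + w', hw.add hw', ⟨g + g', k + k', hg.add hg', hk.add hk', ?_⟩,
    ⟨g1 + g1', k1 + k1', hg1.add hg1', hk1.add hk1', ?_⟩⟩
  · filter_upwards [e, e', Lp.coeFn_add g g', Lp.coeFn_add k k'] with x h1 h2 h3 h4
    simp only [h3, h4, Pi.add_apply]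
    linear_combination h1 + h2
  · filter_upwards [e1, e1', Lp.coeFn_add g1 g1', Lp.coeFn_add k1 k1'] with x h1 h2 h3 h4
    simp only [h3, h4, Pi.add_apply]
    linear_combination h1 + h2

lemma RobinBC.smul {α : ℝ → ℝ} {u : L2Strip d} (a : ℂ) (h : RobinBC d α u) :
    RobinBC d α (a • u) := by
  obtain ⟨w, hw, ⟨g, k, hg, hk, e⟩, ⟨g1, k1, hg1, hk1, e1⟩⟩ := h
  refine ⟨a • w, hw.smul a, ⟨a • g, a • k, hg.smul a, hk.smul a, ?_⟩,
    ⟨a • g1, a • k1, hg1.smul a, hk1.smul a, ?_⟩⟩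
  · filter_upwards [e, Lp.coeFn_smul a g, Lp.coeFn_smul a k] with x h1 h3 h4
    simp only [h3, h4, Pi.smul_apply, smul_eq_mul]
    linear_combination a * h1
  · filter_upwards [e1, Lp.coeFn_smul a g1, Lp.coeFn_smul a k1] with x h1 h3 h4
    simp only [h3, h4, Pi.smul_apply, smul_eq_mul]
    linear_combination a * h1

lemma IsWeakLaplacian.add {u F u' F' : L2Strip d} (h : IsWeakLaplacian d u F)
    (h' : IsWeakLaplacian d u' F') : IsWeakLaplacian d (u + u') (F + F') := by
  obtain ⟨ux, uy, uxx, uyy, hg, hx, hy, rfl⟩ := h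
  obtain ⟨ux', uy', uxx', uyy', hg', hx', hy', rfl⟩ := h'
  exact ⟨_, _, _, _, hg.add hg', hx.add hx', hy.add hy', by abel⟩

lemma IsWeakLaplacian.smul {u F : L2Strip d} (a : ℂ) (h : IsWeakLaplacian d u F) :
    IsWeakLaplacian d (a • u) (a • F) := by
  obtain ⟨ux, uy, uxx, uyy, hg, hx, hy, rfl⟩ := h
  exact ⟨_, _, _, _, hg.smul a, hx.smul a, hy.smul a, smul_add _ _ _⟩

lemma IsWeakLaplacian.unique {u F F' : L2Strip d} (h : IsWeakLaplacian d u F)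
    (h' : IsWeakLaplacian d u F') : F = F' := by
  obtain ⟨ux, uy, uxx, uyy, hg, hx, hy, rfl⟩ := h
  obtain ⟨ux', uy', uxx', uyy', hg', hx', hy', rfl⟩ := h'
  obtain rfl := hg.1.unique hg'.1
  obtain rfl := hg.2.unique hg'.2
  rw [hx.unique hx', hy.unique hy']

lemma exists_weakLaplacian {u : L2Strip d} (h : u ∈ W22 d) : ∃ F, IsWeakLaplacian d u F := by
  obtain ⟨ux, uy, hg, ⟨uxx, uxy, hx⟩, ⟨uyx, uyy, hy⟩⟩ := h
  exact ⟨uxx + uyy, ux, uy, uxx, uyy, hg, hx.1, hy.2, rfl⟩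

end Helpers

/-! ## The Robin Laplacian on the strip -/

/-- The domain `{ψ ∈ W^{2,2} | ψ satisfies the Robin boundary conditions}`. -/
def robinDomain (d : ℝ) (α : ℝ → ℝ) : Submodule ℂ (L2Strip d) where
  carrier := {ψ | ψ ∈ W22 d ∧ RobinBC d α ψ}
  zero_mem' := ⟨⟨0, 0, .zero, W12.zero, W12.zero⟩, .zero⟩
  add_mem' := by
    rintro _ _ ⟨⟨_, _, h1, h2, h3⟩, h4⟩ ⟨⟨_, _, h1', h2', h3'⟩, h4'⟩
    exact ⟨⟨_, _, h1.add h1', W12.add h2 h2', W12.add h3 h3'⟩, h4.add h4'⟩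
  smul_mem' := by
    rintro a _ ⟨⟨_, _, h1, h2, h3⟩, h4⟩
    exact ⟨⟨_, _, h1.smul a, W12.smul a h2, W12.smul a h3⟩, h4.smul a⟩

/-- The operator `H_α ψ = -Δψ` in `L²(ℝ × (0, d))` with domain `robinDomain d α`. -/
def robinLaplacian (d : ℝ) (α : ℝ → ℝ) : L2Strip d →ₗ.[ℂ] L2Strip d where
  domain := robinDomain d α
  toFun :=
    { toFun := fun ψ => -Classical.choose (exists_weakLaplacian ψ.2.1)
      map_add' := fun ψ ψ' => by
        have h := Classical.choose_spec (exists_weakLaplacian ψ.2.1)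
        have h' := Classical.choose_spec (exists_weakLaplacian ψ'.2.1)
        have hs := Classical.choose_spec (exists_weakLaplacian (ψ + ψ').2.1)
        rw [hs.unique (h.add h'), neg_add]
      map_smul' := fun a ψ => by
        have h := Classical.choose_spec (exists_weakLaplacian ψ.2.1)
        have hs := Classical.choose_spec (exists_weakLaplacian (a • ψ).2.1)
        rw [hs.unique (h.smul a), RingHom.id_apply, smul_neg] }

/-- On its domain, `H_α ψ` is minus the weak Laplacian of `ψ`. -/
lemma robinLaplacian_spec (d : ℝ) (α : ℝ → ℝ) (ψ : (robinLaplacian d α).domain) :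
    IsWeakLaplacian d (ψ : L2Strip d) (-(robinLaplacian d α ψ)) := by
  have h := Classical.choose_spec (exists_weakLaplacian ψ.2.1)
  have e : robinLaplacian d α ψ = -Classical.choose (exists_weakLaplacian ψ.2.1) := rfl
  rw [e, neg_neg]
  exact h

/-! ## The transversal Robin problem -/

/-- The eigenvalues of the Robin problem `-u'' = E u` on `[0, d]`, `-u'(0) + a u(0) = 0`,
`u'(d) + a u(d) = 0` (with `v = u'`). -/
def transversalEigenvalues (d a : ℝ) : Set ℝ :=
  {E | ∃ u v : ℝ → ℂ,
    (∀ y ∈ Icc 0 d, HasDerivWithinAt u (v y) (Icc 0 d) y) ∧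
    (∀ y ∈ Icc 0 d, HasDerivWithinAt v (-(E : ℂ) * u y) (Icc 0 d) y) ∧
    -v 0 + (a : ℂ) * u 0 = 0 ∧
    v d + (a : ℂ) * u d = 0 ∧
    ∃ y ∈ Icc 0 d, u y ≠ 0}

/-- The lowest transversal eigenvalue `E₁(a)`. -/
def lowestTransversalEigenvalue (d a : ℝ) : ℝ :=
  sInf (transversalEigenvalues d a)

end

/-! ### Operators associated with nonnegative forms, and their essential spectrum -/

section FormOperator

open scoped InnerProductSpace
open ContinuousLinearMap (adjoint adjoint_inner_left adjoint_inner_right)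

/-! The lowest transversal eigenvalue is `κ ^ 2`, where `κ tan (κ d / 2) = α₀` and `0 ≤ κ d < π`;
its eigenfunction `cos (κ (y - d / 2))` has no zero on `[0, d]`. The spectrum of the Robin Laplacian
is read off its quadratic form on `W^{1,2}`, the Dirichlet integral plus the integrals of `α |ψ|²`
over the two boundary lines. Positivity of `α` makes this form nonnegative.

Every `l ≥ κ ^ 2` lies in the spectrum (`exists_approximate_eigenvector`): multiply the transversal
ground state by a slowly modulated plane wave `exp (i k x)` with `k ^ 2 = l - κ ^ 2`, supported so
far out that `α` is close to `α₀`. As these `l` fill a half-line, none of them is isolated in the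
spectrum.

For `t < κ ^ 2` the form minus `t ‖ψ‖²` is coercive up to a term of finite rank
(`boundedBelowFiniteRank_robinForm`). Where `|x|` is large, each vertical slice satisfies the
transversal inequality with a coupling close to `α₀`. The remaining rectangle is cut into small
cells, on which Poincaré's inequality controls `ψ` by its gradient and by finitely many cell
averages; this takes the place of a compact embedding. By the Fredholm alternative, spectral points
below `κ ^ 2` are eigenvalues of finite multiplicity, and a dimension count leaves only finitely
many of them below each `t < κ ^ 2`, so they are isolated. `IsFormOperator.essentialSpectrum_eq`
puts the two halves together.

The operator has its domain in `W^{2,2}`, so it has to be matched with the form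
(`isFormOperator_robinLaplacian`). Green's formula gives one direction. The other is elliptic
regularity: since `α` is Lipschitz, Nirenberg's difference quotients in `x` give the second
derivatives involving `x`, and the equation gives the remaining one. Traces and Green's formula rest
on the density of restricted test functions in `W^{1,2}` (`denseRange_jet`). -/

lemma mem_unboundedEigenspace {H : Type*} [NormedAddCommGroup H] [InnerProductSpace ℂ H]
    {A : H →ₗ.[ℂ] H} (z : ℂ) (u : A.domain) :
    u ∈ unboundedEigenspace A z ↔ A u = z • (u : H) := by
  change A.toFun u - z • (u : H) = 0 ↔ _
  rw [sub_eq_zero]; rfl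

variable {H V : Type*} [NormedAddCommGroup H] [InnerProductSpace ℂ H] [CompleteSpace H]
  [NormedAddCommGroup V] [InnerProductSpace ℂ V] [CompleteSpace V]

/-- `A` is the operator associated with the nonnegative symmetric form `(U, W) ↦ ⟪T U, W⟫` on the
form domain `V`, which is mapped to the Hilbert space `H` by `ι`. -/
structure IsFormOperator (A : H →ₗ.[ℂ] H) (ι : V →L[ℂ] H) (T : V →L[ℂ] V) : Prop where
  exists_of_domain : ∀ u : A.domain, ∃ U, ι U = u ∧ T U = adjoint ι (A u)
  mem_domain : ∀ U g, T U = adjoint ι g → ∃ h : ι U ∈ A.domain, A ⟨ι U, h⟩ = g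
  symm : ∀ U W, ⟪T U, W⟫_ℂ = ⟪U, T W⟫_ℂ
  nonneg : ∀ U, 0 ≤ (⟪T U, U⟫_ℂ).re
  norm_sq_le : ∀ U, ‖U‖ ^ 2 ≤ (⟪T U, U⟫_ℂ).re + ‖ι U‖ ^ 2

namespace IsFormOperator

variable {A : H →ₗ.[ℂ] H} {ι : V →L[ℂ] H} {T : V →L[ℂ] V}

lemma inner_self_eq (hA : IsFormOperator A ι T) (U : V) :
    ⟪T U, U⟫_ℂ = ((⟪T U, U⟫_ℂ).re : ℂ) := by
  have h : (starRingEnd ℂ) ⟪T U, U⟫_ℂ = ⟪T U, U⟫_ℂ := by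
    rw [inner_conj_symm, ← hA.symm]
  exact (Complex.conj_eq_iff_re.1 h).symm

/-- The shifted and perturbed form operator `T - z ι†ι + ι†Fι`. -/
noncomputable def shifted (ι : V →L[ℂ] H) (T : V →L[ℂ] V) (F : H →L[ℂ] H) (z : ℂ) : V →L[ℂ] V :=
  T - z • (adjoint ι ∘L ι) + adjoint ι ∘L F ∘L ι

lemma shifted_apply (F : H →L[ℂ] H) (z : ℂ) (U : V) :
    shifted ι T F z U = T U - z • adjoint ι (ι U) + adjoint ι (F (ι U)) := rfl

/-- With `B` the shifted form operator, `S = ι B⁻¹ ι†` is the candidate for the inverse of `A - z +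
F`. The first property is the form version of `(A - z + F) S = 1`, the second is `S (A - z + F) = 1`
on the domain. -/
lemma exists_solution (hA : IsFormOperator A ι T) {F : H →L[ℂ] H} {z : ℂ}
    (hB : IsUnit (shifted ι T F z)) :
    ∃ S : H →L[ℂ] H, (∀ g, ∃ U, ι U = S g ∧ T U = adjoint ι (g + z • S g - F (S g))) ∧
      ∀ u : A.domain, S (A u - z • (u : H) + F u) = u := by
  obtain ⟨B, hB⟩ := hB
  have h1 (x : V) : shifted ι T F z ((B⁻¹ : (V →L[ℂ] V)ˣ).1 x) = x := by
    rw [← hB]; exact congrArg (fun L : V →L[ℂ] V => L x) B.mul_inv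
  have h2 (x : V) : (B⁻¹ : (V →L[ℂ] V)ˣ).1 (shifted ι T F z x) = x := by
    rw [← hB]; exact congrArg (fun L : V →L[ℂ] V => L x) B.inv_mul
  refine ⟨ι ∘L (B⁻¹ : (V →L[ℂ] V)ˣ).1 ∘L adjoint ι, fun g => ?_, fun u => ?_⟩
  · refine ⟨(B⁻¹ : (V →L[ℂ] V)ˣ).1 (adjoint ι g), rfl, ?_⟩
    have := h1 (adjoint ι g)
    rw [shifted_apply] at this
    set X := (B⁻¹ : (V →L[ℂ] V)ˣ).1 (adjoint ι g)
    change T X = adjoint ι (g + z • ι X - F (ι X))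
    rw [map_sub, map_add, map_smul, ← this]
    abel
  · obtain ⟨U, hU, hT⟩ := hA.exists_of_domain u
    have : adjoint ι (A u - z • (u : H) + F u) = shifted ι T F z U := by
      rw [shifted_apply, hU, hT]; simp
    rw [ContinuousLinearMap.comp_apply, ContinuousLinearMap.comp_apply, this, h2, hU]

/-- The perturbation `F` is undone: `(A - z) r = f` amounts to `r = S (f + F r)`, so the resolvent
is `(1 - S F)⁻¹ S`. -/
lemma mem_resolventSet (hA : IsFormOperator A ι T) {F S : H →L[ℂ] H} {z : ℂ}
    (h1 : ∀ g, ∃ U, ι U = S g ∧ T U = adjoint ι (g + z • S g - F (S g)))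
    (h2 : ∀ u : A.domain, S (A u - z • (u : H) + F u) = u)
    (hu : IsUnit (1 - S ∘L F)) : z ∈ unboundedResolventSet A := by
  obtain ⟨B, hB⟩ := hu
  have e1 (x : H) : (B⁻¹ : (H →L[ℂ] H)ˣ).1 x - S (F ((B⁻¹ : (H →L[ℂ] H)ˣ).1 x)) = x := by
    have := congrArg (fun L : H →L[ℂ] H => L x) B.mul_inv
    rw [hB] at this; exact this
  have e2 (x : H) : (B⁻¹ : (H →L[ℂ] H)ˣ).1 (x - S (F x)) = x := by
    have := congrArg (fun L : H →L[ℂ] H => L x) B.inv_mul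
    rw [hB] at this; exact this
  refine ⟨(B⁻¹ : (H →L[ℂ] H)ˣ).1 ∘L S, fun f => ?_, fun u => ?_⟩
  · set r := ((B⁻¹ : (H →L[ℂ] H)ˣ).1 ∘L S) f with hr
    have hr1 : r = S (f + F r) := by
      rw [map_add, ← sub_eq_iff_eq_add]; exact e1 (S f)
    obtain ⟨U, hU, hT⟩ := h1 (f + F r)
    rw [← hr1] at hU hT
    have e : f + F r + z • r - F r = f + z • r := by abel
    rw [e] at hT
    obtain ⟨h, hh⟩ := hA.mem_domain U _ hT
    rw [← hU]
    refine ⟨h, ?_⟩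
    rw [hh, hU]; abel
  · have : S (A u - z • (u : H)) = u - S (F u) := by
      rw [eq_sub_iff_add_eq, ← map_add, h2]
    rw [ContinuousLinearMap.comp_apply, this, e2]

/-- Coercivity away from `[0, ∞)`, to be used with `x` the value of the form and `y = ‖ι U‖²`. For
real `z < 0` both terms have the same sign; otherwise the imaginary part controls `y`, and then the
triangle inequality controls `x`. -/
lemma exists_lower_bound_of_notMem (z : ℂ) (hz : ¬ ∃ t : ℝ, 0 ≤ t ∧ (t : ℂ) = z) :
    ∃ c : ℝ, 0 < c ∧ ∀ x y : ℝ, 0 ≤ x → 0 ≤ y → c * (x + y) ≤ ‖(x : ℂ) - z * y‖ := by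
  by_cases hi : z.im = 0
  · have hre : z.re < 0 := by
      by_contra! h
      exact hz ⟨z.re, h, Complex.ext rfl (by simp [hi])⟩
    refine ⟨min 1 (-z.re), lt_min one_pos (by linarith), fun x y hx hy => ?_⟩
    have h1 : x - z.re * y ≤ ‖(x : ℂ) - z * y‖ := by
      have := Complex.re_le_norm ((x : ℂ) - z * y)
      simpa using this
    have h2 := min_le_left 1 (-z.re)
    have h3 := min_le_right 1 (-z.re)
    nlinarith
  · set c := |z.im|
    have hc : 0 < c := abs_pos.2 hi
    refine ⟨c / (1 + c + ‖z‖), by positivity, fun x y hx hy => ?_⟩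
    have h1 : c * y ≤ ‖(x : ℂ) - z * y‖ := by
      have := Complex.abs_im_le_norm ((x : ℂ) - z * y)
      simpa [abs_mul, abs_of_nonneg hy, c] using this
    have h2 : x - ‖z‖ * y ≤ ‖(x : ℂ) - z * y‖ := by
      have := norm_sub_norm_le (x : ℂ) (z * y)
      simpa [abs_of_nonneg hy, abs_of_nonneg hx] using this
    rw [div_mul_eq_mul_div, div_le_iff₀ (by positivity)]
    nlinarith [norm_nonneg z]

/-- The Lax–Milgram theorem. -/
lemma isUnit_of_lower_bound {B : V →L[ℂ] V} {c : ℝ} (hc : 0 < c)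
    (h : ∀ U, c * ‖U‖ ^ 2 ≤ ‖⟪B U, U⟫_ℂ‖) : IsUnit B :=
  B.isUnit_of_forall_le_norm_inner_map (c := ⟨c, hc.le⟩) hc fun x => by
    rw [mul_comm]; exact h x

lemma notMem_spectrum_of_notMem (hA : IsFormOperator A ι T) (z : ℂ)
    (hz : ¬ ∃ t : ℝ, 0 ≤ t ∧ (t : ℂ) = z) : z ∉ unboundedSpectrum A := by
  obtain ⟨c, hc, h⟩ := exists_lower_bound_of_notMem z hz
  have hB : IsUnit (shifted ι T 0 z) := by
    refine isUnit_of_lower_bound hc fun U => ?_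
    have e : ⟪U, shifted ι T 0 z U⟫_ℂ = ((⟪T U, U⟫_ℂ).re : ℂ) - z * ((‖ι U‖ ^ 2 : ℝ) : ℂ) := by
      rw [shifted_apply, inner_add_right, inner_sub_right, inner_smul_right, adjoint_inner_right,
        ← hA.symm, ← hA.inner_self_eq, inner_self_eq_norm_sq_to_K]
      simp
    rw [← norm_inner_symm, e]
    exact (mul_le_mul_of_nonneg_left (hA.norm_sq_le U) hc.le).trans
      (h _ _ (hA.nonneg U) (by positivity))
  obtain ⟨S, h1, h2⟩ := hA.exists_solution hB
  exact fun hn => hn (hA.mem_resolventSet h1 h2 (by simp))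

/-- The form is bounded below by `t`, up to a perturbation of finite rank. -/
def BoundedBelowFiniteRank (ι : V →L[ℂ] H) (T : V →L[ℂ] V) (t : ℝ) : Prop :=
  ∃ (J : Type) (_ : Fintype J) (a : H →L[ℂ] EuclideanSpace ℂ J) (c : ℝ), 0 < c ∧
    ∀ U, c * ‖U‖ ^ 2 ≤ (⟪T U, U⟫_ℂ).re - t * ‖ι U‖ ^ 2 + ‖a (ι U)‖ ^ 2

/-- Fredholm alternative. Adding `F = a† a` makes the form at level `t` coercive, and `S F` is
compact because `a` has finite rank. Either `1` is an eigenvalue of `S F`, which gives an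
eigenvector of `A`, or `1 - S F` is invertible and `t` is in the resolvent set. An eigenvector
killed by `a` is zero, so `a` is injective on the eigenspace. -/
lemma eigenspace_of_mem_spectrum (hA : IsFormOperator A ι T) {t : ℝ}
    (ht : BoundedBelowFiniteRank ι T t) (hs : (t : ℂ) ∈ unboundedSpectrum A) :
    unboundedEigenspace A t ≠ ⊥ ∧ FiniteDimensional ℂ (unboundedEigenspace A t) := by
  obtain ⟨J, _, a, c, hc, h⟩ := ht
  set F := adjoint a ∘L a with hF
  have hB : IsUnit (shifted ι T F t) := by
    refine isUnit_of_lower_bound hc fun U => ?_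
    have e : ⟪U, shifted ι T F t U⟫_ℂ =
        (((⟪T U, U⟫_ℂ).re - t * ‖ι U‖ ^ 2 + ‖a (ι U)‖ ^ 2 : ℝ) : ℂ) := by
      rw [shifted_apply, inner_add_right, inner_sub_right, inner_smul_right, adjoint_inner_right,
        adjoint_inner_right, hF, ContinuousLinearMap.comp_apply, adjoint_inner_right,
        inner_self_eq_norm_sq_to_K, inner_self_eq_norm_sq_to_K, ← hA.symm, hA.inner_self_eq]
      push_cast; rfl
    rw [← norm_inner_symm, e, Complex.norm_real]
    exact (h U).trans (le_abs_self _)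
  obtain ⟨S, h1, h2⟩ := hA.exists_solution hB
  have hcomp : IsCompactOperator (S ∘L F) :=
    ((isCompactOperator_id (E := EuclideanSpace ℂ J)).comp_clm a).clm_comp (S ∘L adjoint a)
  have key (r : H) (hr : S (F r) = r) : ∃ h : r ∈ A.domain, A ⟨r, h⟩ = (t : ℂ) • r := by
    obtain ⟨U, hU, hT⟩ := h1 (F r)
    rw [hr] at hU hT
    rw [add_sub_cancel_left] at hT
    obtain ⟨h, hh⟩ := hA.mem_domain U _ hT
    subst hU
    exact ⟨h, hh⟩
  constructor
  · rcases hcomp.hasEigenvalue_or_mem_resolventSet (μ := 1) one_ne_zero with h3 | h3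
    · obtain ⟨r, hr⟩ := h3.exists_hasEigenvector
      have hr1 : S (F r) = r := by simpa using hr.apply_eq_smul
      obtain ⟨hd, he⟩ := key r hr1
      intro hbot
      have : (⟨r, hd⟩ : A.domain) ∈ unboundedEigenspace A t :=
        (mem_unboundedEigenspace _ _).2 he
      rw [hbot, Submodule.mem_bot] at this
      exact hr.2 (congrArg Subtype.val this)
    · exact (hs (hA.mem_resolventSet h1 h2 (by simpa [spectrum.mem_resolventSet_iff] using h3))).elim
  · let f : unboundedEigenspace A t →ₗ[ℂ] EuclideanSpace ℂ J :=
      a.toLinearMap ∘ₗ A.domain.subtype ∘ₗ (unboundedEigenspace A t).subtype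
    refine FiniteDimensional.of_injective f ((injective_iff_map_eq_zero f).2 fun u hu => ?_)
    have e := (mem_unboundedEigenspace _ _).1 u.2
    have e2 := h2 u
    have e3 : F ((u : A.domain) : H) = 0 := by
      rw [hF, ContinuousLinearMap.comp_apply]
      change adjoint a (f u) = 0
      rw [hu, map_zero]
    rw [e, sub_self, zero_add, e3, map_zero] at e2
    exact Subtype.ext (Subtype.ext e2.symm)

/-- Below a level where the form is bounded below up to finite rank, there are finitely many
eigenvalues. -/
lemma finite_eigenvalues_lt (hA : IsFormOperator A ι T) {t : ℝ}
    (ht : BoundedBelowFiniteRank ι T t) :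
    {s : ℝ | s < t ∧ unboundedEigenspace A s ≠ ⊥}.Finite := by
  obtain ⟨J, _, a, c, hc, h⟩ := ht
  by_contra hinf
  -- One eigenvalue more than the dimension of the target of `a`: some nonzero combination `W` of
  -- eigenvectors is killed by `a`. Eigenvectors being orthogonal, the form at `W` is below `t ‖ι
  -- W‖²`, against the assumed bound.
  obtain ⟨L, hL, hcard⟩ := Set.Infinite.exists_subset_card_eq hinf (Fintype.card J + 1)
  have hex (s : L) : ∃ U : V, ι U ≠ 0 ∧ T U = ((s : ℝ) : ℂ) • adjoint ι (ι U) := by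
    obtain ⟨u, hu, hne⟩ := Submodule.exists_mem_ne_zero_of_ne_bot (hL s.2).2
    rw [mem_unboundedEigenspace] at hu
    obtain ⟨U, hU, hT⟩ := hA.exists_of_domain u
    refine ⟨U, ?_, ?_⟩
    · rw [hU]; exact fun h => hne (Subtype.ext h)
    · rw [hT, hu, hU, map_smul]
  choose U hU0 hU using hex
  have horth (s s' : L) (hne : s ≠ s') : ⟪ι (U s), ι (U s')⟫_ℂ = 0 := by
    have h1 := hA.symm (U s) (U s')
    rw [hU, hU, inner_smul_left, inner_smul_right, adjoint_inner_left, adjoint_inner_right,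
      Complex.conj_ofReal, ← sub_eq_zero, ← sub_mul, mul_eq_zero] at h1
    refine h1.resolve_left fun h2 => hne (Subtype.ext ?_)
    exact_mod_cast sub_eq_zero.1 h2
  let g : (L → ℂ) →ₗ[ℂ] EuclideanSpace ℂ J :=
    Fintype.linearCombination ℂ (fun s => a (ι (U s)))
  have hker : LinearMap.ker g ≠ ⊥ := by
    apply LinearMap.ker_ne_bot_of_finrank_lt
    simp [hcard]
  obtain ⟨k, hk, hk0⟩ := Submodule.exists_mem_ne_zero_of_ne_bot hker
  rw [LinearMap.mem_ker, Fintype.linearCombination_apply] at hk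
  set W := ∑ s, k s • U s with hW
  have haW : a (ι W) = 0 := by
    rw [← hk]; simp [hW]
  have hTW : ⟪T W, W⟫_ℂ = ((∑ s : L, (s : ℝ) * (‖k s‖ ^ 2 * ‖ι (U s)‖ ^ 2) : ℝ) : ℂ) := by
    have h1 (s s' : L) : ⟪T (k s • U s), k s' • U s'⟫_ℂ =
        if s = s' then (((s : ℝ) * (‖k s‖ ^ 2 * ‖ι (U s)‖ ^ 2) : ℝ) : ℂ) else 0 := by
      rw [map_smul, hU, inner_smul_left, inner_smul_left, inner_smul_right, adjoint_inner_left,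
        Complex.conj_ofReal]
      split_ifs with hs
      · subst hs
        rw [inner_self_eq_norm_sq_to_K]
        have := Complex.conj_mul' (k s)
        push_cast
        linear_combination ((s : ℝ) : ℂ) * (‖ι (U s)‖ : ℂ) ^ 2 * this
      · rw [horth _ _ hs]; simp
    rw [hW, map_sum, sum_inner]
    simp_rw [inner_sum, h1]
    simp
  have hιW : ‖ι W‖ ^ 2 = ∑ s : L, ‖k s‖ ^ 2 * ‖ι (U s)‖ ^ 2 := by
    have h1 (s s' : L) : ⟪ι (k s • U s), ι (k s' • U s')⟫_ℂ =
        if s = s' then ((‖k s‖ ^ 2 * ‖ι (U s)‖ ^ 2 : ℝ) : ℂ) else 0 := by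
      rw [map_smul, map_smul, inner_smul_left, inner_smul_right]
      split_ifs with hs
      · subst hs
        rw [inner_self_eq_norm_sq_to_K]
        have := Complex.conj_mul' (k s)
        push_cast
        linear_combination (‖ι (U s)‖ : ℂ) ^ 2 * this
      · rw [horth _ _ hs]; simp
    have h2 : ((‖ι W‖ ^ 2 : ℝ) : ℂ) = ((∑ s : L, ‖k s‖ ^ 2 * ‖ι (U s)‖ ^ 2 : ℝ) : ℂ) := by
      have := inner_self_eq_norm_sq_to_K (𝕜 := ℂ) (ι W)
      push_cast
      rw [← Complex.ofReal_pow] at *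
      refine Eq.trans (by push_cast; exact this.symm) ?_
      rw [hW, map_sum, sum_inner]
      simp_rw [inner_sum, h1]
      simp
    exact_mod_cast h2
  have h3 := h W
  rw [haW, hTW, Complex.ofReal_re, hιW, norm_zero, Finset.mul_sum] at h3
  have h4 : ∑ s : L, (s : ℝ) * (‖k s‖ ^ 2 * ‖ι (U s)‖ ^ 2) <
      ∑ s : L, t * (‖k s‖ ^ 2 * ‖ι (U s)‖ ^ 2) := by
    obtain ⟨s, hs⟩ := Function.ne_iff.1 hk0
    refine Finset.sum_lt_sum (fun s _ => ?_) ⟨s, Finset.mem_univ _, ?_⟩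
    · exact mul_le_mul_of_nonneg_right (hL s.2).1.le (by positivity)
    · refine mul_lt_mul_of_pos_right (hL s.2).1 ?_
      have := norm_pos_iff.2 (hU0 s)
      have := norm_pos_iff.2 hs
      positivity
  have h5 : 0 ≤ c * ‖W‖ ^ 2 := by positivity
  linarith

/-- Weyl's criterion in form sense, where `Ψ` need not be in the domain of `A`. If `l` had a
resolvent `R`, testing against the form vector `W` of `R (ι Ψ)` would turn the left side into `‖ι
Ψ‖²`, while `‖W‖` is at most a fixed multiple of `‖ι Ψ‖`. -/
lemma mem_spectrum_of_approx (hA : IsFormOperator A ι T) {l : ℝ}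
    (hl : ∀ ε > 0, ∃ Ψ : V, ι Ψ ≠ 0 ∧
      ∀ W, ‖⟪T Ψ, W⟫_ℂ - l * ⟪ι Ψ, ι W⟫_ℂ‖ ≤ ε * ‖ι Ψ‖ * ‖W‖) :
    (l : ℂ) ∈ unboundedSpectrum A := by
  rintro ⟨R, h1, -⟩
  -- The last three terms bound `‖W‖² / ‖ι Ψ‖²`; the summand `1` gives `C ≤ C²`, so that `C` also
  -- bounds `‖W‖ / ‖ι Ψ‖`. The choice `ε = 1 / (2 C)` then yields `‖ι Ψ‖² ≤ ‖ι Ψ‖² / 2`.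
  set C : ℝ := 1 + ‖R‖ + |l| * ‖R‖ ^ 2 + ‖R‖ ^ 2 with hC
  have hC1 : 1 ≤ C := by
    have : 0 ≤ ‖R‖ + |l| * ‖R‖ ^ 2 + ‖R‖ ^ 2 := by positivity
    linarith
  obtain ⟨Ψ, hΨ, hW⟩ := hl (1 / (2 * C)) (by positivity)
  obtain ⟨hd, hR⟩ := h1 (ι Ψ)
  obtain ⟨W, hιW, hT⟩ := hA.exists_of_domain ⟨_, hd⟩
  have hAR : A ⟨R (ι Ψ), hd⟩ = ι Ψ + (l : ℂ) • R (ι Ψ) := eq_add_of_sub_eq hR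
  have hιW' : ι W = R (ι Ψ) := hιW
  rw [hAR] at hT
  have hn := norm_pos_iff.2 hΨ
  have e1 : ⟪T Ψ, W⟫_ℂ - l * ⟪ι Ψ, ι W⟫_ℂ = ((‖ι Ψ‖ ^ 2 : ℝ) : ℂ) := by
    rw [hA.symm, hT, adjoint_inner_right, inner_add_right, inner_smul_right, hιW',
      inner_self_eq_norm_sq_to_K]
    push_cast; simp
  have e2 := hW W
  rw [e1, Complex.norm_real, Real.norm_of_nonneg (by positivity)] at e2
  have hRn : ‖R (ι Ψ)‖ ≤ ‖R‖ * ‖ι Ψ‖ := R.le_opNorm _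
  have e3 : ‖W‖ ^ 2 ≤ C * ‖ι Ψ‖ ^ 2 := by
    have e4 := hA.norm_sq_le W
    have e5 : (⟪T W, W⟫_ℂ).re ≤ ‖ι Ψ‖ * ‖R (ι Ψ)‖ + |l| * ‖R (ι Ψ)‖ ^ 2 := by
      rw [hT, adjoint_inner_left, hιW', inner_add_left, inner_smul_left, Complex.add_re]
      refine add_le_add ((Complex.re_le_norm _).trans (norm_inner_le_norm _ _)) ?_
      rw [inner_self_eq_norm_sq_to_K, Complex.conj_ofReal]
      refine (Complex.re_le_norm _).trans (le_of_eq ?_)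
      simp
    have e6 : ‖R (ι Ψ)‖ ^ 2 ≤ ‖R‖ ^ 2 * ‖ι Ψ‖ ^ 2 := by
      rw [← mul_pow]; exact pow_le_pow_left₀ (norm_nonneg _) hRn 2
    have e7 : ‖ι Ψ‖ * ‖R (ι Ψ)‖ ≤ ‖R‖ * ‖ι Ψ‖ ^ 2 := by nlinarith
    have e8 := mul_le_mul_of_nonneg_left e6 (abs_nonneg l)
    rw [hιW'] at e4
    have : 0 ≤ ‖ι Ψ‖ ^ 2 := by positivity
    rw [hC]; nlinarith
  have e9 : ‖W‖ ≤ C * ‖ι Ψ‖ := by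
    refine abs_le_of_sq_le_sq' (e3.trans ?_) (by positivity) |>.2
    rw [mul_pow]
    exact mul_le_mul_of_nonneg_right (by nlinarith) (by positivity)
  have e10 : 1 / (2 * C) * ‖ι Ψ‖ * ‖W‖ ≤ 1 / (2 * C) * ‖ι Ψ‖ * (C * ‖ι Ψ‖) :=
    mul_le_mul_of_nonneg_left e9 (by positivity)
  have e11 : 1 / (2 * C) * ‖ι Ψ‖ * (C * ‖ι Ψ‖) = ‖ι Ψ‖ ^ 2 / 2 := by
    field_simp
  nlinarith [sq_pos_of_pos hn]

/-- Below `E` the spectrum consists of eigenvalues of finite multiplicity that do not accumulate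
below `E`; from `E` on it contains a half-line, none of whose points is isolated. -/
theorem essentialSpectrum_eq (hA : IsFormOperator A ι T) (E : ℝ)
    (hlow : ∀ t < E, BoundedBelowFiniteRank ι T t)
    (hup : ∀ l ≥ E, ∀ ε > 0, ∃ Ψ : V, ι Ψ ≠ 0 ∧
      ∀ W, ‖⟪T Ψ, W⟫_ℂ - l * ⟪ι Ψ, ι W⟫_ℂ‖ ≤ ε * ‖ι Ψ‖ * ‖W‖) :
    essentialSpectrum A = (fun t : ℝ => (t : ℂ)) '' Ici E := by
  have hsub : (fun t : ℝ => (t : ℂ)) '' Ici E ⊆ unboundedSpectrum A := by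
    rintro _ ⟨t, ht, rfl⟩
    exact hA.mem_spectrum_of_approx (hup t ht)
  apply Subset.antisymm
  · rintro z ⟨hz, hd⟩
    have hreal : ∃ t : ℝ, 0 ≤ t ∧ (t : ℂ) = z := by
      by_contra h
      exact hA.notMem_spectrum_of_notMem z h hz
    obtain ⟨t, -, rfl⟩ := hreal
    refine ⟨t, ?_, rfl⟩
    by_contra ht
    rw [mem_Ici, not_le] at ht
    -- Finiteness is known only below levels smaller than `E`. The isolating neighbourhood of `t` is
    -- the half-plane left of `t'` with the finitely many other eigenvalues removed.
    obtain ⟨t', h1, h2⟩ := exists_between ht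
    obtain ⟨hne, hfin⟩ := hA.eigenspace_of_mem_spectrum (hlow t ht) hz
    refine hd ⟨hz, ?_, hne, hfin⟩
    have hf := (hA.finite_eigenvalues_lt (hlow t' h2)).subset
      (sdiff_subset (t := {t}))
    have hcl := (hf.image (fun s : ℝ => (s : ℂ))).isClosed
    refine ⟨{z | z.re < t'} ∩ ((fun s : ℝ => (s : ℂ)) ''
      ({s : ℝ | s < t' ∧ unboundedEigenspace A s ≠ ⊥} \ {t}))ᶜ, ?_, ?_⟩
    · refine ((isOpen_lt Complex.continuous_re continuous_const).inter hcl.isOpen_compl).mem_nhds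
        ⟨by simpa using h1, ?_⟩
      rintro ⟨s, hs, he⟩
      exact hs.2 (Complex.ofReal_injective he)
    · ext w
      constructor
      · rintro ⟨⟨hw1, hw2⟩, hw3⟩
        have hreal : ∃ t : ℝ, 0 ≤ t ∧ (t : ℂ) = w := by
          by_contra h
          exact hA.notMem_spectrum_of_notMem w h hw3
        obtain ⟨s, -, rfl⟩ := hreal
        have hs : s < t' := by simpa using hw1
        by_contra hst
        refine hw2 ⟨s, ⟨⟨hs, (hA.eigenspace_of_mem_spectrum (hlow s (hs.trans h2)) hw3).1⟩, ?_⟩, rfl⟩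
        rintro rfl
        exact hst rfl
      · rintro rfl
        refine ⟨⟨by simpa using h1, ?_⟩, hz⟩
        rintro ⟨s, hs, he⟩
        exact hs.2 (Complex.ofReal_injective he)
  · intro z hz
    refine ⟨hsub hz, ?_⟩
    rintro ⟨-, ⟨U, hU, hUeq⟩, -⟩
    obtain ⟨t, ht, rfl⟩ := hz
    -- Points slightly to the right of `t` remain in `[E, ∞)`, hence in the spectrum, so `t` is not
    -- isolated.
    have hev : ∀ᶠ s : ℝ in 𝓝[>] t, (s : ℂ) ∈ U :=
      (Complex.continuous_ofReal.tendsto t).mono_left nhdsWithin_le_nhds hU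
    obtain ⟨s, hs, hst⟩ := (hev.and self_mem_nhdsWithin).exists
    have : (s : ℂ) ∈ ({(t : ℂ)} : Set ℂ) := by
      rw [← hUeq]
      exact ⟨hs, hsub ⟨s, (mem_Ici.1 ht).trans (le_of_lt hst), rfl⟩⟩
    have h : s = t := Complex.ofReal_injective this
    exact (ne_of_gt hst) h

end IsFormOperator

end FormOperator

/-! ### Trace and Poincaré inequalities on an interval -/

section Interval

variable {a b : ℝ} {f f' : ℝ → ℂ}

/-- Cauchy–Schwarz against the constant `1`, obtained as nonnegativity of the integral of `(g - m)²`
with `m` the mean of `g`. -/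
lemma sq_integral_le_of_continuousOn (hab : a ≤ b) {g : ℝ → ℝ} (hg : ContinuousOn g (Icc a b)) :
    (∫ x in a..b, g x) ^ 2 ≤ (b - a) * ∫ x in a..b, g x ^ 2 := by
  rcases hab.eq_or_lt with rfl | hlt
  · simp
  have hab' : uIcc a b = Icc a b := uIcc_of_le hab
  set m := (∫ x in a..b, g x) / (b - a) with hm
  have hi : IntervalIntegrable g volume a b := (hab' ▸ hg).intervalIntegrable
  have hi2 : IntervalIntegrable (fun x => g x ^ 2) volume a b :=
    ContinuousOn.intervalIntegrable (by rw [hab']; exact hg.pow 2)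
  have h0 : 0 ≤ ∫ x in a..b, (g x - m) ^ 2 :=
    intervalIntegral.integral_nonneg hab fun _ _ => sq_nonneg _
  have e : ∫ x in a..b, (g x - m) ^ 2 =
      (∫ x in a..b, g x ^ 2) - 2 * m * (∫ x in a..b, g x) + m ^ 2 * (b - a) := by
    have : ∀ x, (g x - m) ^ 2 = g x ^ 2 - 2 * m * g x + m ^ 2 := fun x => by ring
    simp_rw [this]
    rw [intervalIntegral.integral_add (hi2.sub (hi.const_mul _)) intervalIntegrable_const,
      intervalIntegral.integral_sub hi2 (hi.const_mul _), intervalIntegral.integral_const_mul,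
      intervalIntegral.integral_const, smul_eq_mul]
    ring
  have hba : 0 < b - a := sub_pos.2 hlt
  have hI : ∫ x in a..b, g x = m * (b - a) := by rw [hm]; field_simp
  rw [e, hI] at h0
  rw [hI]
  nlinarith

lemma norm_integral_sq_le_of_continuousOn (hab : a ≤ b) (hf : ContinuousOn f (Icc a b)) :
    ‖∫ x in a..b, f x‖ ^ 2 ≤ (b - a) * ∫ x in a..b, ‖f x‖ ^ 2 :=
  (pow_le_pow_left₀ (norm_nonneg _) (intervalIntegral.norm_integral_le_integral_norm hab) 2).trans
    (sq_integral_le_of_continuousOn hab hf.norm)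

/-- The fundamental theorem of calculus and Cauchy–Schwarz on the interval between `s` and `t`, then
enlarged to `[a, b]`. -/
lemma norm_sub_sq_le_integral (hf : ∀ x ∈ Icc a b, HasDerivWithinAt f (f' x) (Icc a b) x)
    (hf' : ContinuousOn f' (Icc a b)) {s t : ℝ} (hs : s ∈ Icc a b) (ht : t ∈ Icc a b) :
    ‖f t - f s‖ ^ 2 ≤ (b - a) * ∫ x in a..b, ‖f' x‖ ^ 2 := by
  wlog hst : s ≤ t generalizing s t
  · rw [norm_sub_rev]; exact this ht hs (le_of_not_ge hst)
  have hab : a ≤ b := hs.1.trans hs.2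
  have hsub : Icc s t ⊆ Icc a b := Icc_subset_Icc hs.1 ht.2
  have e : ∫ x in s..t, f' x = f t - f s := by
    refine intervalIntegral.integral_eq_sub_of_hasDerivAt_of_le hst
      (fun x hx => ((hf x (hsub hx)).mono hsub).continuousWithinAt) (fun x hx => ?_)
      (ContinuousOn.intervalIntegrable (by rw [uIcc_of_le hst]; exact hf'.mono hsub))
    exact (hf x (hsub (Ioo_subset_Icc_self hx))).hasDerivAt
      (Icc_mem_nhds (hs.1.trans_lt hx.1) (hx.2.trans_le ht.2))
  rw [← e]
  refine (norm_integral_sq_le_of_continuousOn hst (hf'.mono hsub)).trans ?_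
  have h0 : 0 ≤ ∫ x in s..t, ‖f' x‖ ^ 2 :=
    intervalIntegral.integral_nonneg hst fun _ _ => sq_nonneg _
  refine mul_le_mul (by linarith [hs.1, ht.2]) ?_ h0 (by linarith)
  refine intervalIntegral.integral_mono_interval hs.1 hst ht.2
    (Eventually.of_forall fun _ => sq_nonneg _) ?_
  exact ContinuousOn.intervalIntegrable (by rw [uIcc_of_le hab]; exact hf'.norm.pow 2)

lemma norm_sq_le_two_mul (z w : ℂ) : ‖z‖ ^ 2 ≤ 2 * ‖w‖ ^ 2 + 2 * ‖z - w‖ ^ 2 := by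
  have h : ‖z‖ ≤ ‖w‖ + ‖z - w‖ := by simpa using norm_add_le w (z - w)
  nlinarith [norm_nonneg z, norm_nonneg w, norm_nonneg (z - w), sq_nonneg (‖w‖ - ‖z - w‖)]

/-- Trace inequality on an interval. -/
lemma norm_sq_le_integral (hf : ∀ x ∈ Icc a b, HasDerivWithinAt f (f' x) (Icc a b) x)
    (hf' : ContinuousOn f' (Icc a b)) {c : ℝ} (hc : c ∈ Icc a b) :
    (b - a) * ‖f c‖ ^ 2 ≤
      2 * (∫ x in a..b, ‖f x‖ ^ 2) + 2 * (b - a) ^ 2 * ∫ x in a..b, ‖f' x‖ ^ 2 := by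
  have hab : a ≤ b := hc.1.trans hc.2
  have hcf : ContinuousOn f (Icc a b) := fun x hx => (hf x hx).continuousWithinAt
  have hi : IntervalIntegrable (fun x => ‖f x‖ ^ 2) volume a b :=
    ContinuousOn.intervalIntegrable (by rw [uIcc_of_le hab]; exact hcf.norm.pow 2)
  -- The value at `c` is compared with `f s` for every `s`, and the comparison is integrated over
  -- `s`.
  have h := intervalIntegral.integral_mono_on hab (f := fun _ => ‖f c‖ ^ 2)
    (g := fun s => 2 * ‖f s‖ ^ 2 + 2 * ((b - a) * ∫ x in a..b, ‖f' x‖ ^ 2))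
    intervalIntegrable_const ((hi.const_mul 2).add intervalIntegrable_const) (fun s hs => by
      have := norm_sub_sq_le_integral hf hf' hs hc
      have := norm_sq_le_two_mul (f c) (f s)
      linarith)
  rw [intervalIntegral.integral_const, intervalIntegral.integral_add (hi.const_mul 2)
    intervalIntegrable_const, intervalIntegral.integral_const,
    intervalIntegral.integral_const_mul, smul_eq_mul, smul_eq_mul] at h
  linarith

/-- Poincaré inequality on an interval. -/
lemma integral_norm_sq_le (hab : a ≤ b)
    (hf : ∀ x ∈ Icc a b, HasDerivWithinAt f (f' x) (Icc a b) x)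
    (hf' : ContinuousOn f' (Icc a b)) :
    (b - a) * ∫ x in a..b, ‖f x‖ ^ 2 ≤
      2 * ‖∫ x in a..b, f x‖ ^ 2 + 2 * (b - a) ^ 3 * ∫ x in a..b, ‖f' x‖ ^ 2 := by
  rcases hab.eq_or_lt with rfl | hlt
  · simp
  have hba : 0 < b - a := sub_pos.2 hlt
  have hcf : ContinuousOn f (Icc a b) := fun x hx => (hf x hx).continuousWithinAt
  have hi : IntervalIntegrable (fun x => ‖f x‖ ^ 2) volume a b :=
    ContinuousOn.intervalIntegrable (by rw [uIcc_of_le hab]; exact hcf.norm.pow 2)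
  have hi0 : IntervalIntegrable f volume a b :=
    ContinuousOn.intervalIntegrable (by rwa [uIcc_of_le hab])
  set I := ∫ x in a..b, ‖f' x‖ ^ 2
  set M := ∫ x in a..b, f x
  -- The deviation `(b - a) f s - M` is the integral over `t` of `f s - f t`, and each such
  -- difference is controlled by `f'`.
  have key (s : ℝ) (hs : s ∈ Icc a b) : (b - a) * ((b - a) * ‖f s‖ ^ 2) ≤
      2 * ‖M‖ ^ 2 + (b - a) * (2 * (b - a) ^ 2 * I) := by
    have e : ∫ t in a..b, (f s - f t) = (b - a : ℝ) * f s - M := by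
      rw [intervalIntegral.integral_sub intervalIntegrable_const hi0,
        intervalIntegral.integral_const, Complex.real_smul]
    have h1 := norm_integral_sq_le_of_continuousOn hab (f := fun t => f s - f t)
      (continuousOn_const.sub hcf)
    rw [e] at h1
    have h2 : ∫ t in a..b, ‖f s - f t‖ ^ 2 ≤ ∫ _ in a..b, (b - a) * I := by
      refine intervalIntegral.integral_mono_on hab ?_ intervalIntegrable_const
        fun t ht => norm_sub_sq_le_integral hf hf' ht hs
      exact ContinuousOn.intervalIntegrable
        (by rw [uIcc_of_le hab]; exact (continuousOn_const.sub hcf).norm.pow 2)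
    rw [intervalIntegral.integral_const, smul_eq_mul] at h2
    have h3 := norm_sq_le_two_mul ((b - a : ℝ) * f s) M
    rw [norm_mul, Complex.norm_real, Real.norm_of_nonneg hba.le, mul_pow] at h3
    nlinarith [mul_le_mul_of_nonneg_left h2 hba.le]
  have h := intervalIntegral.integral_mono_on hab ((hi.const_mul (b - a)).const_mul (b - a))
    intervalIntegrable_const key
  rw [intervalIntegral.integral_const, intervalIntegral.integral_const_mul,
    intervalIntegral.integral_const_mul, smul_eq_mul] at h
  have h := le_of_mul_le_mul_left h hba
  linarith

end Interval

/-! ### The transversal ground state -/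

section GroundState

/-- The equation is the Robin condition for `cos (κ (y - d / 2))`. The difference of its sides goes
from `-a` at `0` to `π / d` at `κ = π / d`; it does not vanish at the right end, so `κ d < π` and
the cosine is positive on `[0, d]`. For `a = 0` the root `κ = 0` is allowed. -/
lemma exists_ground_frequency {d a : ℝ} (hd : 0 < d) (ha : 0 ≤ a) :
    ∃ κ, 0 ≤ κ ∧ κ * d < Real.pi ∧
      κ * Real.sin (κ * d / 2) = a * Real.cos (κ * d / 2) := by
  set F : ℝ → ℝ := fun κ => κ * Real.sin (κ * d / 2) - a * Real.cos (κ * d / 2) with hF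
  have hpi := Real.pi_pos
  have hend : F (Real.pi / d) = Real.pi / d := by
    have : Real.pi / d * d / 2 = Real.pi / 2 := by field_simp
    simp [hF, this]
  have hpd : 0 < Real.pi / d := by positivity
  have hc : ContinuousOn F (Icc 0 (Real.pi / d)) := by fun_prop
  obtain ⟨κ, hκ, h0⟩ := intermediate_value_Icc hpd.le hc
    (show (0 : ℝ) ∈ Icc (F 0) (F (Real.pi / d)) by rw [hend]; simp [hF, ha, hpd.le])
  refine ⟨κ, hκ.1, ?_, sub_eq_zero.1 h0⟩
  rcases hκ.2.lt_or_eq with h | rfl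
  · rwa [lt_div_iff₀ hd] at h
  · rw [hend] at h0
    exact absurd h0 hpd.ne'

variable {d a κ : ℝ}

lemma cos_pos_of_mem_Icc (hκ : 0 ≤ κ) (hκd : κ * d < Real.pi) {y : ℝ} (hy : y ∈ Icc 0 d) :
    0 < Real.cos (κ * (y - d / 2)) := by
  have h1 := mul_nonneg hκ hy.1
  have h2 := mul_le_mul_of_nonneg_left hy.2 hκ
  refine Real.cos_pos_of_mem_Ioo ⟨?_, ?_⟩ <;> nlinarith

/-- The transversal Robin form is bounded below by the square of the ground frequency. -/
lemma ground_state_inequality (hd : 0 < d) (hκ : 0 ≤ κ) (hκd : κ * d < Real.pi)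
    (hκa : κ * Real.sin (κ * d / 2) = a * Real.cos (κ * d / 2)) {f f' : ℝ → ℂ}
    (hf : ∀ x ∈ Icc 0 d, HasDerivWithinAt f (f' x) (Icc 0 d) x)
    (hf' : ContinuousOn f' (Icc 0 d)) :
    κ ^ 2 * ∫ x in 0..d, ‖f x‖ ^ 2 ≤
      (∫ x in 0..d, ‖f' x‖ ^ 2) + a * (‖f 0‖ ^ 2 + ‖f d‖ ^ 2) := by
  -- `p` is the logarithmic derivative of the ground state and satisfies the Riccati equation `p' =
  -- -κ² - p²` with `p 0 = a` and `p d = -a`. Integrating `|f' - p f|² ≥ 0` and the derivative of `p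
  -- |f|²` gives the claim (Jacobi's method).
  set p : ℝ → ℝ := fun y => -κ * Real.tan (κ * (y - d / 2)) with hp
  have hcf : ContinuousOn f (Icc 0 d) := fun x hx => (hf x hx).continuousWithinAt
  have hpd (y : ℝ) (hy : y ∈ Icc 0 d) : HasDerivAt p (-κ ^ 2 - p y ^ 2) y := by
    have hc := (cos_pos_of_mem_Icc hκ hκd hy).ne'
    have h1 : HasDerivAt (fun y : ℝ => κ * (y - d / 2)) κ y := by
      simpa using ((hasDerivAt_id y).sub_const (d / 2)).const_mul κ
    have h2 := ((Real.hasDerivAt_tan hc).comp y h1).const_mul (-κ)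
    refine h2.congr_deriv ?_
    simp only [hp, Real.tan_eq_sin_div_cos]
    generalize κ * (y - d / 2) = θ at hc ⊢
    have := Real.sin_sq_add_cos_sq θ
    field_simp
    linear_combination κ ^ 2 * this
  have hpc : ContinuousOn p (Icc 0 d) := fun y hy => (hpd y hy).continuousAt.continuousWithinAt
  have hlast : p d = -a ∧ p 0 = a := by
    have hc := (cos_pos_of_mem_Icc hκ hκd (right_mem_Icc.2 hd.le)).ne'
    have e1 : κ * (d - d / 2) = κ * d / 2 := by ring
    have e2 : κ * (0 - d / 2) = -(κ * d / 2) := by ring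
    rw [e1] at hc
    constructor <;> simp only [hp, e1, e2, Real.tan_eq_sin_div_cos, Real.sin_neg, Real.cos_neg] <;>
      field_simp <;> linarith
  have hfi : IntervalIntegrable (fun x => ‖f x‖ ^ 2) volume 0 d :=
    ContinuousOn.intervalIntegrable (by rw [uIcc_of_le hd.le]; exact hcf.norm.pow 2)
  have hfi' : IntervalIntegrable (fun x => ‖f' x‖ ^ 2) volume 0 d :=
    ContinuousOn.intervalIntegrable (by rw [uIcc_of_le hd.le]; exact hf'.norm.pow 2)
  set D : ℝ → ℝ := fun y => (-κ ^ 2 - p y ^ 2) * ‖f y‖ ^ 2 + p y * (2 * inner ℝ (f y) (f' y))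
  have hDc : ContinuousOn D (Icc 0 d) := by
    have := hcf.inner (𝕜 := ℝ) hf'
    fun_prop
  have hDi : IntervalIntegrable D volume 0 d :=
    ContinuousOn.intervalIntegrable (by rwa [uIcc_of_le hd.le])
  have hFTC : ∫ y in 0..d, D y = p d * ‖f d‖ ^ 2 - p 0 * ‖f 0‖ ^ 2 := by
    refine intervalIntegral.integral_eq_sub_of_hasDerivAt_of_le hd.le
      (f := fun y => p y * ‖f y‖ ^ 2) (hpc.mul (hcf.norm.pow 2)) (fun y hy => ?_) hDi
    have hy' := Ioo_subset_Icc_self hy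
    exact (hpd y hy').mul
      ((hf y hy').hasDerivAt (Icc_mem_nhds hy.1 hy.2)).norm_sq
  have hle : ∫ y in 0..d, D y ≤ ∫ y in 0..d, (‖f' y‖ ^ 2 - κ ^ 2 * ‖f y‖ ^ 2) := by
    refine intervalIntegral.integral_mono_on hd.le hDi (hfi'.sub (hfi.const_mul _))
      fun y _ => ?_
    have h1 := norm_sub_sq_real (f' y) (p y • f y)
    rw [real_inner_smul_right, norm_smul, mul_pow, Real.norm_eq_abs, sq_abs,
      real_inner_comm] at h1
    have h2 := sq_nonneg ‖f' y - p y • f y‖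
    simp only [D]
    nlinarith
  rw [hFTC, hlast.1, hlast.2, intervalIntegral.integral_sub hfi' (hfi.const_mul _),
    intervalIntegral.integral_const_mul] at hle
  linarith

lemma hasDerivAt_cos_ground (κ d y : ℝ) :
    HasDerivAt (fun y => Real.cos (κ * (y - d / 2))) (-κ * Real.sin (κ * (y - d / 2))) y := by
  have h1 : HasDerivAt (fun y : ℝ => κ * (y - d / 2)) κ y := by
    simpa using ((hasDerivAt_id y).sub_const (d / 2)).const_mul κ
  exact ((Real.hasDerivAt_cos _).comp y h1).congr_deriv (by ring)

lemma hasDerivAt_sin_ground (κ d y : ℝ) :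
    HasDerivAt (fun y => -κ * Real.sin (κ * (y - d / 2)))
      (-κ ^ 2 * Real.cos (κ * (y - d / 2))) y := by
  have h1 : HasDerivAt (fun y : ℝ => κ * (y - d / 2)) κ y := by
    simpa using ((hasDerivAt_id y).sub_const (d / 2)).const_mul κ
  exact (((Real.hasDerivAt_sin _).comp y h1).const_mul (-κ)).congr_deriv (by ring)

/-- The cosine realises `κ²`. For any other eigenpair, integration by parts writes `E ∫ |u|²` as the
transversal form of `u`, to which `ground_state_inequality` applies. -/
theorem isLeast_transversalEigenvalues (hd : 0 < d) (hκ : 0 ≤ κ) (hκd : κ * d < Real.pi)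
    (hκa : κ * Real.sin (κ * d / 2) = a * Real.cos (κ * d / 2)) :
    IsLeast (transversalEigenvalues d a) (κ ^ 2) := by
  have e1 : κ * (d - d / 2) = κ * d / 2 := by ring
  have e2 : κ * (0 - d / 2) = -(κ * d / 2) := by ring
  constructor
  · refine ⟨fun y => (Real.cos (κ * (y - d / 2)) : ℝ),
      fun y => (-κ * Real.sin (κ * (y - d / 2)) : ℝ), fun y _ => ?_, fun y _ => ?_, ?_, ?_,
      0, left_mem_Icc.2 hd.le, ?_⟩
    · exact (hasDerivAt_cos_ground κ d y).ofReal_comp.hasDerivWithinAt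
    · exact ((hasDerivAt_sin_ground κ d y).ofReal_comp.congr_deriv
        (by push_cast; ring)).hasDerivWithinAt
    · beta_reduce
      rw [e2, Real.sin_neg, Real.cos_neg, ← Complex.ofReal_mul, ← hκa]
      push_cast; ring
    · beta_reduce
      rw [e1, ← Complex.ofReal_mul, ← hκa]
      push_cast; ring
    · exact Complex.ofReal_ne_zero.2 (cos_pos_of_mem_Icc hκ hκd (left_mem_Icc.2 hd.le)).ne'
  · rintro E ⟨u, v, hu, hv, h0, h1, y₀, hy₀, hne⟩
    have hcu : ContinuousOn u (Icc 0 d) := fun x hx => (hu x hx).continuousWithinAt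
    have hcv : ContinuousOn v (Icc 0 d) := fun x hx => (hv x hx).continuousWithinAt
    have hui : IntervalIntegrable (fun x => ‖u x‖ ^ 2) volume 0 d :=
      ContinuousOn.intervalIntegrable (by rw [uIcc_of_le hd.le]; exact hcu.norm.pow 2)
    have hvi : IntervalIntegrable (fun x => ‖v x‖ ^ 2) volume 0 d :=
      ContinuousOn.intervalIntegrable (by rw [uIcc_of_le hd.le]; exact hcv.norm.pow 2)
    -- The integrand is the derivative of the real inner product of `u` and `v = u'`, by the
    -- eigenvalue equation.
    have hFTC : ∫ y in 0..d, (‖v y‖ ^ 2 - E * ‖u y‖ ^ 2) =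
        inner ℝ (u d) (v d) - inner ℝ (u 0) (v 0) := by
      refine intervalIntegral.integral_eq_sub_of_hasDerivAt_of_le hd.le
        (f := fun y => inner ℝ (u y) (v y)) (hcu.inner hcv) (fun y hy => ?_)
        (hvi.sub (hui.const_mul _))
      have hy' := Ioo_subset_Icc_self hy
      have hn := Icc_mem_nhds hy.1 hy.2
      refine (((hu y hy').hasDerivAt hn).inner ℝ ((hv y hy').hasDerivAt hn)).congr_deriv ?_
      have : (-(E : ℂ) * u y) = (-E) • u y := by simp
      rw [this, real_inner_smul_right, real_inner_self_eq_norm_sq, real_inner_self_eq_norm_sq]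
      ring
    have hd1 : v d = (-a) • u d := by
      rw [Complex.real_smul]; push_cast; linear_combination h1
    have hd0 : v 0 = a • u 0 := by
      rw [Complex.real_smul]; linear_combination -h0
    rw [hd1, hd0, real_inner_smul_right, real_inner_smul_right, real_inner_self_eq_norm_sq,
      real_inner_self_eq_norm_sq, intervalIntegral.integral_sub hvi (hui.const_mul _),
      intervalIntegral.integral_const_mul] at hFTC
    have hle := ground_state_inequality hd hκ hκd hκa hu hcv
    have hpos : 0 < ∫ x in 0..d, ‖u x‖ ^ 2 := by
      refine intervalIntegral.integral_pos hd (hcu.norm.pow 2) (fun _ _ => sq_nonneg _)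
        ⟨y₀, hy₀, ?_⟩
      have := norm_pos_iff.2 hne
      positivity
    by_contra! hlt
    nlinarith

end GroundState

noncomputable section

open scoped InnerProductSpace ComplexConjugate

/-! ### Continuous functions with compact support as elements of `L²` -/

section CompactSupport

variable {X : Type*} [TopologicalSpace X] [MeasurableSpace X] [OpensMeasurableSpace X]

/-- The class in `L²` of a continuous function with compact support. -/
def toL2 (μ : Measure X) [IsFiniteMeasureOnCompacts μ] (f : X → ℂ) (hc : Continuous f)
    (hs : HasCompactSupport f) : Lp ℂ 2 μ :=
  (hc.memLp_of_hasCompactSupport hs).toLp f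

variable {μ : Measure X} [IsFiniteMeasureOnCompacts μ] {f g : X → ℂ}

lemma coeFn_toL2 (hc : Continuous f) (hs : HasCompactSupport f) : toL2 μ f hc hs =ᵐ[μ] f :=
  MemLp.coeFn_toLp _

lemma inner_toL2_left (hc : Continuous f) (hs : HasCompactSupport f) (u : Lp ℂ 2 μ) :
    ⟪toL2 μ f hc hs, u⟫_ℂ = ∫ x, conj (f x) * u x ∂μ := by
  rw [L2.inner_def]
  refine integral_congr_ae ((coeFn_toL2 hc hs).mono fun x hx => ?_)
  simp only [hx, RCLike.inner_apply, mul_comm]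

lemma inner_toL2_right (hc : Continuous f) (hs : HasCompactSupport f) (u : Lp ℂ 2 μ) :
    ⟪u, toL2 μ f hc hs⟫_ℂ = ∫ x, conj (u x) * f x ∂μ := by
  rw [L2.inner_def]
  refine integral_congr_ae ((coeFn_toL2 hc hs).mono fun x hx => ?_)
  simp only [hx, RCLike.inner_apply, mul_comm]

lemma inner_toL2 (hc : Continuous f) (hs : HasCompactSupport f) (hc' : Continuous g)
    (hs' : HasCompactSupport g) :
    ⟪toL2 μ f hc hs, toL2 μ g hc' hs'⟫_ℂ = ∫ x, conj (f x) * g x ∂μ := by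
  rw [inner_toL2_left]
  exact integral_congr_ae ((coeFn_toL2 hc' hs').mono fun x hx => by simp only [hx])

lemma norm_sq_toL2 (hc : Continuous f) (hs : HasCompactSupport f) :
    ‖toL2 μ f hc hs‖ ^ 2 = ∫ x, ‖f x‖ ^ 2 ∂μ := by
  have h : ((‖toL2 μ f hc hs‖ ^ 2 : ℝ) : ℂ) = ((∫ x, ‖f x‖ ^ 2 ∂μ : ℝ) : ℂ) := by
    have h1 := inner_self_eq_norm_sq_to_K (𝕜 := ℂ) (toL2 μ f hc hs)
    rw [inner_toL2] at h1
    rw [← integral_complex_ofReal]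
    simp only [Complex.conj_mul'] at h1
    push_cast
    exact h1.symm
  exact_mod_cast h

/-- Writing the pairing as an inner product makes it visibly continuous in `u`. -/
lemma integral_smul_eq_inner {φ : X → ℝ} (hc : Continuous φ) (hs : HasCompactSupport φ)
    (u : Lp ℂ 2 μ) :
    ∫ x, φ x • u x ∂μ = ⟪toL2 μ (fun x => (φ x : ℂ)) (by fun_prop)
      (hs.comp_left (g := fun t : ℝ => (t : ℂ)) Complex.ofReal_zero), u⟫_ℂ := by
  rw [inner_toL2_left]
  simp

lemma toL2_congr {hc : Continuous f} {hs : HasCompactSupport f} {hc' : Continuous g}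
    {hs' : HasCompactSupport g} (h : f =ᵐ[μ] g) : toL2 μ f hc hs = toL2 μ g hc' hs' :=
  (MemLp.toLp_eq_toLp_iff _ _).2 h

end CompactSupport

/-! ### The Sobolev space of the strip and its test functions -/

section Strip

variable {d : ℝ}

lemma restrict_strip_eq (d : ℝ) : (volume : Measure (ℝ × ℝ)).restrict (strip d) =
    (volume : Measure ℝ).prod ((volume : Measure ℝ).restrict (Ioo 0 d)) := by
  have := Measure.prod_restrict (μ := (volume : Measure ℝ)) (ν := (volume : Measure ℝ))
    univ (Ioo 0 d)
  rw [Measure.restrict_univ] at this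
  rw [this]; rfl

lemma integral_strip {E : Type*} [NormedAddCommGroup E] [NormedSpace ℝ E] (hd : 0 ≤ d)
    {F : ℝ × ℝ → E} (hF : Continuous F) (hs : HasCompactSupport F) :
    ∫ p in strip d, F p = ∫ x, ∫ y in 0..d, F (x, y) := by
  have hi : Integrable F (volume.restrict (strip d)) := hF.integrable_of_hasCompactSupport hs
  rw [restrict_strip_eq] at hi ⊢
  rw [integral_prod _ hi]
  refine integral_congr_ae (Eventually.of_forall fun x => ?_)
  simp only
  rw [intervalIntegral.integral_of_le hd, integral_Ioc_eq_integral_Ioo]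

lemma integrable_strip_slice (hd : 0 ≤ d) {E : Type*} [NormedAddCommGroup E] [NormedSpace ℝ E]
    {F : ℝ × ℝ → E} (hF : Continuous F) (hs : HasCompactSupport F) :
    Integrable (fun x => ∫ y in 0..d, F (x, y)) := by
  have hi : Integrable F (volume.restrict (strip d)) := hF.integrable_of_hasCompactSupport hs
  rw [restrict_strip_eq] at hi
  refine hi.integral_prod_left.congr (Eventually.of_forall fun x => ?_)
  simp only
  rw [intervalIntegral.integral_of_le hd, integral_Ioc_eq_integral_Ioo]

lemma hasCompactSupport_slice_left {E : Type*} [Zero E] {F : ℝ × ℝ → E}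
    (hs : HasCompactSupport F) (c : ℝ) : HasCompactSupport fun x => F (x, c) := by
  refine HasCompactSupport.intro (hs.isCompact.image continuous_fst) fun x hx => ?_
  exact image_eq_zero_of_notMem_tsupport fun h => hx ⟨_, h, rfl⟩

/-- The space of smooth functions with compact support in the plane. -/
def testPlaneSubmodule : Submodule ℂ (ℝ × ℝ → ℂ) where
  carrier := {φ | ContDiff ℝ ∞ φ ∧ HasCompactSupport φ}
  zero_mem' := ⟨contDiff_const, .zero⟩
  add_mem' h h' := ⟨h.1.add h'.1, h.2.add h'.2⟩
  smul_mem' a _ h := ⟨contDiff_const.smul h.1, h.2.smul_left (f := fun _ => a)⟩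

/-- Smooth functions with compact support in the plane. -/
abbrev TestPlane : Type := testPlaneSubmodule

instance : CoeFun TestPlane fun _ => ℝ × ℝ → ℂ := ⟨Subtype.val⟩

namespace TestPlane

variable (φ : TestPlane)

lemma contDiff : ContDiff ℝ ∞ (φ : ℝ × ℝ → ℂ) := φ.2.1

lemma continuous : Continuous (φ : ℝ × ℝ → ℂ) := φ.2.1.continuous

lemma hasCompactSupport : HasCompactSupport (φ : ℝ × ℝ → ℂ) := φ.2.2

lemma differentiable : Differentiable ℝ (φ : ℝ × ℝ → ℂ) := φ.2.1.differentiable (by simp)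

/-- The directional derivative of a test function. -/
def dir (v : ℝ × ℝ) : TestPlane :=
  ⟨fun p => fderiv ℝ (φ : ℝ × ℝ → ℂ) p v,
    (φ.contDiff.fderiv_right (m := ∞) (by simp)).clm_apply contDiff_const,
    φ.hasCompactSupport.fderiv_apply ℝ v⟩

lemma dir_apply (v p : ℝ × ℝ) : φ.dir v p = fderiv ℝ (φ : ℝ × ℝ → ℂ) p v := rfl

/-- The class of a test function in `L²` of the strip. -/
def toStrip (d : ℝ) : TestPlane →ₗ[ℂ] L2Strip d where
  toFun φ := toL2 _ φ φ.continuous φ.hasCompactSupport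
  map_add' _ _ := rfl
  map_smul' _ _ := rfl

lemma coeFn_toStrip (d : ℝ) : toStrip d φ =ᵐ[volume.restrict (strip d)] φ :=
  coeFn_toL2 φ.continuous φ.hasCompactSupport

/-- The restriction of a test function to a horizontal line. -/
def toLine (c : ℝ) : TestPlane →ₗ[ℂ] Lp ℂ 2 (volume : Measure ℝ) where
  toFun φ := toL2 _ (fun x => φ (x, c)) (φ.continuous.comp (by fun_prop))
    (hasCompactSupport_slice_left φ.hasCompactSupport c)
  map_add' _ _ := rfl
  map_smul' _ _ := rfl

lemma dir_add (φ ψ : TestPlane) (v : ℝ × ℝ) : (φ + ψ).dir v = φ.dir v + ψ.dir v := by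
  ext p
  simp only [dir_apply, Submodule.coe_add, Pi.add_apply]
  rw [fderiv_add (φ.differentiable p) (ψ.differentiable p)]; rfl

lemma dir_smul (a : ℂ) (φ : TestPlane) (v : ℝ × ℝ) : (a • φ).dir v = a • φ.dir v := by
  ext p
  simp only [dir_apply, Submodule.coe_smul, Pi.smul_apply]
  rw [fderiv_const_smul (φ.differentiable p)]; rfl

lemma isWeakDeriv (v : ℝ × ℝ) : IsWeakDeriv d v (toStrip d φ) (toStrip d (φ.dir v)) := by
  intro ψ hψ hc hs
  have e (f : ℝ × ℝ → ℝ) (a : TestPlane) :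
      ∫ p in strip d, f p • toStrip d a p = ∫ p in strip d, f p • a p :=
    integral_congr_ae ((a.coeFn_toStrip d).mono fun p hp => by simp only [hp])
  rw [e, e, setIntegral_eq_integral_of_forall_compl_eq_zero,
    setIntegral_eq_integral_of_forall_compl_eq_zero, eq_neg_iff_add_eq_zero, add_comm,
    ← eq_neg_iff_add_eq_zero]
  · refine integral_bilinear_fderiv_right_eq_neg_left_of_integrable
      (B := ContinuousLinearMap.lsmul ℝ ℝ) ?_ ?_ ?_
      (fun x _ => hψ.differentiable (by simp) x) (fun x _ => φ.differentiable x)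
    · exact ((continuous_fderiv_dir hψ v).smul φ.continuous).integrable_of_hasCompactSupport
        ((hc.fderiv_apply ℝ v).smul_right)
    · exact (hψ.continuous.smul (φ.dir v).continuous).integrable_of_hasCompactSupport
        hc.smul_right
    · exact (hψ.continuous.smul φ.continuous).integrable_of_hasCompactSupport hc.smul_right
  · intro p hp
    rw [image_eq_zero_of_notMem_tsupport (fun hh => hp (hs hh)), zero_smul]
  · intro p hp
    rw [image_eq_zero_of_notMem_tsupport
      (fun hh => hp (hs (tsupport_fderiv_apply_subset ℝ v hh))), zero_smul]

end TestPlane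

/-- Each test function imposes an equality between two continuous functionals of the pair.
Completeness of the Sobolev space follows. -/
lemma isClosed_isWeakDeriv (d : ℝ) (v : ℝ × ℝ) :
    IsClosed {q : L2Strip d × L2Strip d | IsWeakDeriv d v q.1 q.2} := by
  simp only [IsWeakDeriv, ofPred_forall]
  refine isClosed_iInter fun φ => isClosed_iInter fun hφ => isClosed_iInter fun hc =>
    isClosed_iInter fun _ => ?_
  simp_rw [integral_smul_eq_inner hφ.continuous hc,
    integral_smul_eq_inner (continuous_fderiv_dir hφ v) (hc.fderiv_apply ℝ v)]
  exact isClosed_eq (by fun_prop) (by fun_prop)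

/-- The Sobolev space `W^{1,2}` of the strip, as a Hilbert space of triples `(u, ∂ₓu, ∂_y u)`. -/
def sobolevSubmodule (d : ℝ) : Submodule ℂ (PiLp 2 fun _ : Fin 3 => L2Strip d) where
  carrier := {U | IsWeakGrad d (U 0) (U 1) (U 2)}
  zero_mem' := .zero
  add_mem' h h' := h.add h'
  smul_mem' a _ h := h.smul a

/-- The Sobolev space `W^{1,2}` of the strip. -/
abbrev Sobolev (d : ℝ) : Type := sobolevSubmodule d

instance (d : ℝ) : CompleteSpace (Sobolev d) := by
  refine IsClosed.completeSpace_coe (s := (↑(sobolevSubmodule d) : Set (PiLp 2 fun _ : Fin 3 => L2Strip d)))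
    (hs := ?_)
  have c (i j : Fin 3) : Continuous fun U : PiLp 2 fun _ : Fin 3 => L2Strip d => (U i, U j) :=
    (PiLp.continuous_apply 2 _ i).prodMk (PiLp.continuous_apply 2 _ j)
  exact ((isClosed_isWeakDeriv d (1, 0)).preimage (c 0 1)).inter
    ((isClosed_isWeakDeriv d (0, 1)).preimage (c 0 2))

namespace Sobolev

/-- The components `u`, `∂ₓu`, `∂_y u` of an element of the Sobolev space. -/
def comp (d : ℝ) (i : Fin 3) : Sobolev d →L[ℂ] L2Strip d :=
  (PiLp.proj 2 (fun _ : Fin 3 => L2Strip d) i).comp (sobolevSubmodule d).subtypeL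

lemma isWeakGrad (U : Sobolev d) : IsWeakGrad d (comp d 0 U) (comp d 1 U) (comp d 2 U) := U.2

/-- The element of the Sobolev space given by a function and its weak gradient. -/
def mk {u ux uy : L2Strip d} (h : IsWeakGrad d u ux uy) : Sobolev d :=
  ⟨WithLp.toLp 2 ![u, ux, uy], h⟩

section
variable {u ux uy : L2Strip d} (h : IsWeakGrad d u ux uy)
@[simp] lemma comp_zero_mk : comp d 0 (mk h) = u := rfl
@[simp] lemma comp_one_mk : comp d 1 (mk h) = ux := rfl
@[simp] lemma comp_two_mk : comp d 2 (mk h) = uy := rfl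
end

lemma inner_eq (U W : Sobolev d) : ⟪U, W⟫_ℂ =
    ⟪comp d 0 U, comp d 0 W⟫_ℂ + ⟪comp d 1 U, comp d 1 W⟫_ℂ + ⟪comp d 2 U, comp d 2 W⟫_ℂ := by
  rw [Submodule.coe_inner, PiLp.inner_apply, Fin.sum_univ_three]; rfl

lemma norm_sq_eq (U : Sobolev d) :
    ‖U‖ ^ 2 = ‖comp d 0 U‖ ^ 2 + ‖comp d 1 U‖ ^ 2 + ‖comp d 2 U‖ ^ 2 := by
  rw [← Submodule.norm_coe, PiLp.norm_sq_eq_of_L2, Fin.sum_univ_three]; rfl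

lemma norm_comp_le (i : Fin 3) (U : Sobolev d) : ‖comp d i U‖ ≤ ‖U‖ := by
  have h := norm_sq_eq U
  refine abs_le_of_sq_le_sq' ?_ (norm_nonneg _) |>.2
  fin_cases i <;> simp only [Fin.zero_eta, Fin.mk_one, Fin.reduceFinMk] <;>
    nlinarith [sq_nonneg ‖comp d 0 U‖, sq_nonneg ‖comp d 1 U‖, sq_nonneg ‖comp d 2 U‖]

-- Weak derivatives are unique, so the zeroth component determines the other two.
@[ext] lemma ext {U W : Sobolev d} (h : comp d 0 U = comp d 0 W) : U = W := by
  have h1 := U.isWeakGrad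
  rw [h] at h1
  have h2 := W.isWeakGrad
  apply Subtype.ext
  apply WithLp.ofLp_injective
  funext i
  fin_cases i
  · exact h
  · exact h1.1.unique h2.1
  · exact h1.2.unique h2.2

end Sobolev

open Sobolev

/-- A test function as an element of the Sobolev space of the strip. -/
def TestPlane.jet (d : ℝ) : TestPlane →ₗ[ℂ] Sobolev d where
  toFun φ := Sobolev.mk ⟨φ.isWeakDeriv (1, 0), φ.isWeakDeriv (0, 1)⟩
  map_add' φ ψ := Sobolev.ext (map_add (TestPlane.toStrip d) φ ψ)
  map_smul' a φ := Sobolev.ext (map_smul (TestPlane.toStrip d) a φ)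

section
variable (φ : TestPlane)
@[simp] lemma comp_zero_jet : comp d 0 (φ.jet d) = TestPlane.toStrip d φ := rfl
@[simp] lemma comp_one_jet : comp d 1 (φ.jet d) = TestPlane.toStrip d (φ.dir (1, 0)) := rfl
@[simp] lemma comp_two_jet : comp d 2 (φ.jet d) = TestPlane.toStrip d (φ.dir (0, 1)) := rfl
end

end Strip

end

noncomputable section

open scoped InnerProductSpace ComplexConjugate
open Sobolev

/-! ### Correlations of `L²` functions -/

section Correlation

/-- The correlation `t ↦ ∫ conj (w p) f (p - t) dp` of two functions in `L²(ℝ²)`. -/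
def correlation (w f : Lp ℂ 2 (volume : Measure (ℝ × ℝ))) (t : ℝ × ℝ) : ℂ :=
  ⟪w, Lp.compMeasurePreserving (fun p => p - t) (measurePreserving_sub_right volume t) f⟫_ℂ

/-- Translation is strongly continuous in `L²`. Through this, an identity known for the shifts in an
open set reaches the shift `0` on its boundary. -/
lemma continuous_correlation (w f : Lp ℂ 2 (volume : Measure (ℝ × ℝ))) :
    Continuous (correlation w f) := by
  refine continuous_const.inner (𝕜 := ℂ) ?_
  let g : C(ℝ × ℝ, C(ℝ × ℝ, ℝ × ℝ)) :=
    (ContinuousMap.mk (fun q : (ℝ × ℝ) × (ℝ × ℝ) => q.2 - q.1) (by fun_prop)).curry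
  exact Continuous.compMeasurePreservingLp (f := fun _ => f) continuous_const g.continuous
    (fun t => measurePreserving_sub_right volume t) (by norm_num)

lemma correlation_eq (w f : Lp ℂ 2 (volume : Measure (ℝ × ℝ))) (t : ℝ × ℝ) :
    correlation w f t = ∫ p, conj (w p) * f (p - t) := by
  rw [correlation, L2.inner_def]
  refine integral_congr_ae ((Lp.coeFn_compMeasurePreserving f
    (measurePreserving_sub_right volume t)).mono fun p hp => ?_)
  simp only [hp, RCLike.inner_apply, mul_comm, Function.comp_apply]

/-- By Fubini, pairing `w` with a mollification of `f` is integrating the mollifier against the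
correlation. Varying `ρ` then determines the correlation itself, and no approximate identity is
needed. -/
lemma integral_mul_integral_eq_correlation (w f : Lp ℂ 2 (volume : Measure (ℝ × ℝ)))
    {ρ : ℝ × ℝ → ℝ} (hc : Continuous ρ) (hs : HasCompactSupport ρ) :
    ∫ p, conj (w p) * ∫ t, ρ t • f (p - t) = ∫ t, ρ t • correlation w f t := by
  have hm : AEStronglyMeasurable
      (fun q : (ℝ × ℝ) × (ℝ × ℝ) => conj (w q.1) * (ρ q.2 • f (q.1 - q.2)))
      (volume.prod volume) := by
    have h1 : StronglyMeasurable fun q : (ℝ × ℝ) × (ℝ × ℝ) => conj (w q.1) :=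
      Complex.continuous_conj.comp_stronglyMeasurable
        ((Lp.stronglyMeasurable w).comp_measurable measurable_fst)
    have h2 : StronglyMeasurable fun q : (ℝ × ℝ) × (ℝ × ℝ) => f (q.1 - q.2) :=
      (Lp.stronglyMeasurable f).comp_measurable (measurable_fst.sub measurable_snd)
    have h3 : StronglyMeasurable fun q : (ℝ × ℝ) × (ℝ × ℝ) => ρ q.2 :=
      (hc.comp continuous_snd).stronglyMeasurable
    exact (h1.mul (h3.smul h2)).aestronglyMeasurable
  have hft (t : ℝ × ℝ) : MemLp (fun p => f (p - t)) 2 volume :=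
    (Lp.memLp f).comp_measurePreserving (measurePreserving_sub_right volume t)
  have hw : MemLp (fun p => conj (w p)) 2 volume := (Lp.memLp w).star
  have hint : Integrable (fun q : (ℝ × ℝ) × (ℝ × ℝ) => conj (w q.1) * (ρ q.2 • f (q.1 - q.2)))
      (volume.prod volume) := by
    rw [integrable_prod_iff' hm]
    have hi (t : ℝ × ℝ) : Integrable (fun p => conj (w p) * f (p - t)) :=
      hw.integrable_mul (hft t)
    constructor
    · refine Eventually.of_forall fun t => ?_
      simp only [mul_smul_comm]
      exact (hi t).smul (ρ t)
    · have hb (t : ℝ × ℝ) : ∫ p, ‖conj (w p) * (ρ t • f (p - t))‖ ≤ ‖ρ t‖ * (‖w‖ * ‖f‖) := by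
        simp only [mul_smul_comm, norm_smul]
        rw [integral_const_mul]
        refine mul_le_mul_of_nonneg_left ?_ (norm_nonneg _)
        have h1 := integral_mul_norm_le_Lp_mul_Lq (μ := volume) Real.HolderConjugate.two_two
          (f := fun p => conj (w p)) (g := fun p => f (p - t)) (by simpa using hw)
          (by simpa using hft t)
        simp only [norm_mul]
        refine h1.trans (le_of_eq ?_)
        have hn (u : Lp ℂ 2 (volume : Measure (ℝ × ℝ))) :
            (∫ p, ‖u p‖ ^ (2 : ℝ)) ^ (1 / (2 : ℝ)) = ‖u‖ := by
          rw [Lp.norm_def, (Lp.memLp u).eLpNorm_eq_integral_rpow_norm (by norm_num) (by norm_num),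
            ENNReal.toReal_ofReal (by positivity)]
          norm_num
        have e : ∫ p, ‖f (p - t)‖ ^ (2 : ℝ) = ∫ p, ‖f p‖ ^ (2 : ℝ) :=
          integral_sub_right_eq_self (fun p => ‖f p‖ ^ (2 : ℝ)) t
        rw [e, hn]
        simp only [RCLike.norm_conj, hn]
      refine Integrable.mono' (g := fun t => ‖ρ t‖ * (‖w‖ * ‖f‖)) ?_ ?_ ?_
      · exact (hc.integrable_of_hasCompactSupport hs).norm.mul_const _
      · exact hm.norm.prod_swap.integral_prod_right'
      · refine Eventually.of_forall fun t => ?_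
        rw [Real.norm_of_nonneg (integral_nonneg fun _ => norm_nonneg _)]
        exact hb t
  simp_rw [← integral_const_mul]
  rw [integral_integral_swap hint]
  refine integral_congr_ae (Eventually.of_forall fun t => ?_)
  simp only [mul_smul_comm]
  rw [integral_smul, correlation_eq]

end Correlation

/-! ### Density of test functions of the plane in `W^{1,2}` of the strip -/

section Density

variable {d : ℝ}

/-- The product `η u`, extended by zero outside the strip. -/
def cutExtend (d : ℝ) (η : ℝ × ℝ → ℝ) (u : L2Strip d) : ℝ × ℝ → ℂ :=
  (strip d).indicator fun p => η p • u p

lemma memLp_smul_strip {η : ℝ × ℝ → ℝ} (hc : Continuous η) (hs : HasCompactSupport η)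
    (u : L2Strip d) : MemLp (fun p => η p • u p) 2 (volume.restrict (strip d)) := by
  have h1 : MemLp η ⊤ (volume.restrict (strip d)) := hc.memLp_of_hasCompactSupport hs
  exact (Lp.memLp u).smul h1

lemma memLp_cutExtend {η : ℝ × ℝ → ℝ} (hc : Continuous η) (hs : HasCompactSupport η)
    (u : L2Strip d) : MemLp (cutExtend d η u) 2 volume :=
  (memLp_indicator_iff_restrict (isOpen_strip d).measurableSet).2 (memLp_smul_strip hc hs u)

lemma integral_smul_cutExtend (g : ℝ × ℝ → ℝ) (η : ℝ × ℝ → ℝ) (u : L2Strip d) :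
    ∫ q, g q • cutExtend d η u q = ∫ q in strip d, (g q * η q) • u q := by
  rw [← integral_indicator (isOpen_strip d).measurableSet]
  congr 1
  ext q
  by_cases hq : q ∈ strip d <;> simp [cutExtend, hq, mul_smul]

lemma hasCompactSupport_cutExtend {η : ℝ × ℝ → ℝ} (hs : HasCompactSupport η) (u : L2Strip d) :
    HasCompactSupport (cutExtend d η u) := by
  refine HasCompactSupport.intro hs.isCompact fun p hp => ?_
  simp [cutExtend, image_eq_zero_of_notMem_tsupport hp]

/-- Mollification of a cut-off function, as a test function. -/
def mollify (d : ℝ) {ρ η : ℝ × ℝ → ℝ} (hρ : ContDiff ℝ ∞ ρ) (hρs : HasCompactSupport ρ)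
    (hη : Continuous η) (hηs : HasCompactSupport η) (u : L2Strip d) : TestPlane :=
  ⟨convolution ρ (cutExtend d η u) (ContinuousLinearMap.lsmul ℝ ℝ) volume,
    hρs.contDiff_convolution_left _ hρ ((memLp_cutExtend hη hηs u).locallyIntegrable (by norm_num)),
    hρs.convolution _ (hasCompactSupport_cutExtend hηs u)⟩

/-- Differentiating the convolution puts the derivative on `ρ`. The hypothesis `hp` makes `q ↦ ρ (p
- q) η q` an admissible test function in the strip, so the weak derivative moves it to `u`, and the
product rule leaves the term with the derivative of `η`. -/
lemma mollify_dir_apply {ρ η : ℝ × ℝ → ℝ} (hρ : ContDiff ℝ ∞ ρ) (hρs : HasCompactSupport ρ)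
    (hη : ContDiff ℝ ∞ η) (hηs : HasCompactSupport η) {u w : L2Strip d} {v : ℝ × ℝ}
    (hu : IsWeakDeriv d v u w) {p : ℝ × ℝ}
    (hp : ∀ q ∈ tsupport η, p - q ∈ tsupport ρ → q ∈ strip d) :
    (mollify d hρ hρs hη.continuous hηs u).dir v p =
      ∫ t, ρ t • (cutExtend d η w (p - t) + cutExtend d (fun q => fderiv ℝ η q v) u (p - t)) := by
  have hloc : LocallyIntegrable (cutExtend d η u) volume :=
    (memLp_cutExtend hη.continuous hηs u).locallyIntegrable (by norm_num)
  have hd := hρs.hasFDerivAt_convolution_left (ContinuousLinearMap.lsmul ℝ ℝ)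
    (hρ.of_le (by simp)) hloc p
  have e0 : (mollify d hρ hρs hη.continuous hηs u).dir v p =
      ∫ t, fderiv ℝ ρ t v • cutExtend d η u (p - t) := by
    rw [TestPlane.dir_apply]
    have h1 : fderiv ℝ (mollify d hρ hρs hη.continuous hηs u : ℝ × ℝ → ℂ) p = _ := hd.fderiv
    have hex := (hρs.fderiv ℝ).convolutionExists_left
      (ContinuousLinearMap.precompL (ℝ × ℝ) (ContinuousLinearMap.lsmul ℝ ℝ : ℝ →L[ℝ] ℂ →L[ℝ] ℂ))
      (μ := volume)
      (hρ.continuous_fderiv (by simp)) hloc p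
    rw [h1, convolution_def, ContinuousLinearMap.integral_apply hex]
    rfl
  have hηd : Continuous fun q => fderiv ℝ η q v := continuous_fderiv_dir hη v
  have hηds : HasCompactSupport fun q => fderiv ℝ η q v := hηs.fderiv_apply ℝ v
  have flip (g : ℝ × ℝ → ℝ) (f : ℝ × ℝ → ℂ) :
      ∫ t, g t • f (p - t) = ∫ q, g (p - q) • f q := by
    rw [← integral_sub_left_eq_self _ volume p]; simp
  rw [e0, flip (fun t => fderiv ℝ ρ t v), flip ρ fun q => cutExtend d η w q +
    cutExtend d (fun q => fderiv ℝ η q v) u q]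
  -- The test function at which the weak derivative of `u` is evaluated.
  set χ : ℝ × ℝ → ℝ := fun q => ρ (p - q) * η q with hχ
  have hχc : ContDiff ℝ ∞ χ := (hρ.comp (contDiff_const.sub contDiff_id)).mul hη
  have hχs : HasCompactSupport χ := hηs.mul_left
  have hχt : tsupport χ ⊆ strip d := by
    intro q hq
    have h1 : q ∈ tsupport η := tsupport_mul_subset_right hq
    have h2 : q ∈ tsupport fun q => ρ (p - q) := tsupport_mul_subset_left hq
    exact hp q h1 (tsupport_comp_subset_preimage ρ (f := fun q => p - q) (by fun_prop) h2)
  have hχd (q : ℝ × ℝ) : fderiv ℝ χ q v =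
      -(fderiv ℝ ρ (p - q) v * η q) + ρ (p - q) * fderiv ℝ η q v := by
    have h1 : HasFDerivAt (fun q => ρ (p - q)) (-(fderiv ℝ ρ (p - q))) q := by
      have h := (hρ.differentiable (by simp) (p - q)).hasFDerivAt.comp q
        ((hasFDerivAt_id (𝕜 := ℝ) q).const_sub p)
      refine h.congr_fderiv ?_
      ext <;> simp
    have h2 : fderiv ℝ χ q = _ := (h1.mul (hη.differentiable (by simp) q).hasFDerivAt).fderiv
    rw [h2]
    simp
    ring
  have key := hu χ hχc hχs hχt
  simp_rw [hχd] at key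
  have hρp : Continuous fun q => ρ (p - q) := hρ.continuous.comp (by fun_prop)
  have i1 : Integrable (fun q => (fderiv ℝ ρ (p - q) v * η q) • u q)
      (volume.restrict (strip d)) :=
    integrable_smul_strip (((continuous_fderiv_dir hρ v).comp (by fun_prop)).mul hη.continuous)
      hηs.mul_left u
  have i2 : Integrable (fun q => (ρ (p - q) * fderiv ℝ η q v) • u q)
      (volume.restrict (strip d)) :=
    integrable_smul_strip (hρp.mul hηd) hηds.mul_left u
  simp_rw [add_smul, neg_smul] at key
  rw [integral_add (f := fun q => -((fderiv ℝ ρ (p - q) v * η q) • u q)) i1.neg i2,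
    integral_neg] at key
  have i3 : Integrable (fun q => ρ (p - q) • cutExtend d η w q) :=
    (memLp_one_iff_integrable.1 ((memLp_cutExtend hη.continuous hηs w).smul
      (hρp.memLp_of_hasCompactSupport (p := 2) (hρs.comp_homeomorph (Homeomorph.subLeft p)))))
  have i4 : Integrable (fun q => ρ (p - q) • cutExtend d (fun q => fderiv ℝ η q v) u q) :=
    (memLp_one_iff_integrable.1 ((memLp_cutExtend hηd hηds u).smul
      (hρp.memLp_of_hasCompactSupport (p := 2) (hρs.comp_homeomorph (Homeomorph.subLeft p)))))
  simp_rw [smul_add]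
  rw [integral_add i3 i4, integral_smul_cutExtend, integral_smul_cutExtend,
    integral_smul_cutExtend]
  linear_combination -key

lemma memLp_indicator_strip (w : L2Strip d) :
    MemLp ((strip d).indicator fun p => w p) 2 volume :=
  (memLp_indicator_iff_restrict (isOpen_strip d).measurableSet).2 (Lp.memLp w)

/-- Extension by zero of a function in `L²` of the strip. -/
def zeroExtend (w : L2Strip d) : Lp ℂ 2 (volume : Measure (ℝ × ℝ)) :=
  (memLp_indicator_strip w).toLp

lemma coeFn_zeroExtend (w : L2Strip d) :
    zeroExtend w =ᵐ[volume] (strip d).indicator fun p => w p :=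
  MemLp.coeFn_toLp _

lemma integral_conj_zeroExtend_mul (w : L2Strip d) (g : ℝ × ℝ → ℂ) :
    ∫ p, conj (zeroExtend w p) * g p = ∫ p in strip d, conj (w p) * g p := by
  rw [← integral_indicator (isOpen_strip d).measurableSet]
  refine integral_congr_ae ?_
  filter_upwards [coeFn_zeroExtend w] with p hp
  rw [hp]
  by_cases hs : p ∈ strip d <;> simp [hs]

lemma integral_smul_correlation_zeroExtend (w : L2Strip d) {f : ℝ × ℝ → ℂ}
    (hf : MemLp f 2 volume) {ρ : ℝ × ℝ → ℝ} (hc : Continuous ρ) (hs : HasCompactSupport ρ) :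
    ∫ t, ρ t • correlation (zeroExtend w) hf.toLp t =
      ∫ p in strip d, conj (w p) * ∫ t, ρ t • f (p - t) := by
  rw [← integral_mul_integral_eq_correlation _ _ hc hs, integral_conj_zeroExtend_mul]
  refine integral_congr_ae (Eventually.of_forall fun p => ?_)
  simp only
  congr 1
  refine integral_congr_ae ?_
  filter_upwards [(Measure.measurePreserving_sub_left volume p).quasiMeasurePreserving.ae
    hf.coeFn_toLp] with t ht
  rw [ht]

lemma correlation_zeroExtend_zero (w : L2Strip d) {f : ℝ × ℝ → ℂ} (hf : MemLp f 2 volume) :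
    correlation (zeroExtend w) hf.toLp 0 = ∫ p in strip d, conj (w p) * f p := by
  rw [correlation_eq, integral_conj_zeroExtend_mul]
  simp only [sub_zero]
  refine integral_congr_ae ?_
  filter_upwards [ae_restrict_of_ae (s := strip d) hf.coeFn_toLp] with p hp
  rw [hp]

/-- The pairing of `W` with the product of `U` and a cut-off function `η` vanishes if `W` is
orthogonal to test functions and the support of `η` allows for one-sided mollification. -/
lemma cut_orthogonal {W : Sobolev d} (hW : ∀ φ : TestPlane, ⟪W, φ.jet d⟫_ℂ = 0) (U : Sobolev d)
    {η : ℝ × ℝ → ℝ} (hη : ContDiff ℝ ∞ η) (hηs : HasCompactSupport η) {O : Set (ℝ × ℝ)}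
    (hO : IsOpen O) (h0 : 0 ∈ closure O)
    (hηO : ∀ p ∈ strip d, ∀ q ∈ tsupport η, p - q ∈ O → q ∈ strip d) :
    (∫ p in strip d, conj (comp d 0 W p) * (η p • comp d 0 U p)) +
    (∫ p in strip d, conj (comp d 1 W p) *
      (η p • comp d 1 U p + fderiv ℝ η p (1, 0) • comp d 0 U p)) +
    (∫ p in strip d, conj (comp d 2 W p) *
      (η p • comp d 2 U p + fderiv ℝ η p (0, 1) • comp d 0 U p)) = 0 := by
  have hηd (v : ℝ × ℝ) : Continuous fun q => fderiv ℝ η q v := continuous_fderiv_dir hη v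
  have hηds (v : ℝ × ℝ) : HasCompactSupport fun q => fderiv ℝ η q v := hηs.fderiv_apply ℝ v
  have m0 := memLp_cutExtend hη.continuous hηs (comp d 0 U)
  have m (i : Fin 3) (v : ℝ × ℝ) : MemLp (fun p => cutExtend d η (comp d i U) p +
      cutExtend d (fun q => fderiv ℝ η q v) (comp d 0 U) p) 2 volume :=
    (memLp_cutExtend hη.continuous hηs (comp d i U)).add
      (memLp_cutExtend (hηd v) (hηds v) (comp d 0 U))
  set G0 := correlation (zeroExtend (comp d 0 W)) m0.toLp with hG0
  set G1 := correlation (zeroExtend (comp d 1 W)) (m 1 (1, 0)).toLp with hG1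
  set G2 := correlation (zeroExtend (comp d 2 W)) (m 2 (0, 1)).toLp with hG2
  have c0 : Continuous G0 := continuous_correlation _ _
  have c1 : Continuous G1 := continuous_correlation _ _
  have c2 : Continuous G2 := continuous_correlation _ _
  have hcG : Continuous fun t => G0 t + G1 t + G2 t := (c0.add c1).add c2
  -- For each `ρ` supported in `O`, the mollification of `η U` is a test function whose gradient on
  -- the strip is the mollified gradient of `η U`. Orthogonality to it says that `ρ` integrates `G0
  -- + G1 + G2` to zero; by continuity this sum vanishes on `O` and on its closure, in particular at
  -- `0`.
  have hG : ∀ᵐ t ∂(volume : Measure (ℝ × ℝ)), t ∈ O → G0 t + G1 t + G2 t = 0 := by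
    refine hO.ae_eq_zero_of_integral_contDiff_smul_eq_zero
      (hcG.locallyIntegrable.locallyIntegrableOn _) fun ρ hρ hρs hρO => ?_
    have i {G : ℝ × ℝ → ℂ} (hc : Continuous G) : Integrable fun t => ρ t • G t :=
      (hρ.continuous.smul hc).integrable_of_hasCompactSupport hρs.smul_right
    simp_rw [smul_add]
    rw [integral_add (f := fun t => ρ t • G0 t + ρ t • G1 t) ((i c0).add (i c1)) (i c2),
      integral_add (i c0) (i c1), hG0, hG1, hG2,
      integral_smul_correlation_zeroExtend _ _ hρ.continuous hρs,
      integral_smul_correlation_zeroExtend _ _ hρ.continuous hρs,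
      integral_smul_correlation_zeroExtend _ _ hρ.continuous hρs]
    have h := hW (mollify d hρ hρs hη.continuous hηs (comp d 0 U))
    rw [Sobolev.inner_eq, comp_zero_jet, comp_one_jet, comp_two_jet] at h
    have hp : ∀ p ∈ strip d, ∀ q ∈ tsupport η, p - q ∈ tsupport ρ → q ∈ strip d :=
      fun p hp q hq hpq => hηO p hp q hq (hρO hpq)
    have e (φ : TestPlane) (w : L2Strip d) :
        ⟪w, TestPlane.toStrip d φ⟫_ℂ = ∫ p in strip d, conj (w p) * φ p :=
      inner_toL2_right φ.continuous φ.hasCompactSupport w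
    rw [e, e, e] at h
    rw [← h]
    refine congrArg₂ _ (congrArg₂ _ rfl ?_) ?_
    · refine setIntegral_congr_fun (isOpen_strip d).measurableSet fun p hps => ?_
      rw [mollify_dir_apply hρ hρs hη hηs U.isWeakGrad.1 (hp p hps)]
    · refine setIntegral_congr_fun (isOpen_strip d).measurableSet fun p hps => ?_
      rw [mollify_dir_apply hρ hρs hη hηs U.isWeakGrad.2 (hp p hps)]
  have hEq : EqOn (fun t => G0 t + G1 t + G2 t) (fun _ => 0) O :=
    Measure.eqOn_open_of_ae_eq ((ae_restrict_iff' hO.measurableSet).2 hG) hO hcG.continuousOn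
      continuousOn_const
  have hzero := hEq.closure hcG continuous_const h0
  simp only [hG0, hG1, hG2] at hzero
  rw [correlation_zeroExtend_zero, correlation_zeroExtend_zero, correlation_zeroExtend_zero]
    at hzero
  have ce (f : ℝ × ℝ → ℝ) (u : L2Strip d) {p : ℝ × ℝ} (hp : p ∈ strip d) :
    cutExtend d f u p = f p • u p := by simp [cutExtend, hp]
  rw [← hzero]
  refine congrArg₂ _ (congrArg₂ _ ?_ ?_) ?_
  all_goals
    refine setIntegral_congr_fun (isOpen_strip d).measurableSet fun p hps => ?_
    simp only [ce _ _ hps]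

lemma integrable_conj_mul_smul_strip {η : ℝ × ℝ → ℝ} (hc : Continuous η)
    (hs : HasCompactSupport η) (w u : L2Strip d) :
    Integrable (fun p => conj (w p) * (η p • u p)) (volume.restrict (strip d)) :=
  (Lp.memLp w).star.integrable_mul (memLp_smul_strip hc hs u)

lemma fderiv_dir_mul {η χ : ℝ × ℝ → ℝ} (hη : ContDiff ℝ ∞ η) (hχ : ContDiff ℝ ∞ χ)
    (p v : ℝ × ℝ) : fderiv ℝ (fun p => η p * χ p) p v =
      η p * fderiv ℝ χ p v + χ p * fderiv ℝ η p v := by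
  have h : fderiv ℝ (fun p => η p * χ p) p = _ :=
    ((hη.differentiable (by simp) p).hasFDerivAt.mul
      (hχ.differentiable (by simp) p).hasFDerivAt).fderiv
  rw [h]; rfl

/-- The pairing of `W` with the product of `U` and a cut-off function vanishes if `W` is
orthogonal to test functions. -/
lemma cut_orthogonal_of_pos (hd : 0 < d) {W : Sobolev d}
    (hW : ∀ φ : TestPlane, ⟪W, φ.jet d⟫_ℂ = 0) (U : Sobolev d)
    {η : ℝ × ℝ → ℝ} (hη : ContDiff ℝ ∞ η) (hηs : HasCompactSupport η) :
    (∫ p in strip d, conj (comp d 0 W p) * (η p • comp d 0 U p)) +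
    (∫ p in strip d, conj (comp d 1 W p) *
      (η p • comp d 1 U p + fderiv ℝ η p (1, 0) • comp d 0 U p)) +
    (∫ p in strip d, conj (comp d 2 W p) *
      (η p • comp d 2 U p + fderiv ℝ η p (0, 1) • comp d 0 U p)) = 0 := by
  -- A partition in `y`: `χ` vanishes for `y ≤ d / 3` and equals `1` for `y ≥ 2 d / 3`. The piece `η
  -- χ` stays away from `y = 0` and is mollified with values from below, which never cross `y = d`;
  -- the piece `η (1 - χ)` is treated with values from above.
  set χ : ℝ × ℝ → ℝ := fun p => Real.smoothTransition ((p.2 - d / 3) / (d / 3)) with hχ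
  have hχc : ContDiff ℝ ∞ χ := Real.smoothTransition.contDiff.comp (by fun_prop)
  have hχ1 : ContDiff ℝ ∞ fun p => 1 - χ p := contDiff_const.sub hχc
  have hs1 : tsupport (fun p => η p * χ p) ⊆ {p | d / 3 ≤ p.2} := by
    refine tsupport_mul_subset_right.trans (closure_minimal (fun p hp => ?_)
      (isClosed_le continuous_const continuous_snd))
    by_contra h
    simp only [mem_ofPred_eq, not_le] at h
    refine hp (Real.smoothTransition.zero_of_nonpos ?_)
    exact div_nonpos_of_nonpos_of_nonneg (by linarith) (by positivity)
  have hs2 : tsupport (fun p => η p * (1 - χ p)) ⊆ {p | p.2 ≤ 2 * d / 3} := by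
    refine tsupport_mul_subset_right.trans (closure_minimal (fun p hp => ?_)
      (isClosed_le continuous_snd continuous_const))
    by_contra h
    simp only [mem_ofPred_eq, not_le] at h
    refine hp ?_
    have : χ p = 1 := by
      refine Real.smoothTransition.one_of_one_le ?_
      rw [le_div_iff₀ (by positivity)]
      linarith
    simp [this]
  have k1 := cut_orthogonal hW U (hη.mul hχc) hηs.mul_right (O := {t : ℝ × ℝ | 0 < t.2})
    (isOpen_lt continuous_const continuous_snd)
    (by
      have : (fun t : ℝ => ((0, t) : ℝ × ℝ)) 0 ∈ closure {t : ℝ × ℝ | 0 < t.2} := by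
        refine map_mem_closure (s := Ioi (0 : ℝ)) (by fun_prop) ?_ fun t ht => ht
        rw [closure_Ioi]; exact self_mem_Ici
      exact this)
    (fun p hp q hq hpq => by
      have h1 := hs1 hq
      simp only [mem_ofPred_eq, Prod.snd_sub] at h1 hpq
      have h2 : p.2 < d := hp.2.2
      exact ⟨trivial, by constructor <;> linarith⟩)
  have k2 := cut_orthogonal hW U (hη.mul hχ1) hηs.mul_right (O := {t : ℝ × ℝ | t.2 < 0})
    (isOpen_lt continuous_snd continuous_const)
    (by
      have : (fun t : ℝ => ((0, t) : ℝ × ℝ)) 0 ∈ closure {t : ℝ × ℝ | t.2 < 0} := by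
        refine map_mem_closure (s := Iio (0 : ℝ)) (by fun_prop) ?_ fun t ht => ht
        rw [closure_Iio]; exact self_mem_Iic
      exact this)
    (fun p hp q hq hpq => by
      have h1 := hs2 hq
      simp only [mem_ofPred_eq, Prod.snd_sub] at h1 hpq
      have h2 : 0 < p.2 := hp.2.1
      exact ⟨trivial, by constructor <;> linarith⟩)
  have hdir (v : ℝ × ℝ) (p : ℝ × ℝ) : fderiv ℝ η p v =
      fderiv ℝ (fun p => η p * χ p) p v + fderiv ℝ (fun p => η p * (1 - χ p)) p v := by
    rw [fderiv_dir_mul hη hχc, fderiv_dir_mul hη hχ1, fderiv_const_sub]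
    simp
    ring
  have j {ζ : ℝ × ℝ → ℝ} (hζ : ContDiff ℝ ∞ ζ) (hζs : HasCompactSupport ζ) (i : Fin 3)
      (v : ℝ × ℝ) : Integrable (fun p => conj (comp d i W p) *
        (ζ p • comp d i U p + fderiv ℝ ζ p v • comp d 0 U p)) (volume.restrict (strip d)) := by
    simp_rw [mul_add]
    exact (integrable_conj_mul_smul_strip hζ.continuous hζs _ _).add
      (integrable_conj_mul_smul_strip (continuous_fderiv_dir hζ v) (hζs.fderiv_apply ℝ v) _ _)
  have e0 : ∫ p in strip d, conj (comp d 0 W p) * (η p • comp d 0 U p) =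
      (∫ p in strip d, conj (comp d 0 W p) * ((η p * χ p) • comp d 0 U p)) +
      ∫ p in strip d, conj (comp d 0 W p) * ((η p * (1 - χ p)) • comp d 0 U p) := by
    rw [← integral_add
      (integrable_conj_mul_smul_strip (hη.mul hχc).continuous hηs.mul_right _ _)
      (integrable_conj_mul_smul_strip (hη.mul hχ1).continuous hηs.mul_right _ _)]
    congr 1
    ext p
    rw [← mul_add, ← add_smul]
    ring_nf
  have e (i : Fin 3) (v : ℝ × ℝ) : ∫ p in strip d, conj (comp d i W p) *
        (η p • comp d i U p + fderiv ℝ η p v • comp d 0 U p) =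
      (∫ p in strip d, conj (comp d i W p) *
        ((η p * χ p) • comp d i U p + fderiv ℝ (fun p => η p * χ p) p v • comp d 0 U p)) +
      ∫ p in strip d, conj (comp d i W p) * ((η p * (1 - χ p)) • comp d i U p +
        fderiv ℝ (fun p => η p * (1 - χ p)) p v • comp d 0 U p) := by
    rw [← integral_add (j (hη.mul hχc) hηs.mul_right i v) (j (hη.mul hχ1) hηs.mul_right i v)]
    congr 1
    ext p
    rw [hdir v p]
    simp only [Complex.real_smul]
    push_cast
    ring
  rw [e0, e, e]
  linear_combination k1 + k2

/-- If `W` is orthogonal to all test functions, `cut_orthogonal_of_pos` with `U = W` and cut-offs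
`η` growing to `1` gives `‖W‖² = 0` in the limit. -/
theorem denseRange_jet (hd : 0 < d) : DenseRange (TestPlane.jet d) := by
  have hperp : (LinearMap.range (TestPlane.jet d))ᗮ = ⊥ := by
    refine (Submodule.eq_bot_iff _).2 fun W hW => ?_
    have hW' (φ : TestPlane) : ⟪W, φ.jet d⟫_ℂ = 0 :=
      inner_eq_zero_symm.1 ((Submodule.mem_orthogonal _ _).1 hW _ ⟨φ, rfl⟩)
    let b : ContDiffBump (0 : ℝ × ℝ) := ⟨1, 2, one_pos, one_lt_two⟩
    have hb : ContDiff ℝ ∞ (b : ℝ × ℝ → ℝ) := b.contDiff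
    -- The cut-off is dilated by `1 / s n`; its gradient carries the factor `s n` and disappears in
    -- the limit.
    let s (n : ℕ) : ℝ := 1 / ((n : ℝ) + 1)
    have hs0 (n : ℕ) : 0 < s n := by positivity
    have hs1 (n : ℕ) : s n ≤ 1 := by
      rw [div_le_one (by positivity)]; linarith [n.cast_nonneg (α := ℝ)]
    have hslim : Tendsto s atTop (𝓝 0) := tendsto_one_div_add_atTop_nhds_zero_nat
    let η (n : ℕ) (p : ℝ × ℝ) : ℝ := b (s n • p)
    have hη (n : ℕ) : ContDiff ℝ ∞ (η n) := hb.comp (by fun_prop)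
    have hηs (n : ℕ) : HasCompactSupport (η n) :=
      b.hasCompactSupport.comp_homeomorph (Homeomorph.smulOfNeZero (s n) (hs0 n).ne')
    have hηd (n : ℕ) (p v : ℝ × ℝ) : fderiv ℝ (η n) p v = s n * fderiv ℝ b (s n • p) v := by
      have h : fderiv ℝ (η n) p = _ :=
        ((hb.differentiable (by simp) (s n • p)).hasFDerivAt.comp p
        ((hasFDerivAt_id (𝕜 := ℝ) p).const_smul (s n))).fderiv
      rw [h]; simp
    have hbd (v : ℝ × ℝ) : ∃ C, ∀ p, ‖fderiv ℝ b p v‖ ≤ C :=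
      (b.hasCompactSupport.fderiv_apply ℝ v).exists_bound_of_continuous
        (continuous_fderiv_dir hb v)
    have hη1 (n : ℕ) (p : ℝ × ℝ) : ‖η n p‖ ≤ 1 := by
      rw [Real.norm_of_nonneg b.nonneg]; exact b.le_one
    have hlimη (p : ℝ × ℝ) : Tendsto (fun n => η n p) atTop (𝓝 1) := by
      have h1 : Tendsto (fun n => s n • p) atTop (𝓝 0) := by
        simpa using hslim.smul_const p
      have h2 := (hb.continuous.tendsto 0).comp h1
      rwa [b.one_of_mem_closedBall (by simp [b.rIn_pos.le])] at h2
    have hlimd (p v : ℝ × ℝ) : Tendsto (fun n => fderiv ℝ (η n) p v) atTop (𝓝 0) := by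
      obtain ⟨C, hC⟩ := hbd v
      refine squeeze_zero_norm (a := fun n => s n * C) (fun n => ?_) (by simpa using hslim.mul_const C)
      rw [hηd, norm_mul, Real.norm_of_nonneg (hs0 n).le]
      exact mul_le_mul_of_nonneg_left (hC _) (hs0 n).le
    have hint (w u : L2Strip d) : Integrable (fun p => conj (w p) * u p)
        (volume.restrict (strip d)) := (Lp.memLp w).star.integrable_mul (Lp.memLp u)
    have l0 : Tendsto (fun n => ∫ p in strip d, conj (comp d 0 W p) * (η n p • comp d 0 W p))
        atTop (𝓝 (∫ p in strip d, conj (comp d 0 W p) * comp d 0 W p)) := by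
      refine tendsto_integral_of_dominated_convergence
        (fun p => ‖conj (comp d 0 W p) * comp d 0 W p‖)
        (fun n => (integrable_conj_mul_smul_strip (hη n).continuous (hηs n) _ _).1)
        (hint _ _).norm (fun n => Eventually.of_forall fun p => ?_)
        (Eventually.of_forall fun p => ?_)
      · rw [mul_smul_comm, norm_smul]
        exact mul_le_of_le_one_left (norm_nonneg _) (hη1 n p)
      · have := ((hlimη p).smul_const (comp d 0 W p)).const_mul (conj (comp d 0 W p))
        simpa using this
    have l (i : Fin 3) (v : ℝ × ℝ) : Tendsto (fun n => ∫ p in strip d, conj (comp d i W p) *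
        (η n p • comp d i W p + fderiv ℝ (η n) p v • comp d 0 W p))
        atTop (𝓝 (∫ p in strip d, conj (comp d i W p) * comp d i W p)) := by
      obtain ⟨C, hC⟩ := hbd v
      refine tendsto_integral_of_dominated_convergence
        (fun p => ‖conj (comp d i W p) * comp d i W p‖ +
          C * ‖conj (comp d i W p) * comp d 0 W p‖)
        (fun n => ?_)
        ((hint _ _).norm.add ((hint _ _).norm.const_mul C))
        (fun n => Eventually.of_forall fun p => ?_)
        (Eventually.of_forall fun p => ?_)
      · simp_rw [mul_add]
        exact ((integrable_conj_mul_smul_strip (hη n).continuous (hηs n) _ _).add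
          (integrable_conj_mul_smul_strip (continuous_fderiv_dir (hη n) v)
            ((hηs n).fderiv_apply ℝ v) _ _)).1
      · rw [mul_add, mul_smul_comm, mul_smul_comm]
        refine (norm_add_le _ _).trans (add_le_add ?_ ?_)
        · rw [norm_smul]
          exact mul_le_of_le_one_left (norm_nonneg _) (hη1 n p)
        · rw [norm_smul, hηd, norm_mul, Real.norm_of_nonneg (hs0 n).le]
          refine mul_le_mul_of_nonneg_right ?_ (norm_nonneg _)
          exact (mul_le_of_le_one_left (norm_nonneg _) (hs1 n)).trans (hC _)
      · have := (((hlimη p).smul_const (comp d i W p)).add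
          ((hlimd p v).smul_const (comp d 0 W p))).const_mul (conj (comp d i W p))
        simpa using this
    have htot := (l0.add (l 1 (1, 0))).add (l 2 (0, 1))
    have hz := tendsto_nhds_unique htot
      (tendsto_const_nhds.congr fun n => (cut_orthogonal_of_pos hd hW' W (hη n) (hηs n)).symm)
    have ei (u : L2Strip d) : ∫ p in strip d, conj (u p) * u p = ⟪u, u⟫_ℂ := by
      rw [L2.inner_def]
      simp only [RCLike.inner_apply, mul_comm]
    rw [ei, ei, ei, ← Sobolev.inner_eq] at hz
    exact inner_self_eq_zero.1 hz
  have := (Submodule.topologicalClosure_eq_top_iff).2 hperp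
  exact (Submodule.dense_iff_topologicalClosure_eq_top (s := LinearMap.range (TestPlane.jet d))).2 this

end Density

end

noncomputable section

open scoped InnerProductSpace ComplexConjugate
open Sobolev

/-! ### Slices of test functions, the trace operator and Green's formulas -/

namespace TestPlane

variable {d : ℝ} (φ ψ : TestPlane)

lemma hasDerivAt_right (x y : ℝ) : HasDerivAt (fun y => φ (x, y)) (φ.dir (0, 1) (x, y)) y :=
  (φ.differentiable (x, y)).hasFDerivAt.comp_hasDerivAt y
    ((hasDerivAt_const y x).prodMk (hasDerivAt_id y))

lemma hasDerivAt_left (x y : ℝ) : HasDerivAt (fun x => φ (x, y)) (φ.dir (1, 0) (x, y)) x :=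
  (φ.differentiable (x, y)).hasFDerivAt.comp_hasDerivAt x
    ((hasDerivAt_id x).prodMk (hasDerivAt_const x y))

lemma continuous_slice_right (x : ℝ) : Continuous fun y => φ (x, y) :=
  φ.continuous.comp (by fun_prop)

lemma continuous_slice_left (y : ℝ) : Continuous fun x => φ (x, y) :=
  φ.continuous.comp (by fun_prop)

lemma integrable_slice_left (y : ℝ) : Integrable fun x => φ (x, y) :=
  (φ.continuous_slice_left y).integrable_of_hasCompactSupport
    (hasCompactSupport_slice_left φ.hasCompactSupport y)

lemma integral_dir_left (d : ℝ) : ∫ p in strip d, φ.dir (1, 0) p = 0 := by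
  have hi : Integrable (φ.dir (1, 0)) (volume.restrict (strip d)) :=
    (φ.dir (1, 0)).continuous.integrable_of_hasCompactSupport (φ.dir (1, 0)).hasCompactSupport
  rw [restrict_strip_eq] at hi ⊢
  rw [integral_prod_symm _ hi]
  refine integral_eq_zero_of_ae (Eventually.of_forall fun y => ?_)
  exact integral_eq_zero_of_hasDerivAt_of_integrable (fun x => φ.hasDerivAt_left x y)
    ((φ.dir (1, 0)).integrable_slice_left y) (φ.integrable_slice_left y)

lemma integral_dir_right (hd : 0 ≤ d) : ∫ p in strip d, φ.dir (0, 1) p =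
    (∫ x, φ (x, d)) - ∫ x, φ (x, 0) := by
  rw [integral_strip hd (φ.dir (0, 1)).continuous (φ.dir (0, 1)).hasCompactSupport,
    ← integral_sub (φ.integrable_slice_left d) (φ.integrable_slice_left 0)]
  refine integral_congr_ae (Eventually.of_forall fun x => ?_)
  exact intervalIntegral.integral_eq_sub_of_hasDerivAt (fun y _ => φ.hasDerivAt_right x y)
    (((φ.dir (0, 1)).continuous_slice_right x).intervalIntegrable _ _)

/-- The product `conj φ * ψ` of test functions. -/
def conjMul : TestPlane :=
  ⟨fun p => conj (φ p) * ψ p, (Complex.conjCLE.contDiff.comp φ.contDiff).mul ψ.contDiff,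
    ψ.hasCompactSupport.mul_left⟩

lemma conjMul_dir_apply (v p : ℝ × ℝ) :
    (conjMul φ ψ).dir v p = conj (φ.dir v p) * ψ p + conj (φ p) * ψ.dir v p := by
  have h1 : HasFDerivAt (fun p => conj (φ p)) _ p :=
    Complex.conjCLE.hasFDerivAt.comp p (φ.differentiable p).hasFDerivAt
  have h : fderiv ℝ (conjMul φ ψ : ℝ × ℝ → ℂ) p = _ :=
    (h1.mul (ψ.differentiable p).hasFDerivAt).fderiv
  rw [dir_apply, h]
  simp [dir_apply]
  ring

lemma inner_toStrip (φ ψ : TestPlane) :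
    ⟪toStrip d φ, toStrip d ψ⟫_ℂ = ∫ p in strip d, conj (φ p) * ψ p :=
  inner_toL2 φ.continuous φ.hasCompactSupport ψ.continuous ψ.hasCompactSupport

lemma inner_toLine (c : ℝ) (φ ψ : TestPlane) :
    ⟪toLine c φ, toLine c ψ⟫_ℂ = ∫ x, conj (φ (x, c)) * ψ (x, c) :=
  inner_toL2 (φ.continuous_slice_left c) (hasCompactSupport_slice_left φ.hasCompactSupport c)
    (ψ.continuous_slice_left c) (hasCompactSupport_slice_left ψ.hasCompactSupport c)

lemma norm_sq_toStrip (φ : TestPlane) : ‖toStrip d φ‖ ^ 2 = ∫ p in strip d, ‖φ p‖ ^ 2 :=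
  norm_sq_toL2 φ.continuous φ.hasCompactSupport

lemma norm_sq_toLine (c : ℝ) (φ : TestPlane) : ‖toLine c φ‖ ^ 2 = ∫ x, ‖φ (x, c)‖ ^ 2 :=
  norm_sq_toL2 (φ.continuous_slice_left c) (hasCompactSupport_slice_left φ.hasCompactSupport c)

lemma hasCompactSupport_norm_sq (φ : TestPlane) : HasCompactSupport fun p => ‖φ p‖ ^ 2 :=
  φ.hasCompactSupport.comp_left (g := fun z : ℂ => ‖z‖ ^ 2) (by simp)

lemma continuous_norm_sq (φ : TestPlane) : Continuous fun p => ‖φ p‖ ^ 2 :=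
  φ.continuous.norm.pow 2

lemma norm_sq_toStrip_eq (hd : 0 ≤ d) (φ : TestPlane) :
    ‖toStrip d φ‖ ^ 2 = ∫ x, ∫ y in 0..d, ‖φ (x, y)‖ ^ 2 := by
  rw [norm_sq_toStrip, integral_strip hd φ.continuous_norm_sq φ.hasCompactSupport_norm_sq]

lemma integrable_norm_sq_slice (hd : 0 ≤ d) (φ : TestPlane) :
    Integrable fun x => ∫ y in 0..d, ‖φ (x, y)‖ ^ 2 :=
  integrable_strip_slice hd φ.continuous_norm_sq φ.hasCompactSupport_norm_sq

lemma integrable_norm_sq_slice_left (c : ℝ) (φ : TestPlane) :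
    Integrable fun x => ‖φ (x, c)‖ ^ 2 :=
  (φ.continuous_norm_sq.comp (by fun_prop)).integrable_of_hasCompactSupport
    (hasCompactSupport_slice_left φ.hasCompactSupport_norm_sq c)

lemma norm_sq_toLine_le (hd : 0 < d) {c : ℝ} (hc : c ∈ Icc 0 d) (φ : TestPlane) :
    d * ‖toLine c φ‖ ^ 2 ≤
      2 * ‖toStrip d φ‖ ^ 2 + 2 * d ^ 2 * ‖toStrip d (φ.dir (0, 1))‖ ^ 2 := by
  rw [norm_sq_toLine, norm_sq_toStrip_eq hd.le, norm_sq_toStrip_eq hd.le, ← integral_const_mul,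
    ← integral_const_mul, ← integral_const_mul,
    ← integral_add ((φ.integrable_norm_sq_slice hd.le).const_mul _)
      (((φ.dir (0, 1)).integrable_norm_sq_slice hd.le).const_mul _)]
  refine integral_mono ((φ.integrable_norm_sq_slice_left c).const_mul _)
    (((φ.integrable_norm_sq_slice hd.le).const_mul _).add
      (((φ.dir (0, 1)).integrable_norm_sq_slice hd.le).const_mul _)) fun x => ?_
  have := norm_sq_le_integral (fun y _ => (φ.hasDerivAt_right x y).hasDerivWithinAt)
    ((φ.dir (0, 1)).continuous_slice_right x).continuousOn hc
  simpa using this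

end TestPlane

/-- A constant for the trace inequality on the strip of width `d`. -/
def traceConst (d : ℝ) : ℝ := √(2 / d + 2 * d)

section Trace

variable {d c : ℝ}

lemma norm_toLine_le (hd : 0 < d) (hc : c ∈ Icc 0 d) (φ : TestPlane) :
    ‖TestPlane.toLine c φ‖ ≤ traceConst d * ‖φ.jet d‖ := by
  refine abs_le_of_sq_le_sq' ?_ (mul_nonneg (Real.sqrt_nonneg _) (norm_nonneg _)) |>.2
  rw [mul_pow, Real.sq_sqrt (by positivity), Sobolev.norm_sq_eq]
  simp only [comp_zero_jet, comp_one_jet, comp_two_jet]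
  have h := φ.norm_sq_toLine_le hd hc
  have e : (2 / d + 2 * d) = (2 + 2 * d ^ 2) / d := by field_simp
  rw [e, div_mul_eq_mul_div, le_div_iff₀ hd]
  nlinarith [sq_nonneg ‖TestPlane.toStrip d φ‖, sq_nonneg ‖TestPlane.toStrip d (φ.dir (1, 0))‖,
    sq_nonneg ‖TestPlane.toStrip d (φ.dir (0, 1))‖, sq_nonneg d,
    mul_nonneg (sq_nonneg d) (sq_nonneg ‖TestPlane.toStrip d φ‖),
    mul_nonneg (sq_nonneg d) (sq_nonneg ‖TestPlane.toStrip d (φ.dir (1, 0))‖)]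

/-- The trace operator on the line `y = c`. -/
def trace (d c : ℝ) : Sobolev d →L[ℂ] Lp ℂ 2 (volume : Measure ℝ) :=
  (TestPlane.toLine c).extendOfNorm (TestPlane.jet d)

lemma trace_jet (hd : 0 < d) (hc : c ∈ Icc 0 d) (φ : TestPlane) :
    trace d c (φ.jet d) = TestPlane.toLine c φ :=
  LinearMap.extendOfNorm_eq (denseRange_jet hd) ⟨_, norm_toLine_le hd hc⟩ φ

lemma norm_trace_le (hd : 0 < d) (hc : c ∈ Icc 0 d) (U : Sobolev d) :
    ‖trace d c U‖ ≤ traceConst d * ‖U‖ :=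
  LinearMap.norm_extendOfNorm_apply_le (denseRange_jet hd) _ (norm_toLine_le hd hc) U

lemma tendsto_toL2_iff {X : Type*} [TopologicalSpace X] [MeasurableSpace X]
    [OpensMeasurableSpace X] {μ : Measure X} [IsFiniteMeasureOnCompacts μ] {f : ℕ → X → ℂ}
    (hc : ∀ n, Continuous (f n)) (hs : ∀ n, HasCompactSupport (f n)) (u : Lp ℂ 2 μ) :
    Tendsto (fun n => toL2 μ (f n) (hc n) (hs n)) atTop (𝓝 u) ↔
      Tendsto (fun n => eLpNorm (fun x => f n x - u x) 2 μ) atTop (𝓝 0) := by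
  rw [Lp.tendsto_Lp_iff_tendsto_eLpNorm']
  refine tendsto_congr fun n => eLpNorm_congr_ae ?_
  filter_upwards [coeFn_toL2 (hc n) (hs n)] with x hx
  rw [Pi.sub_apply, hx]

lemma tendsto_sobolev_iff {U : Sobolev d} {F : ℕ → Sobolev d} :
    Tendsto F atTop (𝓝 U) ↔ ∀ i, Tendsto (fun n => comp d i (F n)) atTop (𝓝 (comp d i U)) := by
  refine ⟨fun h i => ((comp d i).continuous.tendsto U).comp h, fun h => ?_⟩
  have hn (i : Fin 3) : Tendsto (fun n => ‖comp d i (F n - U)‖ ^ 2) atTop (𝓝 0) := by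
    have := (tendsto_iff_norm_sub_tendsto_zero.1 (h i)).pow 2
    simpa using this
  have h2 : Tendsto (fun n => ‖F n - U‖ ^ 2) atTop (𝓝 0) := by
    simp_rw [Sobolev.norm_sq_eq]
    simpa using ((hn 0).add (hn 1)).add (hn 2)
  rw [tendsto_iff_norm_sub_tendsto_zero]
  have h3 := h2.sqrt
  simpa using h3

/-- The definition by approximating sequences agrees with the continuous trace operator: continuity
makes the limit on the line unique, and density supplies a sequence. -/
theorem isTrace_iff (hd : 0 < d) (hc : c ∈ Icc 0 d) (U : Sobolev d)
    (g : Lp ℂ 2 (volume : Measure ℝ)) : IsTrace d c (comp d 0 U) g ↔ trace d c U = g := by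
  constructor
  · rintro ⟨ux, uy, hu, φ, hφ, h0, h1, h2, h3⟩
    have hU : U = Sobolev.mk hu := Sobolev.ext rfl
    let Φ (n : ℕ) : TestPlane := ⟨φ n, hφ n⟩
    have hlim : Tendsto (fun n => (Φ n).jet d) atTop (𝓝 U) := by
      rw [hU, tendsto_sobolev_iff]
      intro i
      fin_cases i
      · exact (tendsto_toL2_iff (fun n => (Φ n).continuous)
          (fun n => (Φ n).hasCompactSupport) _).2 h0
      · exact (tendsto_toL2_iff (fun n => ((Φ n).dir (1, 0)).continuous)
          (fun n => ((Φ n).dir (1, 0)).hasCompactSupport) _).2 h1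
      · exact (tendsto_toL2_iff (fun n => ((Φ n).dir (0, 1)).continuous)
          (fun n => ((Φ n).dir (0, 1)).hasCompactSupport) _).2 h2
    have hl1 := ((trace d c).continuous.tendsto U).comp hlim
    have hl2 : Tendsto (fun n => TestPlane.toLine c (Φ n)) atTop (𝓝 g) :=
      (tendsto_toL2_iff (fun n => (Φ n).continuous_slice_left c)
        (fun n => hasCompactSupport_slice_left (Φ n).hasCompactSupport c) _).2 h3
    refine tendsto_nhds_unique hl1 (hl2.congr fun n => ?_)
    exact (trace_jet hd hc (Φ n)).symm
  · rintro rfl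
    obtain ⟨F, hF, hlim⟩ := mem_closure_iff_seq_limit.1 (denseRange_jet hd U)
    choose Φ hΦ using hF
    have hlim' : Tendsto (fun n => (Φ n).jet d) atTop (𝓝 U) := by simpa only [hΦ] using hlim
    have hc' := tendsto_sobolev_iff.1 hlim'
    refine ⟨comp d 1 U, comp d 2 U, U.isWeakGrad, fun n => Φ n, fun n => (Φ n).2, ?_, ?_, ?_, ?_⟩
    · exact (tendsto_toL2_iff (fun n => (Φ n).continuous)
          (fun n => (Φ n).hasCompactSupport) _).1 (hc' 0)
    · exact (tendsto_toL2_iff (fun n => ((Φ n).dir (1, 0)).continuous)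
          (fun n => ((Φ n).dir (1, 0)).hasCompactSupport) _).1 (hc' 1)
    · exact (tendsto_toL2_iff (fun n => ((Φ n).dir (0, 1)).continuous)
          (fun n => ((Φ n).dir (0, 1)).hasCompactSupport) _).1 (hc' 2)
    · refine (tendsto_toL2_iff (fun n => (Φ n).continuous_slice_left c)
        (fun n => hasCompactSupport_slice_left (Φ n).hasCompactSupport c) _).1 ?_
      refine (((trace d c).continuous.tendsto U).comp hlim').congr fun n => ?_
      exact trace_jet hd hc (Φ n)

/-- Integration by parts in the longitudinal direction. -/
theorem green_left (hd : 0 < d) (U W : Sobolev d) :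
    ⟪comp d 1 U, comp d 0 W⟫_ℂ + ⟪comp d 0 U, comp d 1 W⟫_ℂ = 0 := by
  refine (denseRange_jet hd).induction_on₂ (p := fun U W =>
    ⟪comp d 1 U, comp d 0 W⟫_ℂ + ⟪comp d 0 U, comp d 1 W⟫_ℂ = 0)
    (isClosed_eq (by fun_prop) continuous_const) (fun φ ψ => ?_) U W
  have h := (φ.conjMul ψ).integral_dir_left d
  simp_rw [TestPlane.conjMul_dir_apply] at h
  simp only [comp_zero_jet, comp_one_jet, TestPlane.inner_toStrip]
  rw [← integral_add, h]
  · exact ((φ.dir (1, 0)).conjMul ψ).continuous.integrable_of_hasCompactSupport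
      ((φ.dir (1, 0)).conjMul ψ).hasCompactSupport
  · exact (φ.conjMul (ψ.dir (1, 0))).continuous.integrable_of_hasCompactSupport
      (φ.conjMul (ψ.dir (1, 0))).hasCompactSupport

/-- Integration by parts in the transversal direction. -/
theorem green_right (hd : 0 < d) (U W : Sobolev d) :
    ⟪comp d 2 U, comp d 0 W⟫_ℂ + ⟪comp d 0 U, comp d 2 W⟫_ℂ =
      ⟪trace d d U, trace d d W⟫_ℂ - ⟪trace d 0 U, trace d 0 W⟫_ℂ := by
  refine (denseRange_jet hd).induction_on₂ (p := fun U W =>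
    ⟪comp d 2 U, comp d 0 W⟫_ℂ + ⟪comp d 0 U, comp d 2 W⟫_ℂ =
      ⟪trace d d U, trace d d W⟫_ℂ - ⟪trace d 0 U, trace d 0 W⟫_ℂ)
    (isClosed_eq (by fun_prop) (by fun_prop)) (fun φ ψ => ?_) U W
  have h := (φ.conjMul ψ).integral_dir_right hd.le
  simp_rw [TestPlane.conjMul_dir_apply] at h
  simp only [comp_zero_jet, comp_two_jet, TestPlane.inner_toStrip,
    trace_jet hd (left_mem_Icc.2 hd.le), trace_jet hd (right_mem_Icc.2 hd.le),
    TestPlane.inner_toLine]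
  rw [← integral_add, h]
  · rfl
  · exact ((φ.dir (0, 1)).conjMul ψ).continuous.integrable_of_hasCompactSupport
      ((φ.dir (0, 1)).conjMul ψ).hasCompactSupport
  · exact (φ.conjMul (ψ.dir (0, 1))).continuous.integrable_of_hasCompactSupport
      (φ.conjMul (ψ.dir (0, 1))).hasCompactSupport

end Trace

end

noncomputable section

open scoped InnerProductSpace ComplexConjugate
open Sobolev

/-! ### Lipschitz bounds for functions in `W^{1,∞}` -/

section Lipschitz

lemma MeasureTheory.MemLp.exists_ae_norm_le {X E : Type*} [MeasurableSpace X]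
    [NormedAddCommGroup E] {μ : Measure X} {f : X → E} (hf : MemLp f ⊤ μ) :
    ∃ C : ℝ, 0 ≤ C ∧ ∀ᵐ x ∂μ, ‖f x‖ ≤ C := by
  have hlt : eLpNormEssSup f μ < ⊤ := by simpa using hf.2
  refine ⟨(eLpNormEssSup f μ).toReal, ENNReal.toReal_nonneg, ?_⟩
  filter_upwards [ae_le_eLpNormEssSup (f := f) (μ := μ)] with x hx
  have := ENNReal.toReal_mono hlt.ne hx
  simpa using this

/-- A function in `W^{1,∞}(ℝ)` is almost everywhere equal to a Lipschitz function. -/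
lemma MemW1Infty.exists_lipschitz {α : ℝ → ℝ} (hα : MemW1Infty α) :
    ∃ L : ℝ, 0 ≤ L ∧ ∀ k : ℝ, ∀ᵐ x, ‖α (x + k) - α x‖ ≤ L * |k| := by
  obtain ⟨hα, β, hβ, hweak⟩ := hα
  obtain ⟨L, hL, hLβ⟩ := hβ.exists_ae_norm_le
  have hαl : LocallyIntegrable α volume := hα.locallyIntegrable (by norm_num)
  -- The outer radius is a fixed multiple of the inner one; this is the condition under which
  -- mollifications of a locally integrable function converge almost everywhere.
  let b (n : ℕ) : ContDiffBump (0 : ℝ) :=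
    ⟨1 / ((n : ℝ) + 1), 2 * (1 / ((n : ℝ) + 1)), by positivity, by
      have : 0 < 1 / ((n : ℝ) + 1) := by positivity
      linarith⟩
  let F (n : ℕ) : ℝ → ℝ :=
    convolution ((b n).normed volume) α (ContinuousLinearMap.lsmul ℝ ℝ) volume
  have hlim : ∀ᵐ x, Tendsto (fun n => F n x) atTop (𝓝 (α x)) := by
    refine ContDiffBump.ae_convolution_tendsto_right_of_locallyIntegrable (K := 2) ?_
      (Eventually.of_forall fun n => le_rfl) hαl
    have h := (tendsto_one_div_add_atTop_nhds_zero_nat (𝕜 := ℝ)).const_mul 2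
    rwa [mul_zero] at h
  -- The derivative of the mollification is the mollification of `β`, and a nonnegative bump of
  -- integral `1` preserves the bound `L`.
  have hder (n : ℕ) (x : ℝ) : ∃ D, HasDerivAt (F n) D x ∧ ‖D‖ ≤ L := by
    set ρ := (b n).normed (volume : Measure ℝ) with hρ
    have hρc : ContDiff ℝ ∞ ρ := (b n).contDiff_normed
    have hρs : HasCompactSupport ρ := (b n).hasCompactSupport_normed
    have hd := hρs.hasDerivAt_convolution_left (ContinuousLinearMap.lsmul ℝ ℝ)
      (hρc.of_le (by simp)) hαl x
    refine ⟨_, hd, ?_⟩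
    rw [convolution_eq_swap]
    simp only [ContinuousLinearMap.lsmul_apply, smul_eq_mul]
    have hφc : ContDiff ℝ ∞ fun t => ρ (x - t) := hρc.comp (contDiff_const.sub contDiff_id)
    have hφs : HasCompactSupport fun t => ρ (x - t) := hρs.comp_homeomorph (Homeomorph.subLeft x)
    have hφd (t : ℝ) : deriv (fun t => ρ (x - t)) t = -deriv ρ (x - t) := by
      rw [deriv_comp_const_sub]
    have h := hweak _ hφc hφs
    simp_rw [hφd, neg_mul] at h
    rw [integral_neg, neg_inj] at h
    rw [h]
    have h1 : ∫ t, ρ (x - t) = 1 := by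
      rw [integral_sub_left_eq_self]; exact (b n).integral_normed
    calc ‖∫ t, ρ (x - t) * β t‖ ≤ ∫ t, ρ (x - t) * L := by
          refine norm_integral_le_of_norm_le
            ((hφc.continuous.integrable_of_hasCompactSupport hφs).mul_const L) ?_
          filter_upwards [hLβ] with t ht
          rw [norm_mul, Real.norm_of_nonneg ((b n).nonneg_normed _)]
          exact mul_le_mul_of_nonneg_left ht ((b n).nonneg_normed _)
      _ = L := by rw [integral_mul_const, h1, one_mul]
  choose D hD hDL using hder
  refine ⟨L, hL, fun k => ?_⟩
  filter_upwards [hlim, (measurePreserving_add_right volume k).quasiMeasurePreserving.ae hlim]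
    with x h1 h2
  refine le_of_tendsto (h2.sub h1).norm (Eventually.of_forall fun n => ?_)
  have := convex_univ.norm_image_sub_le_of_norm_hasDerivWithin_le (C := L) (x := x) (y := x + k)
    (fun y _ => (hD n y).hasDerivWithinAt) (fun y _ => hDL n y) (mem_univ _) (mem_univ _)
  simpa using this

end Lipschitz

/-! ### Multiplication operators on `L²` of the line -/

section Multiplication

variable {a : ℝ → ℝ}

/-- Multiplication by an essentially bounded real function in `L²(ℝ)`. -/
def mulOp (ha : MemLp a ⊤ volume) : Lp ℂ 2 (volume : Measure ℝ) →L[ℂ] Lp ℂ 2 (volume : Measure ℝ) :=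
  (ContinuousLinearMap.mul ℂ ℂ).holderL volume ⊤ 2 2 (ha.ofReal (K := ℂ)).toLp

lemma coeFn_mulOp (ha : MemLp a ⊤ volume) (g : Lp ℂ 2 (volume : Measure ℝ)) :
    mulOp ha g =ᵐ[volume] fun x => (a x : ℂ) * g x := by
  have h := ContinuousLinearMap.coeFn_holder (r := 2) (ContinuousLinearMap.mul ℂ ℂ)
    (ha.ofReal (K := ℂ)).toLp g
  filter_upwards [h, (ha.ofReal (K := ℂ)).coeFn_toLp] with x h1 h2
  have : mulOp ha g x = _ := h1
  rw [this, h2]; rfl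

lemma inner_mulOp_left (ha : MemLp a ⊤ volume) (f g : Lp ℂ 2 (volume : Measure ℝ)) :
    ⟪mulOp ha f, g⟫_ℂ = ∫ x, (a x : ℂ) * (conj (f x) * g x) := by
  rw [L2.inner_def]
  refine integral_congr_ae ?_
  filter_upwards [coeFn_mulOp ha f] with x hx
  simp only [hx, RCLike.inner_apply, map_mul, Complex.conj_ofReal]
  ring

lemma inner_mulOp_symm (ha : MemLp a ⊤ volume) (f g : Lp ℂ 2 (volume : Measure ℝ)) :
    ⟪mulOp ha f, g⟫_ℂ = ⟪f, mulOp ha g⟫_ℂ := by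
  rw [inner_mulOp_left, L2.inner_def]
  refine integral_congr_ae ?_
  filter_upwards [coeFn_mulOp ha g] with x hx
  simp only [hx, RCLike.inner_apply]
  ring

lemma inner_mulOp_self (ha : MemLp a ⊤ volume) (g : Lp ℂ 2 (volume : Measure ℝ)) :
    ⟪mulOp ha g, g⟫_ℂ = ((∫ x, a x * ‖g x‖ ^ 2 : ℝ) : ℂ) := by
  rw [inner_mulOp_left, ← integral_complex_ofReal]
  refine integral_congr_ae (Eventually.of_forall fun x => ?_)
  simp only [Complex.conj_mul']
  push_cast; rfl

lemma re_inner_mulOp_self_nonneg (ha : MemLp a ⊤ volume) (h0 : ∀ᵐ x, 0 ≤ a x)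
    (g : Lp ℂ 2 (volume : Measure ℝ)) : 0 ≤ (⟪mulOp ha g, g⟫_ℂ).re := by
  rw [inner_mulOp_self, Complex.ofReal_re]
  refine integral_nonneg_of_ae ?_
  filter_upwards [h0] with x hx
  exact mul_nonneg hx (sq_nonneg _)

lemma norm_mulOp_le (ha : MemLp a ⊤ volume) {C : ℝ} (hC : ∀ᵐ x, ‖a x‖ ≤ C)
    (g : Lp ℂ 2 (volume : Measure ℝ)) : ‖mulOp ha g‖ ≤ C * ‖g‖ := by
  refine Lp.norm_le_mul_norm_of_ae_le_mul ?_
  filter_upwards [coeFn_mulOp ha g, hC] with x hx h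
  rw [hx, norm_mul, Complex.norm_real]
  exact mul_le_mul_of_nonneg_right h (norm_nonneg _)

end Multiplication

/-! ### Longitudinal translations -/

section Translation

/-- Translation by `k` in `L²(ℝ)`. -/
def shiftLine (k : ℝ) : Lp ℂ 2 (volume : Measure ℝ) →ₗᵢ[ℂ] Lp ℂ 2 (volume : Measure ℝ) :=
  Lp.compMeasurePreservingₗᵢ ℂ (fun x => x + k) (measurePreserving_add_right volume k)

lemma coeFn_shiftLine (k : ℝ) (g : Lp ℂ 2 (volume : Measure ℝ)) :
    shiftLine k g =ᵐ[volume] fun x => g (x + k) :=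
  Lp.coeFn_compMeasurePreserving g (measurePreserving_add_right volume k)

lemma measurePreserving_shiftStrip (d k : ℝ) :
    MeasurePreserving (fun p : ℝ × ℝ => (p.1 + k, p.2)) (volume.restrict (strip d))
      (volume.restrict (strip d)) := by
  rw [restrict_strip_eq]
  exact (measurePreserving_add_right volume k).prod (MeasurePreserving.id _)

variable {d : ℝ}

/-- Longitudinal translation by `k` in `L²` of the strip. -/
def shiftStrip (d k : ℝ) : L2Strip d →ₗᵢ[ℂ] L2Strip d :=
  Lp.compMeasurePreservingₗᵢ ℂ _ (measurePreserving_shiftStrip d k)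

lemma coeFn_shiftStrip (k : ℝ) (u : L2Strip d) :
    shiftStrip d k u =ᵐ[volume.restrict (strip d)] fun p => u (p.1 + k, p.2) :=
  Lp.coeFn_compMeasurePreserving u (measurePreserving_shiftStrip d k)

lemma shiftLine_shiftLine_neg (k : ℝ) (g : Lp ℂ 2 (volume : Measure ℝ)) :
    shiftLine k (shiftLine (-k) g) = g := by
  apply Lp.ext
  filter_upwards [coeFn_shiftLine k (shiftLine (-k) g),
    (measurePreserving_add_right volume k).quasiMeasurePreserving.ae (coeFn_shiftLine (-k) g)]
    with x h1 h2
  rw [h1, h2, add_neg_cancel_right]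

lemma shiftStrip_shiftStrip (k l : ℝ) (u : L2Strip d) :
    shiftStrip d k (shiftStrip d l u) = shiftStrip d (k + l) u := by
  apply Lp.ext
  filter_upwards [coeFn_shiftStrip k (shiftStrip d l u), coeFn_shiftStrip (k + l) u,
    (measurePreserving_shiftStrip d k).quasiMeasurePreserving.ae (coeFn_shiftStrip l u)]
    with x h1 h2 h3
  rw [h1, h2, h3, add_assoc]

lemma shiftStrip_zero (u : L2Strip d) : shiftStrip d 0 u = u := by
  apply Lp.ext
  filter_upwards [coeFn_shiftStrip 0 u] with x h1
  rw [h1, add_zero]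

lemma inner_shiftLine (k : ℝ) (f g : Lp ℂ 2 (volume : Measure ℝ)) :
    ⟪shiftLine k f, g⟫_ℂ = ⟪f, shiftLine (-k) g⟫_ℂ := by
  conv_lhs => rw [← shiftLine_shiftLine_neg k g]
  rw [LinearIsometry.inner_map_map]

lemma inner_shiftStrip (k : ℝ) (f g : L2Strip d) :
    ⟪shiftStrip d k f, g⟫_ℂ = ⟪f, shiftStrip d (-k) g⟫_ℂ := by
  conv_lhs => rw [← shiftStrip_zero g, ← add_neg_cancel k, ← shiftStrip_shiftStrip]
  rw [LinearIsometry.inner_map_map]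

lemma IsWeakDeriv.shift {v : ℝ × ℝ} {u w : L2Strip d} (h : IsWeakDeriv d v u w) (k : ℝ) :
    IsWeakDeriv d v (shiftStrip d k u) (shiftStrip d k w) := by
  intro φ hφ hc hs
  set e : ℝ × ℝ := (k, 0) with he
  have key (g : ℝ × ℝ → ℝ) (u : L2Strip d) : ∫ p in strip d, g p • shiftStrip d k u p =
      ∫ p in strip d, g (p - e) • u p := by
    have hme : MeasurableEmbedding fun p : ℝ × ℝ => (p.1 + k, p.2) := by
      have h := (MeasurableEquiv.addRight e).measurableEmbedding
      have h2 : (fun p : ℝ × ℝ => (p.1 + k, p.2)) = MeasurableEquiv.addRight e := by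
        ext p <;> simp [he]
      rw [h2]; exact h
    have h1 := (measurePreserving_shiftStrip d k).integral_comp hme fun p => g (p - e) • u p
    rw [← h1]
    refine integral_congr_ae ?_
    filter_upwards [coeFn_shiftStrip k u] with p hp
    have h2 : ((p.1 + k, p.2) : ℝ × ℝ) - e = p := Prod.ext (by simp [he]) (by simp [he])
    rw [hp, h2]
  have hφe : ContDiff ℝ ∞ fun p => φ (p - e) := hφ.comp (contDiff_id.sub contDiff_const)
  have hφes : HasCompactSupport fun p => φ (p - e) := hc.comp_homeomorph (Homeomorph.subRight e)
  have hd (p : ℝ × ℝ) : fderiv ℝ (fun p => φ (p - e)) p = fderiv ℝ φ (p - e) := by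
    simp_rw [sub_eq_add_neg]
    rw [fderiv_comp_add_right]
  rw [key (fun p => fderiv ℝ φ p v), key, ← h _ hφe hφes]
  · simp_rw [hd]
  · intro p hp
    have h1 := hs (tsupport_comp_subset_preimage φ (f := fun p => p - e) (by fun_prop) hp)
    refine ⟨trivial, ?_⟩
    have := h1.2
    simpa [he] using this

lemma IsWeakGrad.shift {u ux uy : L2Strip d} (h : IsWeakGrad d u ux uy) (k : ℝ) :
    IsWeakGrad d (shiftStrip d k u) (shiftStrip d k ux) (shiftStrip d k uy) :=
  ⟨h.1.shift k, h.2.shift k⟩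

/-- Longitudinal translation by `k` in the Sobolev space. -/
def shiftSobolev (d k : ℝ) : Sobolev d →ₗᵢ[ℂ] Sobolev d where
  toFun U := Sobolev.mk (U.isWeakGrad.shift k)
  map_add' U W := Sobolev.ext (map_add (shiftStrip d k) (comp d 0 U) (comp d 0 W))
  map_smul' a U := Sobolev.ext (map_smul (shiftStrip d k) a (comp d 0 U))
  norm_map' U := by
    have h : ‖Sobolev.mk (U.isWeakGrad.shift k)‖ ^ 2 = ‖U‖ ^ 2 := by
      rw [Sobolev.norm_sq_eq, Sobolev.norm_sq_eq]
      simp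
    exact (sq_eq_sq₀ (norm_nonneg _) (norm_nonneg _)).1 h

lemma comp_shiftSobolev (k : ℝ) (i : Fin 3) (U : Sobolev d) :
    comp d i (shiftSobolev d k U) = shiftStrip d k (comp d i U) := by
  fin_cases i <;> rfl

/-- Longitudinal translation by `k` of a test function. -/
def TestPlane.shift (k : ℝ) (φ : TestPlane) : TestPlane :=
  ⟨fun p => φ (p + (k, 0)), φ.contDiff.comp (contDiff_id.add contDiff_const),
    φ.hasCompactSupport.comp_homeomorph (Homeomorph.addRight (k, 0))⟩

lemma shiftStrip_toStrip (k : ℝ) (φ : TestPlane) :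
    shiftStrip d k (TestPlane.toStrip d φ) = TestPlane.toStrip d (φ.shift k) := by
  apply Lp.ext
  filter_upwards [coeFn_shiftStrip k (TestPlane.toStrip d φ), (φ.shift k).coeFn_toStrip d,
    (measurePreserving_shiftStrip d k).quasiMeasurePreserving.ae (φ.coeFn_toStrip d)]
    with p h1 h2 h3
  rw [h1, h2, h3]
  exact congrArg φ (Prod.ext rfl (add_zero p.2).symm)

lemma trace_shiftSobolev (hd : 0 < d) {c : ℝ} (hc : c ∈ Icc 0 d) (k : ℝ) (U : Sobolev d) :
    trace d c (shiftSobolev d k U) = shiftLine k (trace d c U) := by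
  refine (denseRange_jet hd).induction_on (p := fun U =>
    trace d c (shiftSobolev d k U) = shiftLine k (trace d c U)) U
    (isClosed_eq ((trace d c).continuous.comp (shiftSobolev d k).continuous)
      ((shiftLine k).continuous.comp (trace d c).continuous)) fun φ => ?_
  have h1 : shiftSobolev d k (φ.jet d) = (φ.shift k).jet d :=
    Sobolev.ext (shiftStrip_toStrip k φ)
  rw [h1, trace_jet hd hc, trace_jet hd hc]
  apply Lp.ext
  have e (φ : TestPlane) : TestPlane.toLine c φ =ᵐ[volume] fun x => φ (x, c) :=
    coeFn_toL2 (φ.continuous_slice_left c) (hasCompactSupport_slice_left φ.hasCompactSupport c)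
  filter_upwards [coeFn_shiftLine k (TestPlane.toLine c φ), e (φ.shift k),
    (measurePreserving_add_right volume k).quasiMeasurePreserving.ae (e φ)] with x h1 h2 h3
  rw [h1, h2, h3]
  change φ ((x, c) + (k, 0)) = _
  simp

end Translation

end

noncomputable section

open scoped InnerProductSpace ComplexConjugate
open Sobolev

/-! ### Difference quotients in the longitudinal direction -/

section DifferenceQuotient

variable {d : ℝ}

/-- Dominated convergence: the quotients converge pointwise, the mean value inequality bounds them
by the supremum `M` of the derivative, and for small `k` they are supported in one compact set. -/
lemma tendsto_diffQuot_toStrip (φ : TestPlane) :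
    Tendsto (fun k : ℝ => k⁻¹ • (shiftStrip d k (TestPlane.toStrip d φ) - TestPlane.toStrip d φ))
      (𝓝[≠] 0) (𝓝 (TestPlane.toStrip d (φ.dir (1, 0)))) := by
  let Ψ (k : ℝ) : TestPlane := ((k⁻¹ : ℝ) : ℂ) • (φ.shift k - φ) - φ.dir (1, 0)
  have hΨ (k : ℝ) (p : ℝ × ℝ) :
      Ψ k p = k⁻¹ • (φ (p.1 + k, p.2) - φ p) - φ.dir (1, 0) p := by
    have e : φ.shift k p = φ (p.1 + k, p.2) := congrArg φ (Prod.ext rfl (add_zero p.2))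
    change ((k⁻¹ : ℝ) : ℂ) • (φ.shift k p - φ p) - φ.dir (1, 0) p = _
    rw [e]; simp
  obtain ⟨M, hM⟩ := (φ.dir (1, 0)).hasCompactSupport.exists_bound_of_continuous
    (φ.dir (1, 0)).continuous
  have hM0 : 0 ≤ M := (norm_nonneg _).trans (hM 0)
  have hquot (k : ℝ) (p : ℝ × ℝ) : ‖k⁻¹ • (φ (p.1 + k, p.2) - φ p)‖ ≤ M := by
    have h := convex_univ.norm_image_sub_le_of_norm_hasDerivWithin_le (C := M) (x := p.1)
      (y := p.1 + k) (fun y _ => (φ.hasDerivAt_left y p.2).hasDerivWithinAt)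
      (fun y _ => hM _) (mem_univ _) (mem_univ _)
    rw [add_sub_cancel_left] at h
    rw [norm_smul, norm_inv]
    rcases eq_or_ne k 0 with rfl | hk
    · simpa using hM0
    · rw [inv_mul_le_iff₀ (norm_pos_iff.2 hk), mul_comm]
      exact h
  -- All horizontal translates of the support by at most `1`.
  set K : Set (ℝ × ℝ) := (fun q : (ℝ × ℝ) × ℝ => (q.1.1 - q.2, q.1.2)) ''
    (tsupport φ ×ˢ Icc (-1) 1) with hK
  have hKc : IsCompact K := (φ.hasCompactSupport.isCompact.prod isCompact_Icc).image (by fun_prop)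
  have hout (k : ℝ) (hk : k ∈ Icc (-1 : ℝ) 1) (p : ℝ × ℝ) (hp : p ∉ K) : Ψ k p = 0 := by
    have h1 : φ (p.1 + k, p.2) = 0 := image_eq_zero_of_notMem_tsupport fun h =>
      hp ⟨((p.1 + k, p.2), k), ⟨h, hk⟩, by simp⟩
    have h2 : p ∉ tsupport φ := fun h => hp ⟨(p, 0), ⟨h, by simp⟩, by simp⟩
    have h3 : φ.dir (1, 0) p = 0 := by
      have : p ∉ tsupport (φ.dir (1, 0)) := fun h => h2 (tsupport_fderiv_apply_subset ℝ _ h)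
      exact image_eq_zero_of_notMem_tsupport this
    rw [hΨ, h1, h3, image_eq_zero_of_notMem_tsupport h2]; simp
  have hlim : Tendsto (fun k => ∫ p in strip d, ‖Ψ k p‖ ^ 2) (𝓝[≠] 0) (𝓝 0) := by
    suffices h : Tendsto (fun k => ∫ p in strip d, ‖Ψ k p‖ ^ 2) (𝓝[≠] 0)
        (𝓝 (∫ p in strip d, (fun _ => (0 : ℝ)) p)) by simpa using h
    refine tendsto_integral_filter_of_dominated_convergence
      (K.indicator fun _ => (2 * M) ^ 2)
      (Eventually.of_forall fun k => (Ψ k).continuous_norm_sq.aestronglyMeasurable) ?_ ?_ ?_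
    · have h1 : ∀ᶠ k : ℝ in 𝓝[≠] 0, k ∈ Icc (-1 : ℝ) 1 :=
        mem_nhdsWithin_of_mem_nhds (Icc_mem_nhds (by norm_num) (by norm_num))
      filter_upwards [h1] with k hk
      refine Eventually.of_forall fun p => ?_
      by_cases hp : p ∈ K
      · rw [indicator_of_mem hp, norm_pow, norm_norm]
        refine pow_le_pow_left₀ (norm_nonneg _) ?_ 2
        rw [hΨ, two_mul]
        exact (norm_sub_le _ _).trans (add_le_add (hquot k p) (hM p))
      · rw [indicator_of_notMem hp, hout k hk p hp]; simp
    · rw [integrable_indicator_iff hKc.measurableSet]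
      refine integrableOn_const ?_
      exact ((Measure.restrict_apply_le _ _).trans_lt hKc.measure_lt_top).ne
    · refine Eventually.of_forall fun ⟨x, y⟩ => ?_
      have h1 := hasDerivAt_iff_tendsto_slope_zero.1 (φ.hasDerivAt_left x y)
      have h2 := ((h1.sub_const (φ.dir (1, 0) (x, y))).norm).pow 2
      simpa only [hΨ, sub_self, norm_zero, zero_pow two_ne_zero, ne_eq, OfNat.ofNat_ne_zero,
        not_false_eq_true] using h2
  rw [tendsto_iff_norm_sub_tendsto_zero]
  have h3 := hlim.sqrt
  rw [Real.sqrt_zero] at h3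
  refine h3.congr fun k => ?_
  rw [← TestPlane.norm_sq_toStrip, Real.sqrt_sq (norm_nonneg _), shiftStrip_toStrip]
  simp only [Ψ, map_sub, map_smul]
  congr 2

lemma hasDerivAt_shiftStrip (φ : TestPlane) (t : ℝ) :
    HasDerivAt (fun k => shiftStrip d k (TestPlane.toStrip d φ))
      (shiftStrip d t (TestPlane.toStrip d (φ.dir (1, 0)))) t := by
  rw [hasDerivAt_iff_tendsto_slope_zero]
  refine (((shiftStrip d t).continuous.tendsto _).comp (tendsto_diffQuot_toStrip φ)).congr
    fun k => ?_
  simp only [Function.comp_apply]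
  have e (x : L2Strip d) : k⁻¹ • x = ((k⁻¹ : ℝ) : ℂ) • x := rfl
  rw [e, e, map_smul, map_sub, shiftStrip_shiftStrip]

/-- For a test function the orbit `k ↦ shiftStrip d k φ` has a derivative of constant norm, so the
mean value inequality applies; density does the rest. -/
lemma norm_shiftStrip_sub_le (hd : 0 < d) (U : Sobolev d) (k : ℝ) :
    ‖shiftStrip d k (comp d 0 U) - comp d 0 U‖ ≤ |k| * ‖comp d 1 U‖ := by
  refine (denseRange_jet hd).induction_on (p := fun U =>
    ‖shiftStrip d k (comp d 0 U) - comp d 0 U‖ ≤ |k| * ‖comp d 1 U‖) U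
    (isClosed_le (((shiftStrip d k).continuous.comp (comp d 0).continuous).sub
      (comp d 0).continuous).norm (by fun_prop)) fun φ => ?_
  have h := convex_univ.norm_image_sub_le_of_norm_hasDerivWithin_le
    (C := ‖TestPlane.toStrip d (φ.dir (1, 0))‖) (x := 0) (y := k)
    (fun y _ => (hasDerivAt_shiftStrip (d := d) φ y).hasDerivWithinAt)
    (fun y _ => by simp) (mem_univ _) (mem_univ _)
  rw [shiftStrip_zero, sub_zero, mul_comm] at h
  exact h

end DifferenceQuotient

/-! ### Weak derivatives by duality -/

section WeakDerivative

variable {d : ℝ}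

/-- Test functions supported in the strip. -/
def testStrip (d : ℝ) : Submodule ℂ TestPlane where
  carrier := {φ | tsupport φ ⊆ strip d}
  zero_mem' := by
    have : tsupport ((0 : TestPlane) : ℝ × ℝ → ℂ) = ∅ := tsupport_eq_empty_iff.2 rfl
    change tsupport ((0 : TestPlane) : ℝ × ℝ → ℂ) ⊆ strip d
    rw [this]; exact empty_subset _
  add_mem' {φ ψ} h h' := (tsupport_add (φ : ℝ × ℝ → ℂ) ψ).trans (union_subset h h')
  smul_mem' a φ h := (closure_mono (Function.support_const_smul_subset a (φ : ℝ × ℝ → ℂ))).trans h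

/-- A real test function as a complex one. -/
def TestPlane.ofRealFun {φ : ℝ × ℝ → ℝ} (hφ : ContDiff ℝ ∞ φ) (hs : HasCompactSupport φ) : TestPlane :=
  ⟨fun p => (φ p : ℂ), Complex.ofRealCLM.contDiff.comp hφ,
    hs.comp_left (g := fun t : ℝ => (t : ℂ)) Complex.ofReal_zero⟩

lemma TestPlane.dir_ofReal {φ : ℝ × ℝ → ℝ} (hφ : ContDiff ℝ ∞ φ) (hs : HasCompactSupport φ)
    (v p : ℝ × ℝ) : (TestPlane.ofRealFun hφ hs).dir v p = (fderiv ℝ φ p v : ℂ) := by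
  have h : fderiv ℝ (TestPlane.ofRealFun hφ hs : ℝ × ℝ → ℂ) p = _ :=
    (Complex.ofRealCLM.hasFDerivAt.comp p (hφ.differentiable (by simp) p).hasFDerivAt).fderiv
  rw [TestPlane.dir_apply, h]; rfl

lemma inner_ofReal {φ : ℝ × ℝ → ℝ} (hφ : ContDiff ℝ ∞ φ) (hs : HasCompactSupport φ)
    (u : L2Strip d) : ⟪TestPlane.toStrip d (TestPlane.ofRealFun hφ hs), u⟫_ℂ =
      ∫ p in strip d, φ p • u p :=
  (integral_smul_eq_inner hφ.continuous hs u).symm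

lemma inner_dir_ofReal {φ : ℝ × ℝ → ℝ} (hφ : ContDiff ℝ ∞ φ) (hs : HasCompactSupport φ)
    (v : ℝ × ℝ) (u : L2Strip d) :
    ⟪TestPlane.toStrip d ((TestPlane.ofRealFun hφ hs).dir v), u⟫_ℂ =
      ∫ p in strip d, fderiv ℝ φ p v • u p := by
  rw [integral_smul_eq_inner (continuous_fderiv_dir hφ v) (hs.fderiv_apply ℝ v) u]
  congr 1
  exact toL2_congr (hc := ((TestPlane.ofRealFun hφ hs).dir v).continuous)
    (hs := ((TestPlane.ofRealFun hφ hs).dir v).hasCompactSupport) (Eventually.of_forall fun p => TestPlane.dir_ofReal hφ hs v p)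

lemma tsupport_ofReal_subset {φ : ℝ × ℝ → ℝ} (hφ : ContDiff ℝ ∞ φ) (hs : HasCompactSupport φ) :
    tsupport (TestPlane.ofRealFun hφ hs) ⊆ tsupport φ :=
  closure_mono fun p hp h => hp (by change ((φ p : ℝ) : ℂ) = 0; rw [h, Complex.ofReal_zero])

/-- The bound lets `f` factor through the range of `e` as a bounded functional; Hahn–Banach extends
it and Riesz represents it. -/
lemma exists_inner_eq_of_bound {X H : Type*} [AddCommGroup X] [Module ℂ X]
    [NormedAddCommGroup H] [InnerProductSpace ℂ H] [CompleteSpace H] (f : X →ₗ[ℂ] ℂ)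
    (e : X →ₗ[ℂ] H) {C : ℝ} (h : ∀ x, ‖f x‖ ≤ C * ‖e x‖) : ∃ w : H, ∀ x, ⟪w, e x⟫_ℂ = f x := by
  obtain ⟨g, hg, -⟩ := exists_extension_norm_eq (LinearMap.range e) (f.compLeftInverse e)
  refine ⟨(InnerProductSpace.toDual ℂ H).symm g, fun x => ?_⟩
  rw [InnerProductSpace.toDual_symm_apply]
  exact (hg ⟨e x, LinearMap.mem_range_self e x⟩).trans
    (LinearMap.compLeftInverse_apply_of_bdd _ _ ⟨C, h⟩ _ _ rfl)

/-- A function has a weak derivative in `L²` if the pairing with the derivatives of test functions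
is bounded in the `L²` norm. -/
lemma exists_isWeakDeriv_of_bound {v : ℝ × ℝ} {u : L2Strip d} {C : ℝ}
    (hC : ∀ φ : TestPlane, tsupport φ ⊆ strip d →
      ‖⟪u, TestPlane.toStrip d (φ.dir v)⟫_ℂ‖ ≤ C * ‖TestPlane.toStrip d φ‖) :
    ∃ w, IsWeakDeriv d v u w := by
  let e : testStrip d →ₗ[ℂ] L2Strip d := TestPlane.toStrip d ∘ₗ (testStrip d).subtype
  let f : testStrip d →ₗ[ℂ] ℂ :=
    { toFun := fun φ => ⟪u, TestPlane.toStrip d ((φ : TestPlane).dir v)⟫_ℂ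
      map_add' := fun φ ψ => by
        rw [Submodule.coe_add, TestPlane.dir_add, map_add, inner_add_right]
      map_smul' := fun a φ => by
        rw [Submodule.coe_smul, TestPlane.dir_smul, map_smul, inner_smul_right]; rfl }
  obtain ⟨w, hw⟩ := exists_inner_eq_of_bound f e fun φ : testStrip d => hC φ.1 φ.2
  refine ⟨-w, fun φ hφ hs ht => ?_⟩
  have h := hw ⟨TestPlane.ofRealFun hφ hs, (tsupport_ofReal_subset hφ hs).trans ht⟩
  have h2 := congrArg conj h
  rw [inner_conj_symm] at h2
  change _ = conj ⟪u, TestPlane.toStrip d ((TestPlane.ofRealFun hφ hs).dir v)⟫_ℂ at h2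
  rw [inner_conj_symm, inner_dir_ofReal] at h2
  rw [← h2, ← inner_ofReal hφ hs, inner_neg_right, neg_neg]
  rfl

/-- Weak derivatives are defined by real test functions; a complex one is split into real and
imaginary part. -/
lemma IsWeakDeriv.inner_dir {v : ℝ × ℝ} {u w : L2Strip d} (h : IsWeakDeriv d v u w)
    {φ : TestPlane} (hφ : tsupport φ ⊆ strip d) :
    ⟪u, TestPlane.toStrip d (φ.dir v)⟫_ℂ = -⟪w, TestPlane.toStrip d φ⟫_ℂ := by
  have hre : ContDiff ℝ ∞ fun p => (φ p).re := Complex.reCLM.contDiff.comp φ.contDiff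
  have him : ContDiff ℝ ∞ fun p => (φ p).im := Complex.imCLM.contDiff.comp φ.contDiff
  have hres : HasCompactSupport fun p => (φ p).re := φ.hasCompactSupport.comp_left Complex.zero_re
  have hims : HasCompactSupport fun p => (φ p).im := φ.hasCompactSupport.comp_left Complex.zero_im
  have e : φ = TestPlane.ofRealFun hre hres + Complex.I • TestPlane.ofRealFun him hims := by
    apply Subtype.ext
    funext p
    change φ p = ((φ p).re : ℂ) + Complex.I * ((φ p).im : ℂ)
    rw [mul_comm, Complex.re_add_im]
  have h1 := h _ hre hres ((closure_mono fun p (hp : (φ p).re ≠ 0) (h0 : φ p = 0) =>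
    hp (by simp only [h0, Complex.zero_re])).trans hφ)
  have h2 := h _ him hims ((closure_mono fun p (hp : (φ p).im ≠ 0) (h0 : φ p = 0) =>
    hp (by simp only [h0, Complex.zero_im])).trans hφ)
  rw [← inner_ofReal hre hres, ← inner_dir_ofReal hre hres] at h1
  rw [← inner_ofReal him hims, ← inner_dir_ofReal him hims] at h2
  have h1' := congrArg conj h1
  have h2' := congrArg conj h2
  rw [map_neg, inner_conj_symm, inner_conj_symm] at h1' h2'
  rw [e, TestPlane.dir_add, TestPlane.dir_smul, map_add, map_add, map_smul, map_smul,
    inner_add_right, inner_add_right, inner_smul_right, inner_smul_right, h1', h2']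
  ring

end WeakDerivative

end

noncomputable section

open scoped InnerProductSpace ComplexConjugate
open Sobolev
open ContinuousLinearMap (adjoint adjoint_inner_left)

/-! ### The Robin form -/

section RobinForm

variable {d : ℝ} {α : ℝ → ℝ}

/-- The operator on the Sobolev space which represents the quadratic form of the Robin Laplacian. -/
def robinForm (d : ℝ) (hα : MemLp α ⊤ volume) : Sobolev d →L[ℂ] Sobolev d :=
  adjoint (comp d 1) ∘L comp d 1 + adjoint (comp d 2) ∘L comp d 2 +
    adjoint (trace d 0) ∘L mulOp hα ∘L trace d 0 + adjoint (trace d d) ∘L mulOp hα ∘L trace d d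

lemma inner_robinForm (hα : MemLp α ⊤ volume) (U W : Sobolev d) :
    ⟪robinForm d hα U, W⟫_ℂ = ⟪comp d 1 U, comp d 1 W⟫_ℂ + ⟪comp d 2 U, comp d 2 W⟫_ℂ +
      ⟪mulOp hα (trace d 0 U), trace d 0 W⟫_ℂ + ⟪mulOp hα (trace d d U), trace d d W⟫_ℂ := by
  simp only [robinForm, _root_.add_apply, ContinuousLinearMap.comp_apply, inner_add_left, adjoint_inner_left]

lemma robinForm_symm (hα : MemLp α ⊤ volume) (U W : Sobolev d) :
    ⟪robinForm d hα U, W⟫_ℂ = ⟪U, robinForm d hα W⟫_ℂ := by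
  rw [← inner_conj_symm U, inner_robinForm, inner_robinForm]
  simp only [map_add, inner_conj_symm, inner_mulOp_symm]

lemma re_inner_robinForm_self (hα : MemLp α ⊤ volume) (U : Sobolev d) :
    (⟪robinForm d hα U, U⟫_ℂ).re = ‖comp d 1 U‖ ^ 2 + ‖comp d 2 U‖ ^ 2 +
      (⟪mulOp hα (trace d 0 U), trace d 0 U⟫_ℂ).re +
      (⟪mulOp hα (trace d d U), trace d d U⟫_ℂ).re := by
  have h (x : L2Strip d) : (⟪x, x⟫_ℂ).re = ‖x‖ ^ 2 := (norm_sq_eq_re_inner (𝕜 := ℂ) x).symm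
  rw [inner_robinForm]
  simp only [Complex.add_re, h]

lemma norm_sq_add_norm_sq_le_robinForm (hα : MemLp α ⊤ volume) (h0 : ∀ᵐ x, 0 ≤ α x)
    (U : Sobolev d) :
    ‖comp d 1 U‖ ^ 2 + ‖comp d 2 U‖ ^ 2 ≤ (⟪robinForm d hα U, U⟫_ℂ).re := by
  rw [re_inner_robinForm_self]
  linarith [re_inner_mulOp_self_nonneg hα h0 (trace d 0 U),
    re_inner_mulOp_self_nonneg hα h0 (trace d d U)]

lemma eq_mulOp_of_ae {hα : MemLp α ⊤ volume} {g h : Lp ℂ 2 (volume : Measure ℝ)}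
    (e : ∀ᵐ x, -h x + (α x : ℂ) * g x = 0) : h = mulOp hα g := by
  apply Lp.ext
  filter_upwards [e, coeFn_mulOp hα g] with x h1 h2
  rw [h2]
  linear_combination -h1

/-- Green's formulas for the two first derivatives of `u`; the Robin conditions turn the normal
derivatives on the boundary into the `α` terms of the form. -/
theorem exists_robinForm_eq (hd : 0 < d) (hα : MemLp α ⊤ volume)
    (u : (robinLaplacian d α).domain) :
    ∃ U, comp d 0 U = u ∧ robinForm d hα U = adjoint (comp d 0) (robinLaplacian d α u) := by
  obtain ⟨ux, uy, uxx, uyy, hu, hxx, hyy, hA⟩ := robinLaplacian_spec d α u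
  obtain ⟨⟨ux', uy', hu', ⟨uxx', uxy, hx⟩, ⟨uyx, uyy', hy⟩⟩,
    ⟨uy'', hyw, ⟨g, h, hg, hh, e⟩, ⟨g', h', hg', hh', e'⟩⟩⟩ := u.2
  -- The Laplacian, the `W^{2,2}` condition and the boundary condition each bring their own
  -- derivatives, which uniqueness identifies.
  obtain rfl := hu.1.unique hu'.1
  obtain rfl := hu.2.unique hu'.2
  obtain rfl := hu.2.unique hyw
  obtain rfl := hxx.unique hx.1
  obtain rfl := hyy.unique hy.2
  have hl : (0 : ℝ) ∈ Icc 0 d := left_mem_Icc.2 hd.le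
  have hr : d ∈ Icc 0 d := right_mem_Icc.2 hd.le
  have t1 : trace d 0 (mk hu) = g := (isTrace_iff hd hl (mk hu) g).1 hg
  have t2 : trace d 0 (mk hy) = h := (isTrace_iff hd hl (mk hy) h).1 hh
  have t3 : trace d d (mk hu) = g' := (isTrace_iff hd hr (mk hu) g').1 hg'
  have t4 : trace d d (mk hy) = h' := (isTrace_iff hd hr (mk hy) h').1 hh'
  have b1 : h = mulOp hα g := eq_mulOp_of_ae e
  have b2 : -h' = mulOp hα g' := by
    refine eq_mulOp_of_ae ?_
    filter_upwards [e', Lp.coeFn_neg h'] with x h1 h2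
    rw [h2, Pi.neg_apply, neg_neg, h1]
  refine ⟨mk hu, rfl, ext_inner_right ℂ fun W => ?_⟩
  have g1 := green_left hd (mk hx) W
  have g2 := green_right hd (mk hy) W
  rw [t2, t4, b1] at g2
  rw [inner_robinForm, adjoint_inner_left, t1, t3, ← b2, inner_neg_left]
  rw [neg_eq_iff_eq_neg] at hA
  rw [hA, inner_neg_left, inner_add_left]
  simp only [comp_zero_mk, comp_one_mk, comp_two_mk] at g1 g2 ⊢
  linear_combination g1 + g2

end RobinForm

/-! ### Regularity of form solutions -/

section Regularity

variable {d : ℝ} {α : ℝ → ℝ}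

/-- Discrete product rule: the increment of `α G` is the shifted `α` times the increment of `G`,
which contributes a nonnegative term, plus the increment of `α` times `G`, which is of order `|k|`
by the Lipschitz bound. -/
lemma commutator_shiftLine_le (hα : MemLp α ⊤ volume) (h0 : ∀ᵐ x, 0 ≤ α x) {L k : ℝ}
    (hL : ∀ᵐ x, ‖α (x + k) - α x‖ ≤ L * |k|) (G : Lp ℂ 2 (volume : Measure ℝ)) :
    -(L * |k| * ‖G‖ * ‖shiftLine k G - G‖) ≤
      (⟪shiftLine k (mulOp hα G) - mulOp hα G, shiftLine k G - G⟫_ℂ).re := by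
  have hm := measurePreserving_add_right (volume : Measure ℝ) k
  have hβ : MemLp (fun x => α (x + k)) ⊤ volume := hα.comp_measurePreserving hm
  have hγ : MemLp (fun x => α (x + k) - α x) ⊤ volume := hβ.sub hα
  have e : shiftLine k (mulOp hα G) - mulOp hα G =
      mulOp hβ (shiftLine k G - G) + mulOp hγ G := by
    apply Lp.ext
    filter_upwards [Lp.coeFn_sub (shiftLine k (mulOp hα G)) (mulOp hα G),
      Lp.coeFn_add (mulOp hβ (shiftLine k G - G)) (mulOp hγ G),
      coeFn_shiftLine k (mulOp hα G), hm.quasiMeasurePreserving.ae (coeFn_mulOp hα G),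
      coeFn_mulOp hα G, coeFn_mulOp hβ (shiftLine k G - G), coeFn_mulOp hγ G,
      Lp.coeFn_sub (shiftLine k G) G, coeFn_shiftLine k G] with x h1 h2 h3 h4 h5 h6 h7 h8 h9
    rw [h1, h2, Pi.sub_apply, Pi.add_apply, h3, h4, h5, h6, h7, h8, Pi.sub_apply, h9]
    push_cast
    ring
  rw [e, inner_add_left, Complex.add_re]
  have h1 := re_inner_mulOp_self_nonneg hβ (hm.quasiMeasurePreserving.ae h0) (shiftLine k G - G)
  have h2 := norm_inner_le_norm (𝕜 := ℂ) (mulOp hγ G) (shiftLine k G - G)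
  have h3 := mul_le_mul_of_nonneg_right (norm_mulOp_le hγ hL G) (norm_nonneg (shiftLine k G - G))
  have h4 := (abs_le.1 (Complex.abs_re_le_norm ⟪mulOp hγ G, shiftLine k G - G⟫_ℂ)).1
  linarith

/-- Nirenberg's method. With `D` the increment of `U`, the form equation is tested with the backward
increment `W` of `D`. Moving the translation to the left factor gives `‖∂D‖²`, while the right side
and the boundary commutators are of order `|k| ‖D‖`. Hence `D` is of order `|k|`. -/
lemma exists_norm_shiftSobolev_sub_le (hd : 0 < d) (hα : MemLp α ⊤ volume) (h0 : ∀ᵐ x, 0 ≤ α x)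
    {L : ℝ} (hL0 : 0 ≤ L) (hL : ∀ k, ∀ᵐ x, ‖α (x + k) - α x‖ ≤ L * |k|) {U : Sobolev d}
    {g : L2Strip d} (hU : robinForm d hα U = adjoint (comp d 0) g) :
    ∃ C, ∀ k, ‖shiftSobolev d k U - U‖ ≤ |k| * C := by
  have hl : (0 : ℝ) ∈ Icc 0 d := left_mem_Icc.2 hd.le
  have hr : d ∈ Icc 0 d := right_mem_Icc.2 hd.le
  refine ⟨‖comp d 1 U‖ + (‖g‖ + 2 * L * traceConst d ^ 2 * ‖U‖), fun k => ?_⟩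
  set D := shiftSobolev d k U - U with hD
  set W := shiftSobolev d (-k) D - D with hW
  have ht0 (c : ℝ) (hc : c ∈ Icc 0 d) : trace d c D = shiftLine k (trace d c U) - trace d c U := by
    rw [hD, map_sub, trace_shiftSobolev hd hc]
  have hc (i : Fin 3) : ⟪comp d i U, comp d i W⟫_ℂ = ⟪comp d i D, comp d i D⟫_ℂ := by
    have e : comp d i D = shiftStrip d k (comp d i U) - comp d i U := by
      rw [hD, map_sub, comp_shiftSobolev]
    rw [hW, map_sub, comp_shiftSobolev, inner_sub_right, ← inner_shiftStrip, ← inner_sub_left, ← e]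
  have ht (c : ℝ) (hc : c ∈ Icc 0 d) : -(L * |k| * (traceConst d * ‖U‖) * (traceConst d * ‖D‖)) ≤
      (⟪mulOp hα (trace d c U), trace d c W⟫_ℂ).re := by
    have e : ⟪mulOp hα (trace d c U), trace d c W⟫_ℂ =
        ⟪shiftLine k (mulOp hα (trace d c U)) - mulOp hα (trace d c U),
          shiftLine k (trace d c U) - trace d c U⟫_ℂ := by
      rw [hW, map_sub, trace_shiftSobolev hd hc, inner_sub_right, ← inner_shiftLine,
        ← inner_sub_left, ht0 c hc]
    rw [e]
    refine le_trans (neg_le_neg ?_) (commutator_shiftLine_le hα h0 (hL k) (trace d c U))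
    rw [← ht0 c hc]
    exact mul_le_mul (mul_le_mul_of_nonneg_left (norm_trace_le hd hc U) (by positivity))
      (norm_trace_le hd hc D) (norm_nonneg _)
      (mul_nonneg (by positivity) (mul_nonneg (Real.sqrt_nonneg _) (norm_nonneg _)))
  have key : ⟪robinForm d hα U, W⟫_ℂ = ⟪g, comp d 0 W⟫_ℂ := by rw [hU, adjoint_inner_left]
  rw [inner_robinForm, hc, hc] at key
  have hre := congrArg Complex.re key
  have hn (x : L2Strip d) : (⟪x, x⟫_ℂ).re = ‖x‖ ^ 2 := (norm_sq_eq_re_inner (𝕜 := ℂ) x).symm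
  simp only [Complex.add_re, hn] at hre
  have h1 := ht 0 hl
  have h2 := ht d hr
  have h3 : (⟪g, comp d 0 W⟫_ℂ).re ≤ ‖g‖ * (|k| * ‖D‖) := by
    refine (Complex.re_le_norm _).trans ((norm_inner_le_norm _ _).trans ?_)
    refine mul_le_mul_of_nonneg_left ?_ (norm_nonneg _)
    rw [hW, map_sub, comp_shiftSobolev]
    refine (norm_shiftStrip_sub_le hd D (-k)).trans ?_
    rw [abs_neg]
    exact mul_le_mul_of_nonneg_left (norm_comp_le 1 D) (abs_nonneg _)
  have h4 : ‖comp d 0 D‖ ^ 2 ≤ (|k| * ‖comp d 1 U‖) ^ 2 := by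
    refine pow_le_pow_left₀ (norm_nonneg _) ?_ 2
    rw [hD, map_sub, comp_shiftSobolev]
    exact norm_shiftStrip_sub_le hd U k
  have h5 := norm_sq_eq D
  set X := ‖D‖
  set a := ‖comp d 1 U‖
  set b := ‖g‖ + 2 * L * traceConst d ^ 2 * ‖U‖ with hb
  -- From `X² ≤ A² + B X` with nonnegative `A`, `B` it follows that `X ≤ A + B`.
  have h6 : X ^ 2 ≤ (|k| * a) ^ 2 + |k| * b * X := by rw [hb]; linarith
  have hX : 0 ≤ X := norm_nonneg _
  have ha : 0 ≤ |k| * a := by positivity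
  have hb : 0 ≤ |k| * b := by positivity
  by_contra! hlt
  have h7 : 0 < X - |k| * a - |k| * b := by linarith
  have h8 := mul_pos (by linarith : 0 < X) h7
  have h9 := mul_nonneg ha (by linarith : 0 ≤ X - |k| * a)
  linarith

/-- In the pairing with a difference quotient of `φ` the translation moves to `u`, where it is
bounded by assumption; letting `k` tend to `0` bounds the pairing with the derivative of `φ`. -/
lemma exists_isWeakDeriv_of_shift {u : L2Strip d} {C : ℝ}
    (h : ∀ k, ‖shiftStrip d k u - u‖ ≤ |k| * C) : ∃ w, IsWeakDeriv d (1, 0) u w := by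
  refine exists_isWeakDeriv_of_bound (C := C) fun φ _ => ?_
  have hlim := ((continuous_const (y := u)).inner (𝕜 := ℂ) continuous_id).norm.tendsto
    (TestPlane.toStrip d (φ.dir (1, 0))) |>.comp (tendsto_diffQuot_toStrip φ)
  refine le_of_tendsto hlim ?_
  filter_upwards [self_mem_nhdsWithin] with k hk
  have hk' : 0 < |k| := abs_pos.2 hk
  have e (x : L2Strip d) : k⁻¹ • x = ((k⁻¹ : ℝ) : ℂ) • x := rfl
  have h1 : ⟪u, shiftStrip d k (TestPlane.toStrip d φ)⟫_ℂ =
      ⟪shiftStrip d (-k) u, TestPlane.toStrip d φ⟫_ℂ := by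
    rw [inner_shiftStrip, neg_neg]
  simp only [Function.comp_apply, id_eq]
  rw [e, inner_smul_right, inner_sub_right, h1, ← inner_sub_left, norm_mul, Complex.norm_real,
    norm_inv, Real.norm_eq_abs, inv_mul_le_iff₀ hk']
  refine (norm_inner_le_norm _ _).trans ?_
  rw [← mul_assoc]
  refine mul_le_mul_of_nonneg_right ?_ (norm_nonneg _)
  simpa only [abs_neg] using h (-k)

lemma isWeakDeriv_of_inner {v : ℝ × ℝ} {u w : L2Strip d}
    (h : ∀ φ : TestPlane, tsupport φ ⊆ strip d →
      ⟪u, TestPlane.toStrip d (φ.dir v)⟫_ℂ = -⟪w, TestPlane.toStrip d φ⟫_ℂ) :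
    IsWeakDeriv d v u w := by
  intro φ hφ hs ht
  have h1 := congrArg conj (h _ ((tsupport_ofReal_subset hφ hs).trans ht))
  rwa [map_neg, inner_conj_symm, inner_conj_symm, inner_dir_ofReal, inner_ofReal] at h1

lemma TestPlane.dir_comm (φ : TestPlane) (v w : ℝ × ℝ) : (φ.dir v).dir w = (φ.dir w).dir v := by
  ext p
  have hd : DifferentiableAt ℝ (fderiv ℝ (φ : ℝ × ℝ → ℂ)) p :=
    (φ.contDiff.fderiv_right (m := ∞) (by simp)).differentiable (by simp) p
  have e (v w : ℝ × ℝ) : (φ.dir v).dir w p = fderiv ℝ (fderiv ℝ (φ : ℝ × ℝ → ℂ)) p w v := by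
    rw [TestPlane.dir_apply]
    have := (hd.hasFDerivAt.clm_apply (hasFDerivAt_const v p)).fderiv
    change fderiv ℝ (fun q => fderiv ℝ (φ : ℝ × ℝ → ℂ) q v) p w = _
    rw [this]; simp
  rw [e, e]
  exact (φ.contDiff.contDiffAt.isSymmSndFDerivAt
    (by simpa using WithTop.coe_le_coe.2 (le_top : (2 : ℕ∞) ≤ ⊤))) w v

lemma TestPlane.tsupport_dir_subset (φ : TestPlane) (v : ℝ × ℝ) :
    tsupport (φ.dir v) ⊆ tsupport φ :=
  tsupport_fderiv_apply_subset ℝ _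

/-- Second derivatives of test functions commute. Difference quotients only give `x`-derivatives of
the gradient; this turns the `x`-derivative of `∂_y u` into the `y`-derivative of `∂ₓ u`. -/
lemma IsWeakDeriv.comm {v w : ℝ × ℝ} {u a b c : L2Strip d} (h1 : IsWeakDeriv d v u a)
    (h2 : IsWeakDeriv d w u b) (h3 : IsWeakDeriv d v b c) : IsWeakDeriv d w a c := by
  refine isWeakDeriv_of_inner fun φ hφ => ?_
  have e1 := h1.inner_dir ((φ.tsupport_dir_subset w).trans hφ)
  have e2 := h2.inner_dir ((φ.tsupport_dir_subset v).trans hφ)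
  have e3 := h3.inner_dir hφ
  rw [φ.dir_comm] at e1
  rw [← e3]
  linear_combination e1 - e2

/-- The product of two test functions of one variable. -/
def TestPlane.tensor {f g : ℝ → ℂ} (hf : ContDiff ℝ ∞ f) (hfs : HasCompactSupport f)
    (hg : ContDiff ℝ ∞ g) (hgs : HasCompactSupport g) : TestPlane :=
  ⟨fun p => f p.1 * g p.2, (hf.comp contDiff_fst).mul (hg.comp contDiff_snd),
    HasCompactSupport.intro (hfs.isCompact.prod hgs.isCompact) fun p hp => by
      rw [mem_prod, not_and_or] at hp
      rcases hp with h | h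
      · rw [image_eq_zero_of_notMem_tsupport h, zero_mul]
      · rw [image_eq_zero_of_notMem_tsupport h, mul_zero]⟩

lemma eq_zero_of_inner_toL2 {f : Lp ℂ 2 (volume : Measure ℝ)}
    (h : ∀ (φ : ℝ → ℂ) (hc : ContDiff ℝ ∞ φ) (hs : HasCompactSupport φ),
      ⟪f, toL2 volume φ hc.continuous hs⟫_ℂ = 0) : f = 0 := by
  have hloc : LocallyIntegrable f volume := (Lp.memLp f).locallyIntegrable (by norm_num)
  have h1 := ae_eq_zero_of_integral_contDiff_smul_eq_zero hloc fun g hg hgs => by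
    rw [integral_smul_eq_inner hg.continuous hgs, ← inner_conj_symm,
      h (fun x => (g x : ℂ)) (Complex.ofRealCLM.contDiff.comp hg)
        (hgs.comp_left (g := fun t : ℝ => (t : ℂ)) Complex.ofReal_zero), map_zero]
  apply Lp.ext
  filter_upwards [h1, Lp.coeFn_zero ℂ 2 (volume : Measure ℝ)] with x hx hx'
  rw [hx, hx']; rfl

/-- The two boundary lines are decoupled by products `φ x * ζ y` with `ζ` equal to `1` at `a` and
`0` at `b`. -/
lemma eq_zero_of_inner_trace (hd : 0 < d) {a b : ℝ} (ha : a ∈ Icc 0 d) (hb : b ∈ Icc 0 d)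
    (hab : a ≠ b) {f g : Lp ℂ 2 (volume : Measure ℝ)}
    (h : ∀ W, ⟪f, trace d a W⟫_ℂ + ⟪g, trace d b W⟫_ℂ = 0) : f = 0 := by
  refine eq_zero_of_inner_toL2 fun φ hc hs => ?_
  let ζ : ContDiffBump a := ⟨|b - a| / 2, |b - a|, by
    have := abs_pos.2 (sub_ne_zero.2 hab.symm); positivity, by
    have := abs_pos.2 (sub_ne_zero.2 hab.symm); linarith⟩
  have hζ : ContDiff ℝ ∞ fun x => (ζ x : ℂ) := Complex.ofRealCLM.contDiff.comp ζ.contDiff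
  have hζs : HasCompactSupport fun x => (ζ x : ℂ) :=
    ζ.hasCompactSupport.comp_left (g := fun t : ℝ => (t : ℂ)) Complex.ofReal_zero
  have h1 := h ((TestPlane.tensor hc hs hζ hζs).jet d)
  rw [trace_jet hd ha, trace_jet hd hb] at h1
  have ea : ζ a = 1 := ζ.one_of_mem_closedBall (Metric.mem_closedBall_self ζ.rIn_pos.le)
  have eb : ζ b = 0 := ζ.zero_of_le_dist (by rw [Real.dist_eq])
  have e1 : TestPlane.toLine a (TestPlane.tensor hc hs hζ hζs) = toL2 volume φ hc.continuous hs :=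
    toL2_congr (hc := TestPlane.continuous_slice_left _ a)
      (hs := hasCompactSupport_slice_left (TestPlane.hasCompactSupport _) a)
      (Eventually.of_forall fun x => by
        change φ x * (ζ a : ℂ) = φ x
        rw [ea, Complex.ofReal_one, mul_one])
  have e2 : TestPlane.toLine b (TestPlane.tensor hc hs hζ hζs) = 0 := by
    apply Lp.ext
    filter_upwards [coeFn_toL2 (μ := volume)
      (TestPlane.continuous_slice_left (TestPlane.tensor hc hs hζ hζs) b)
      (hasCompactSupport_slice_left (TestPlane.hasCompactSupport _) b),
      Lp.coeFn_zero ℂ 2 (volume : Measure ℝ)] with x h1 h2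
    refine h1.trans ?_
    rw [h2]
    change φ x * (ζ b : ℂ) = 0
    rw [eb, Complex.ofReal_zero, mul_zero]
  rwa [e1, e2, inner_zero_right, add_zero] at h1

lemma TestPlane.toLine_eq_zero {φ : TestPlane} (hφ : tsupport φ ⊆ strip d) {c : ℝ}
    (hc : c ∉ Ioo 0 d) : TestPlane.toLine c φ = 0 := by
  apply Lp.ext
  filter_upwards [coeFn_toL2 (μ := volume) (TestPlane.continuous_slice_left φ c)
    (hasCompactSupport_slice_left φ.hasCompactSupport c),
    Lp.coeFn_zero ℂ 2 (volume : Measure ℝ)] with x h1 h2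
  refine h1.trans ?_
  rw [h2]
  exact image_eq_zero_of_notMem_tsupport fun h => hc (hφ h).2

/-- A form solution belongs to the operator domain: difference quotients and the equation give
`W^{2,2}`, and comparing the form equation with Green's formulas gives the boundary conditions. -/
theorem robinForm_regularity (hd : 0 < d) (hα : MemLp α ⊤ volume) (h0 : ∀ᵐ x, 0 ≤ α x)
    {L : ℝ} (hL0 : 0 ≤ L) (hL : ∀ k, ∀ᵐ x, ‖α (x + k) - α x‖ ≤ L * |k|) (U : Sobolev d)
    (g : L2Strip d) (hU : robinForm d hα U = adjoint (comp d 0) g) :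
    ∃ h : comp d 0 U ∈ (robinLaplacian d α).domain, robinLaplacian d α ⟨comp d 0 U, h⟩ = g := by
  have hl : (0 : ℝ) ∈ Icc 0 d := left_mem_Icc.2 hd.le
  have hr : d ∈ Icc 0 d := right_mem_Icc.2 hd.le
  obtain ⟨C, hC⟩ := exists_norm_shiftSobolev_sub_le hd hα h0 hL0 hL hU
  have hshift (i : Fin 3) : ∃ w, IsWeakDeriv d (1, 0) (comp d i U) w := by
    refine exists_isWeakDeriv_of_shift (C := C) fun k => ?_
    rw [← comp_shiftSobolev, ← map_sub]
    exact (norm_comp_le i _).trans (hC k)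
  obtain ⟨uxx, hxx⟩ := hshift 1
  obtain ⟨uyx, hyx⟩ := hshift 2
  have hxy : IsWeakDeriv d (0, 1) (comp d 1 U) uyx := U.isWeakGrad.1.comm U.isWeakGrad.2 hyx
  have hform (W : Sobolev d) : ⟪robinForm d hα U, W⟫_ℂ = ⟪g, comp d 0 W⟫_ℂ := by
    rw [hU, adjoint_inner_left]
  -- Test functions supported in the strip have zero traces, so the form equation reduces to `-Δu =
  -- g` in the weak sense and gives the missing second derivative.
  have hyy : IsWeakDeriv d (0, 1) (comp d 2 U) (-g - uxx) := by
    refine isWeakDeriv_of_inner fun φ hφ => ?_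
    have h1 := hform (φ.jet d)
    rw [inner_robinForm, trace_jet hd hl, trace_jet hd hr,
      TestPlane.toLine_eq_zero hφ (by simp), TestPlane.toLine_eq_zero hφ (by simp),
      inner_zero_right, inner_zero_right, comp_one_jet, hxx.inner_dir hφ] at h1
    rw [inner_sub_left, inner_neg_left]
    simp only [comp_two_jet, comp_zero_jet] at h1
    linear_combination h1
  set P := mk (d := d) ⟨hxx, hxy⟩
  set Q := mk (d := d) ⟨hyx, hyy⟩
  -- After Green's formulas all integrals over the strip cancel and only the boundary residuals
  -- remain.
  have hbc (W : Sobolev d) : ⟪mulOp hα (trace d 0 U) - trace d 0 Q, trace d 0 W⟫_ℂ +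
      ⟪mulOp hα (trace d d U) + trace d d Q, trace d d W⟫_ℂ = 0 := by
    have h1 := hform W
    have g1 := green_left hd P W
    have g2 := green_right hd Q W
    change ⟪uxx, comp d 0 W⟫_ℂ + ⟪comp d 1 U, comp d 1 W⟫_ℂ = 0 at g1
    change ⟪-g - uxx, comp d 0 W⟫_ℂ + ⟪comp d 2 U, comp d 2 W⟫_ℂ = _ at g2
    rw [inner_sub_left, inner_neg_left] at g2
    rw [inner_robinForm] at h1
    rw [inner_sub_left, inner_add_left]
    linear_combination h1 - g1 - g2
  have b0 := eq_zero_of_inner_trace hd hl hr hd.ne hbc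
  have bd := eq_zero_of_inner_trace hd hr hl hd.ne' fun W => (add_comm _ _).trans (hbc W)
  rw [sub_eq_zero] at b0
  have t0 : IsTrace d 0 (comp d 2 U) (trace d 0 Q) := (isTrace_iff hd hl Q _).2 rfl
  have td : IsTrace d d (comp d 2 U) (trace d d Q) := (isTrace_iff hd hr Q _).2 rfl
  have hdom : comp d 0 U ∈ (robinLaplacian d α).domain := by
    refine ⟨⟨_, _, U.isWeakGrad, ⟨_, _, hxx, hxy⟩, ⟨_, _, hyx, hyy⟩⟩,
      ⟨_, U.isWeakGrad.2, ⟨_, _, (isTrace_iff hd hl U _).2 rfl, t0, ?_⟩,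
        ⟨_, _, (isTrace_iff hd hr U _).2 rfl, td, ?_⟩⟩⟩
    · rw [← b0]
      filter_upwards [coeFn_mulOp hα (trace d 0 U)] with x hx
      rw [hx, neg_add_cancel]
    · filter_upwards [coeFn_mulOp hα (trace d d U), Lp.coeFn_add (mulOp hα (trace d d U))
        (trace d d Q), Lp.coeFn_zero ℂ 2 (volume : Measure ℝ)] with x h1 h2 h3
      rw [bd, h3, Pi.add_apply, h1, Pi.zero_apply] at h2
      rw [add_comm, ← h2]
  refine ⟨hdom, ?_⟩
  have h1 := robinLaplacian_spec d α ⟨comp d 0 U, hdom⟩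
  have h2 : IsWeakLaplacian d (comp d 0 U) (uxx + (-g - uxx)) :=
    ⟨_, _, _, _, U.isWeakGrad, hxx, hyy, rfl⟩
  have h3 := h1.unique h2
  rw [neg_eq_iff_eq_neg] at h3
  rw [h3]
  abel

theorem isFormOperator_robinLaplacian (hd : 0 < d) (hα : MemW1Infty α) (h0 : ∀ x, 0 ≤ α x) :
    IsFormOperator (robinLaplacian d α) (comp d 0) (robinForm d hα.1) := by
  obtain ⟨L, hL0, hL⟩ := hα.exists_lipschitz
  have h0' : ∀ᵐ x, 0 ≤ α x := Eventually.of_forall h0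
  refine ⟨exists_robinForm_eq hd hα.1, robinForm_regularity hd hα.1 h0' hL0 hL,
    robinForm_symm hα.1, fun U => ?_, fun U => ?_⟩
  · exact (by positivity : (0 : ℝ) ≤ ‖comp d 1 U‖ ^ 2 + ‖comp d 2 U‖ ^ 2).trans
      (norm_sq_add_norm_sq_le_robinForm hα.1 h0' U)
  · rw [Sobolev.norm_sq_eq]
    linarith [norm_sq_add_norm_sq_le_robinForm hα.1 h0' U]

end Regularity

end

noncomputable section

open scoped InnerProductSpace ComplexConjugate
open Sobolev
open ContinuousLinearMap (adjoint adjoint_inner_left)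

section Abstract

variable {V H : Type*} [NormedAddCommGroup V] [InnerProductSpace ℂ V]
  [NormedAddCommGroup H] [InnerProductSpace ℂ H] {ι : V →L[ℂ] H} {T : V →L[ℂ] V}

/-- The finite rank map has the coordinates `√C ⟪v j, ·⟫`. -/
lemma IsFormOperator.boundedBelowFiniteRank_of_vectors {J : Type} [Fintype J] (v : J → H)
    {t c C : ℝ} (hc : 0 < c) (hC : 0 ≤ C)
    (h : ∀ U, c * ‖U‖ ^ 2 ≤ (⟪T U, U⟫_ℂ).re - t * ‖ι U‖ ^ 2 + C * ∑ j, ‖⟪v j, ι U⟫_ℂ‖ ^ 2) :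
    IsFormOperator.BoundedBelowFiniteRank ι T t := by
  refine ⟨J, inferInstance, ((EuclideanSpace.equiv J ℂ).symm : (J → ℂ) →L[ℂ] _) ∘L
    ContinuousLinearMap.pi fun j => ((√C : ℝ) : ℂ) • innerSL ℂ (v j), c, hc, fun U => ?_⟩
  refine (h U).trans_eq ?_
  rw [EuclideanSpace.norm_sq_eq, Finset.mul_sum]
  congr 1
  refine Finset.sum_congr rfl fun j _ => ?_
  change _ = ‖((√C : ℝ) : ℂ) * ⟪v j, ι U⟫_ℂ‖ ^ 2
  rw [norm_mul, Complex.norm_real, mul_pow, Real.norm_eq_abs, sq_abs, Real.sq_sqrt hC]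

end Abstract

/-! ### Poincaré inequalities on cells -/

section Poincare

/-- Poincaré's inequality on each of `n` adjacent cells of length `ℓ`, summed. Only the cell
integrals and a gradient term of size `ℓ²` remain. -/
lemma integral_norm_sq_le_sum {f f' : ℝ → ℂ} (hf : ∀ x, HasDerivAt f (f' x) x)
    (hf' : Continuous f') {ℓ : ℝ} (hℓ : 0 < ℓ) (a : ℝ) (n : ℕ) :
    ∫ x in a..a + n * ℓ, ‖f x‖ ^ 2 ≤
      2 / ℓ * ∑ i ∈ Finset.range n, ‖∫ x in a + i * ℓ..a + (i + 1 : ℕ) * ℓ, f x‖ ^ 2 +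
        2 * ℓ ^ 2 * ∫ x in a..a + n * ℓ, ‖f' x‖ ^ 2 := by
  have hcf : Continuous f := continuous_iff_continuousAt.2 fun x => (hf x).continuousAt
  have hs {g : ℝ → ℝ} (hg : Continuous g) : ∫ x in a..a + n * ℓ, g x =
      ∑ i ∈ Finset.range n, ∫ x in a + i * ℓ..a + (i + 1 : ℕ) * ℓ, g x := by
    rw [intervalIntegral.sum_integral_adjacent_intervals (a := fun i : ℕ => a + i * ℓ)
      fun k _ => hg.intervalIntegrable _ _]
    simp
  rw [hs (g := fun x => ‖f x‖ ^ 2) (hcf.norm.pow 2),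
    hs (g := fun x => ‖f' x‖ ^ 2) (hf'.norm.pow 2), Finset.mul_sum, Finset.mul_sum,
    ← Finset.sum_add_distrib]
  refine Finset.sum_le_sum fun i _ => ?_
  have e : a + (i + 1 : ℕ) * ℓ - (a + i * ℓ) = ℓ := by push_cast; ring
  have h := integral_norm_sq_le (a := a + i * ℓ) (b := a + (i + 1 : ℕ) * ℓ) (f := f) (f' := f')
    (by linarith) (fun x _ => (hf x).hasDerivWithinAt) hf'.continuousOn
  rw [e] at h
  rw [← mul_le_mul_iff_of_pos_left hℓ]
  refine h.trans_eq ?_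
  field_simp

lemma continuous_integral_slice {E : Type*} [NormedAddCommGroup E] [NormedSpace ℝ E]
    {F : ℝ × ℝ → E} (hF : Continuous F) (a b : ℝ) : Continuous fun x => ∫ y in a..b, F (x, y) :=
  intervalIntegral.continuous_parametric_intervalIntegral_of_continuous'
    (f := fun x y => F (x, y)) hF a b

namespace TestPlane

variable (φ : TestPlane)

lemma hasDerivAt_integral_slice (a b x : ℝ) : HasDerivAt (fun x => ∫ y in a..b, φ (x, y))
    (∫ y in a..b, φ.dir (1, 0) (x, y)) x := by
  obtain ⟨M, hM⟩ := (φ.dir (1, 0)).hasCompactSupport.exists_bound_of_continuous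
    (φ.dir (1, 0)).continuous
  exact (intervalIntegral.hasDerivAt_integral_of_dominated_loc_of_deriv_le (s := univ)
    (bound := fun _ => M) univ_mem
    (Eventually.of_forall fun x => (φ.continuous_slice_right x).aestronglyMeasurable)
    ((φ.continuous_slice_right x).intervalIntegrable _ _)
    ((φ.dir (1, 0)).continuous_slice_right x).aestronglyMeasurable
    (Eventually.of_forall fun y _ x _ => hM _) intervalIntegrable_const
    (Eventually.of_forall fun y _ x _ => φ.hasDerivAt_left x y)).2

/-- Poincaré inequality on a rectangle which is divided into cells. -/
lemma integral_norm_sq_rect_le {ℓ η : ℝ} (hℓ : 0 < ℓ) (hη : 0 < η) (a c : ℝ) (m n : ℕ) :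
    ∫ x in a..a + m * ℓ, ∫ y in c..c + n * η, ‖φ (x, y)‖ ^ 2 ≤
      4 / (ℓ * η) * ∑ j ∈ Finset.range n, ∑ i ∈ Finset.range m,
        ‖∫ x in a + i * ℓ..a + (i + 1 : ℕ) * ℓ, ∫ y in c + j * η..c + (j + 1 : ℕ) * η,
          φ (x, y)‖ ^ 2 +
      4 * ℓ ^ 2 * (∫ x in a..a + m * ℓ, ∫ y in c..c + n * η, ‖φ.dir (1, 0) (x, y)‖ ^ 2) +
      2 * η ^ 2 * ∫ x in a..a + m * ℓ, ∫ y in c..c + n * η, ‖φ.dir (0, 1) (x, y)‖ ^ 2 := by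
  have ham : a ≤ a + m * ℓ := by
    have : 0 ≤ m * ℓ := by positivity
    linarith
  -- The inequality is applied twice: in `y` at fixed `x`, which leaves the strip integrals `V j x`,
  -- and in `x` to each `V j`. Cauchy–Schwarz bounds `|V' j x|²` by `η` times an integral of
  -- `|∂ₓφ|²`, and this `η` cancels the one in `2 / η`.
  set V : ℕ → ℝ → ℂ := fun j x => ∫ y in c + j * η..c + (j + 1 : ℕ) * η, φ (x, y)
  set V' : ℕ → ℝ → ℂ := fun j x => ∫ y in c + j * η..c + (j + 1 : ℕ) * η, φ.dir (1, 0) (x, y)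
  have hV (j : ℕ) : Continuous (V j) := continuous_integral_slice φ.continuous _ _
  have hV' (j : ℕ) : Continuous (V' j) := continuous_integral_slice (φ.dir _).continuous _ _
  have hY : Continuous fun x => ∫ y in c..c + n * η, ‖φ.dir (0, 1) (x, y)‖ ^ 2 :=
    continuous_integral_slice (φ.dir _).continuous_norm_sq _ _
  have hVi (j : ℕ) : IntervalIntegrable (fun x => ‖V j x‖ ^ 2) volume a (a + m * ℓ) :=
    ((hV j).norm.pow 2).intervalIntegrable _ _
  have hVs : Continuous fun x => ∑ j ∈ Finset.range n, ‖V j x‖ ^ 2 :=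
    continuous_finsetSum _ fun j _ => (hV j).norm.pow 2
  have h1 : ∫ x in a..a + m * ℓ, ∫ y in c..c + n * η, ‖φ (x, y)‖ ^ 2 ≤
      2 / η * ∑ j ∈ Finset.range n, (∫ x in a..a + m * ℓ, ‖V j x‖ ^ 2) +
      2 * η ^ 2 * ∫ x in a..a + m * ℓ, ∫ y in c..c + n * η, ‖φ.dir (0, 1) (x, y)‖ ^ 2 := by
    rw [← intervalIntegral.integral_finsetSum fun j _ => hVi j, ← intervalIntegral.integral_const_mul,
      ← intervalIntegral.integral_const_mul, ← intervalIntegral.integral_add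
      ((hVs.const_mul _).intervalIntegrable _ _) ((hY.const_mul _).intervalIntegrable _ _)]
    refine intervalIntegral.integral_mono_on ham
      ((continuous_integral_slice φ.continuous_norm_sq _ _).intervalIntegrable _ _)
      (((hVs.const_mul _).add (hY.const_mul _)).intervalIntegrable _ _) fun x _ => ?_
    exact integral_norm_sq_le_sum (fun y => φ.hasDerivAt_right x y)
      ((φ.dir (0, 1)).continuous_slice_right x) hη c n
  have h2 (j : ℕ) : ∫ x in a..a + m * ℓ, ‖V j x‖ ^ 2 ≤
      2 / ℓ * ∑ i ∈ Finset.range m, ‖∫ x in a + i * ℓ..a + (i + 1 : ℕ) * ℓ, V j x‖ ^ 2 +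
      2 * ℓ ^ 2 * (η * ∫ x in a..a + m * ℓ,
        ∫ y in c + j * η..c + (j + 1 : ℕ) * η, ‖φ.dir (1, 0) (x, y)‖ ^ 2) := by
    refine (integral_norm_sq_le_sum (fun x => φ.hasDerivAt_integral_slice _ _ x) (hV' j) hℓ a
      m).trans (add_le_add le_rfl (mul_le_mul_of_nonneg_left ?_ (by positivity)))
    rw [← intervalIntegral.integral_const_mul]
    refine intervalIntegral.integral_mono_on ham
      (((hV' j).norm.pow 2).intervalIntegrable _ _)
      (((continuous_integral_slice (φ.dir _).continuous_norm_sq _ _).const_mul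
        _).intervalIntegrable _ _) fun x _ => ?_
    have e : c + (j + 1 : ℕ) * η - (c + j * η) = η := by push_cast; ring
    have h := norm_integral_sq_le_of_continuousOn (a := c + j * η) (b := c + (j + 1 : ℕ) * η)
      (by linarith) ((φ.dir (1, 0)).continuous_slice_right x).continuousOn
    rwa [e] at h
  have h3 : ∑ j ∈ Finset.range n, ∫ x in a..a + m * ℓ,
        ∫ y in c + j * η..c + (j + 1 : ℕ) * η, ‖φ.dir (1, 0) (x, y)‖ ^ 2 =
      ∫ x in a..a + m * ℓ, ∫ y in c..c + n * η, ‖φ.dir (1, 0) (x, y)‖ ^ 2 := by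
    rw [← intervalIntegral.integral_finsetSum fun j _ =>
      (continuous_integral_slice (φ.dir _).continuous_norm_sq _ _).intervalIntegrable _ _]
    refine intervalIntegral.integral_congr fun x _ => ?_
    have hi : Continuous fun y => ‖φ.dir (1, 0) (x, y)‖ ^ 2 :=
      ((φ.dir (1, 0)).continuous_slice_right x).norm.pow 2
    rw [intervalIntegral.sum_integral_adjacent_intervals (a := fun i : ℕ => c + i * η)
      fun k _ => hi.intervalIntegrable _ _]
    simp
  have h4 := Finset.sum_le_sum fun j (_ : j ∈ Finset.range n) => h2 j
  rw [Finset.sum_add_distrib, ← Finset.mul_sum, ← Finset.mul_sum, ← Finset.mul_sum, h3] at h4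
  dsimp only [V] at h1 h4
  refine h1.trans (add_le_add ((mul_le_mul_of_nonneg_left h4 (by positivity)).trans_eq ?_) le_rfl)
  field_simp
  ring

end TestPlane

/-- `v` is the indicator of the cell, open in `y` so that cells touching the boundary lie in the
strip. -/
lemma exists_inner_eq_integral_cell {d a b c e : ℝ} (hab : a ≤ b) (hce : c ≤ e) (hc : 0 ≤ c)
    (he : e ≤ d) : ∃ v : L2Strip d, ∀ φ : TestPlane,
      ⟪v, TestPlane.toStrip d φ⟫_ℂ = ∫ x in a..b, ∫ y in c..e, φ (x, y) := by
  have hs : MeasurableSet (Ioc a b ×ˢ Ioo c e) := measurableSet_Ioc.prod measurableSet_Ioo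
  have hsub : Ioc a b ×ˢ Ioo c e ⊆ strip d := fun p hp =>
    ⟨mem_univ _, hc.trans_lt hp.2.1, hp.2.2.trans_le he⟩
  have hfin : (volume.restrict (strip d)) (Ioc a b ×ˢ Ioo c e) ≠ ⊤ := by
    refine ((Measure.restrict_apply_le _ _).trans_lt ?_).ne
    rw [Measure.volume_eq_prod, Measure.prod_prod]
    exact ENNReal.mul_lt_top measure_Ioc_lt_top measure_Ioo_lt_top
  refine ⟨indicatorConstLp 2 hs hfin (1 : ℂ), fun φ => ?_⟩
  rw [L2.inner_indicatorConstLp_one, integral_congr_ae (ae_restrict_of_ae (φ.coeFn_toStrip d)),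
    Measure.restrict_restrict hs, inter_eq_self_of_subset_left hsub, Measure.volume_eq_prod,
    setIntegral_prod _ (φ.continuous.integrable_of_hasCompactSupport
      φ.hasCompactSupport).integrableOn, intervalIntegral.integral_of_le hab]
  refine integral_congr_ae (Eventually.of_forall fun x => ?_)
  simp only
  rw [intervalIntegral.integral_of_le hce, integral_Ioc_eq_integral_Ioo]

end Poincare

/-! ### Lower bound of the form up to finite rank -/

section LowerBound

variable {d κ α₀ : ℝ} {α : ℝ → ℝ}

lemma integrable_mul_slice (hα : MemLp α ⊤ volume) (φ : TestPlane) (c : ℝ) :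
    Integrable fun x => α x * ‖φ (x, c)‖ ^ 2 := by
  obtain ⟨C, hC⟩ := hα.exists_ae_norm_le
  exact (φ.integrable_norm_sq_slice_left c).bdd_mul hα.1 hC.2

lemma re_inner_mulOp_toLine (hα : MemLp α ⊤ volume) (φ : TestPlane) (c : ℝ) :
    (⟪mulOp hα (TestPlane.toLine c φ), TestPlane.toLine c φ⟫_ℂ).re =
      ∫ x, α x * ‖φ (x, c)‖ ^ 2 := by
  rw [inner_mulOp_self, Complex.ofReal_re]
  refine integral_congr_ae ?_
  filter_upwards [coeFn_toL2 (μ := volume) (φ.continuous_slice_left c)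
    (hasCompactSupport_slice_left φ.hasCompactSupport c)] with x hx
  have h : TestPlane.toLine c φ x = φ (x, c) := hx
  rw [h]

lemma re_inner_robinForm_jet (hd : 0 < d) (hα : MemLp α ⊤ volume) (φ : TestPlane) :
    (⟪robinForm d hα (φ.jet d), φ.jet d⟫_ℂ).re =
      (∫ x, ∫ y in 0..d, ‖φ.dir (1, 0) (x, y)‖ ^ 2) +
      (∫ x, ((∫ y in 0..d, ‖φ.dir (0, 1) (x, y)‖ ^ 2) +
        (α x * ‖φ (x, 0)‖ ^ 2 + α x * ‖φ (x, d)‖ ^ 2))) := by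
  have i0 := integrable_mul_slice hα φ 0
  have i1 := integrable_mul_slice hα φ d
  have i2 : Integrable fun x => α x * ‖φ (x, 0)‖ ^ 2 + α x * ‖φ (x, d)‖ ^ 2 := i0.add i1
  rw [re_inner_robinForm_self, trace_jet hd (left_mem_Icc.2 hd.le),
    trace_jet hd (right_mem_Icc.2 hd.le), re_inner_mulOp_toLine, re_inner_mulOp_toLine,
    comp_one_jet, comp_two_jet, TestPlane.norm_sq_toStrip_eq hd.le,
    TestPlane.norm_sq_toStrip_eq hd.le,
    integral_add ((φ.dir (0, 1)).integrable_norm_sq_slice hd.le) i2, integral_add i0 i1]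
  ring

/-- The transversal form with a coupling `b` close to or above `a`. -/
lemma ground_state_inequality_of_le {a b δ t : ℝ} (hd : 0 < d) (hκ : 0 ≤ κ)
    (hκd : κ * d < Real.pi) (hκa : κ * Real.sin (κ * d / 2) = a * Real.cos (κ * d / 2))
    (hb : 0 ≤ b) (hδ : 0 ≤ δ) (hab : a - δ ≤ b)
    (ht : t * (1 + 4 * d * δ) ≤ κ ^ 2 - 4 / d * δ) {f f' : ℝ → ℂ}
    (hf : ∀ x ∈ Icc 0 d, HasDerivWithinAt f (f' x) (Icc 0 d) x)
    (hf' : ContinuousOn f' (Icc 0 d)) :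
    t * ∫ x in 0..d, ‖f x‖ ^ 2 ≤
      (∫ x in 0..d, ‖f' x‖ ^ 2) + (b * ‖f 0‖ ^ 2 + b * ‖f d‖ ^ 2) := by
  have h1 := ground_state_inequality hd hκ hκd hκa hf hf'
  have t0 := norm_sq_le_integral hf hf' (left_mem_Icc.2 hd.le)
  have td := norm_sq_le_integral hf hf' (right_mem_Icc.2 hd.le)
  rw [sub_zero] at t0 td
  have hS : 0 ≤ ∫ x in 0..d, ‖f x‖ ^ 2 :=
    intervalIntegral.integral_nonneg hd.le fun _ _ => sq_nonneg _
  have hY : 0 ≤ ∫ x in 0..d, ‖f' x‖ ^ 2 :=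
    intervalIntegral.integral_nonneg hd.le fun _ _ => sq_nonneg _
  set S := ∫ x in 0..d, ‖f x‖ ^ 2
  set Y := ∫ x in 0..d, ‖f' x‖ ^ 2
  have hτ : 0 ≤ ‖f 0‖ ^ 2 + ‖f d‖ ^ 2 := by positivity
  set τ := ‖f 0‖ ^ 2 + ‖f d‖ ^ 2 with hτ'
  have e : b * ‖f 0‖ ^ 2 + b * ‖f d‖ ^ 2 = b * τ := by rw [hτ']; ring
  -- Replacing the coupling `a` by `b` costs at most `δ τ`. The trace inequality spreads this cost
  -- over `S` and `Y`: the part in `Y` is absorbed by multiplying the claim by `1 + 4 d δ`, and `ht`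
  -- balances the part in `S`.
  have h2 : τ ≤ 4 / d * S + 4 * d * Y := by
    rw [← mul_le_mul_iff_of_pos_left hd]
    have : d * (4 / d * S + 4 * d * Y) = 4 * S + 4 * d ^ 2 * Y := by field_simp
    rw [this, hτ']
    linarith
  rw [e]
  have h3 := mul_le_mul_of_nonneg_right hab hτ
  have h4 := mul_le_mul_of_nonneg_left h2 hδ
  have h5 := mul_le_mul_of_nonneg_right ht hS
  have h6 : 0 ≤ 4 * d * δ * (b * τ) := by positivity
  have h7 : 0 < 1 + 4 * d * δ := by positivity
  rw [← mul_le_mul_iff_of_pos_left h7]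
  linarith

/-- On a bounded rectangle, a fine enough grid makes the gradient constants in Poincaré's inequality
at most `1 / t`; the cell integrals form the finite rank term. -/
lemma exists_finite_cells_bound {t N : ℝ} (hd : 0 < d) (hN : 0 < N) (ht : 0 ≤ t) :
    ∃ (m : ℕ) (v : Fin m × Fin m → L2Strip d) (C : ℝ), 0 ≤ C ∧ ∀ φ : TestPlane,
      t * ∫ x in -N..N, ∫ y in 0..d, ‖φ (x, y)‖ ^ 2 ≤
        C * ∑ j, ‖⟪v j, TestPlane.toStrip d φ⟫_ℂ‖ ^ 2 +
        (∫ x in -N..N, ∫ y in 0..d, ‖φ.dir (1, 0) (x, y)‖ ^ 2) +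
        ∫ x in -N..N, ∫ y in 0..d, ‖φ.dir (0, 1) (x, y)‖ ^ 2 := by
  -- With this `m` both mesh sizes `s` satisfy `2 (t + 1) s ≤ 1`, hence `4 t s² ≤ 1`.
  obtain ⟨m, hm⟩ := exists_nat_gt (2 * (t + 1) * (2 * N + d))
  have hm0 : (0 : ℝ) < m := lt_of_le_of_lt (by positivity) hm
  set ℓ := 2 * N / m with hℓ
  set η := d / m with hη
  have hℓ0 : 0 < ℓ := by positivity
  have hη0 : 0 < η := by positivity
  have eℓ : -N + m * ℓ = N := by rw [hℓ]; field_simp; ring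
  have eη : 0 + m * η = d := by rw [hη]; field_simp; ring
  have hcell (p : Fin m × Fin m) := exists_inner_eq_integral_cell (d := d)
    (a := -N + (p.2 : ℕ) * ℓ) (b := -N + ((p.2 : ℕ) + 1 : ℕ) * ℓ)
    (c := 0 + (p.1 : ℕ) * η) (e := 0 + ((p.1 : ℕ) + 1 : ℕ) * η)
    (by push_cast; nlinarith) (by push_cast; nlinarith) (by positivity) (by
      rw [← eη]
      have : (((p.1 : ℕ) + 1 : ℕ) : ℝ) ≤ m := by exact_mod_cast p.1.2
      have := mul_le_mul_of_nonneg_right this hη0.le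
      linarith)
  choose v hv using hcell
  have hsq {s : ℝ} (hs : 0 ≤ s) (h : 2 * (t + 1) * s ≤ 1) : t * (4 * s ^ 2) ≤ 1 := by
    have h1 : (2 * (t + 1) * s) ^ 2 ≤ 1 := pow_le_one₀ (by positivity) h
    have h2 : 0 ≤ s ^ 2 * (t ^ 2 + t + 1) := by positivity
    linarith
  have bℓ : t * (4 * ℓ ^ 2) ≤ 1 := hsq hℓ0.le (by
    rw [hℓ, ← mul_div_assoc, div_le_one hm0]
    have : 0 ≤ (t + 1) * d := by positivity
    linarith)
  have bη : t * (4 * η ^ 2) ≤ 1 := hsq hη0.le (by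
    rw [hη, ← mul_div_assoc, div_le_one hm0]
    have : 0 ≤ (t + 1) * N := by positivity
    linarith)
  refine ⟨m, v, t * (4 / (ℓ * η)), by positivity, fun φ => ?_⟩
  have h := φ.integral_norm_sq_rect_le hℓ0 hη0 (-N) 0 m m
  rw [eℓ, eη] at h
  have hsum : ∑ j, ‖⟪v j, TestPlane.toStrip d φ⟫_ℂ‖ ^ 2 = ∑ j ∈ Finset.range m,
      ∑ i ∈ Finset.range m, ‖∫ x in -N + i * ℓ..-N + (i + 1 : ℕ) * ℓ,
        ∫ y in 0 + j * η..0 + (j + 1 : ℕ) * η, φ (x, y)‖ ^ 2 := by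
    rw [Fintype.sum_prod_type, Finset.sum_range]
    refine Finset.sum_congr rfl fun j _ => ?_
    rw [Finset.sum_range]
    exact Finset.sum_congr rfl fun i _ => by rw [hv (j, i)]
  rw [hsum]
  have hNN : -N ≤ N := by linarith
  have hnn (ψ : TestPlane) : 0 ≤ ∫ x in -N..N, ∫ y in 0..d, ‖ψ (x, y)‖ ^ 2 :=
    intervalIntegral.integral_nonneg hNN fun _ _ =>
      intervalIntegral.integral_nonneg hd.le fun _ _ => sq_nonneg _
  have hX := hnn (φ.dir (1, 0))
  have hY := hnn (φ.dir (0, 1))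
  have h1 := mul_le_mul_of_nonneg_left h ht
  have h2 := mul_le_mul_of_nonneg_right bℓ hX
  have h3 := mul_le_mul_of_nonneg_right bη hY
  have h4 : 0 ≤ t * (4 * η ^ 2) * ∫ x in -N..N, ∫ y in 0..d, ‖φ.dir (0, 1) (x, y)‖ ^ 2 := by
    positivity
  linarith

/-- The strip is split at `|x| = N`. Outside, `α > α₀ - δ` and `ground_state_inequality_of_le` holds
on every slice. Inside, the boundary terms are dropped as nonnegative and the cells are used. No
coupling across the cuts is needed, since both estimates are free of conditions at `x = ±N`. -/
theorem exists_robinForm_lower_bound (hd : 0 < d) (hα : MemLp α ⊤ volume) (h0 : ∀ x, 0 ≤ α x)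
    (hlim : Tendsto α (cocompact ℝ) (𝓝 α₀)) (hκ : 0 ≤ κ) (hκd : κ * d < Real.pi)
    (hκa : κ * Real.sin (κ * d / 2) = α₀ * Real.cos (κ * d / 2)) {t : ℝ} (ht : 0 ≤ t)
    (htκ : t < κ ^ 2) :
    ∃ (m : ℕ) (v : Fin m × Fin m → L2Strip d) (C : ℝ), 0 ≤ C ∧ ∀ U : Sobolev d,
      t * ‖comp d 0 U‖ ^ 2 ≤ (⟪robinForm d hα U, U⟫_ℂ).re +
        C * ∑ j, ‖⟪v j, comp d 0 U⟫_ℂ‖ ^ 2 := by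
  -- Solves `t (1 + 4 d δ) = κ² - (4 / d) δ`, the largest loss of coupling that keeps the level `t`.
  set δ := (κ ^ 2 - t) / (4 / d + 4 * d * t) with hδ
  have hδ0 : 0 < δ := div_pos (by linarith) (by positivity)
  have htδ : t * (1 + 4 * d * δ) ≤ κ ^ 2 - 4 / d * δ := by
    have : δ * (4 / d + 4 * d * t) = κ ^ 2 - t := div_mul_cancel₀ _ (by positivity)
    linarith
  obtain ⟨r, hr⟩ := Metric.mem_cocompact_iff_closedBall_compl_subset (0 : ℝ) |>.1
    (hlim.eventually (lt_mem_nhds (sub_lt_self α₀ hδ0)))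
  set N := |r| + 1 with hN
  have hN0 : 0 < N := by positivity
  obtain ⟨m, v, C, hC, hcell⟩ := exists_finite_cells_bound hd hN0 ht
  refine ⟨m, v, C, hC, fun U => ?_⟩
  refine (denseRange_jet hd).induction_on (p := fun U : Sobolev d =>
      t * ‖comp d 0 U‖ ^ 2 ≤ (⟪robinForm d hα U, U⟫_ℂ).re +
        C * ∑ j, ‖⟪v j, comp d 0 U⟫_ℂ‖ ^ 2) U
    (isClosed_le (by fun_prop) ((Complex.continuous_re.comp
      ((robinForm d hα).continuous.inner continuous_id)).add (by fun_prop)))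
    fun φ => ?_
  rw [re_inner_robinForm_jet hd, comp_zero_jet, TestPlane.norm_sq_toStrip_eq hd.le]
  set S := fun x => ∫ y in 0..d, ‖φ (x, y)‖ ^ 2 with hS
  set X := fun x => ∫ y in 0..d, ‖φ.dir (1, 0) (x, y)‖ ^ 2 with hX
  set Y := fun x => ∫ y in 0..d, ‖φ.dir (0, 1) (x, y)‖ ^ 2 with hY
  set A := fun x => α x * ‖φ (x, 0)‖ ^ 2 + α x * ‖φ (x, d)‖ ^ 2 with hA
  have iS : Integrable S := φ.integrable_norm_sq_slice hd.le
  have iX : Integrable X := (φ.dir (1, 0)).integrable_norm_sq_slice hd.le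
  have iY : Integrable Y := (φ.dir (0, 1)).integrable_norm_sq_slice hd.le
  have iA : Integrable A := (integrable_mul_slice hα φ 0).add (integrable_mul_slice hα φ d)
  have hX0 : ∀ x, 0 ≤ X x := fun x => intervalIntegral.integral_nonneg hd.le fun _ _ => sq_nonneg _
  have hA0 : ∀ x, 0 ≤ A x := fun x => add_nonneg (mul_nonneg (h0 x) (sq_nonneg _))
    (mul_nonneg (h0 x) (sq_nonneg _))
  have hR : MeasurableSet (Ioc (-N) N) := measurableSet_Ioc
  have hin := hcell φ
  rw [intervalIntegral.integral_of_le (by linarith), intervalIntegral.integral_of_le (by linarith),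
    intervalIntegral.integral_of_le (by linarith)] at hin
  have hout : t * ∫ x in (Ioc (-N) N)ᶜ, S x ≤ ∫ x in (Ioc (-N) N)ᶜ, (Y x + A x) := by
    rw [← integral_const_mul]
    refine setIntegral_mono_on (iS.const_mul t).integrableOn (iY.add iA).integrableOn hR.compl
      fun x hx => ?_
    have hx' : α₀ - δ < α x := by
      refine hr ?_
      rw [mem_compl_iff, mem_Ioc, not_and_or, not_lt, not_le] at hx
      rw [mem_compl_iff, mem_closedBall_zero_iff, Real.norm_eq_abs, not_le]
      have := le_abs_self r
      rcases hx with h | h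
      · exact lt_of_lt_of_le (by linarith) (neg_le_abs x)
      · exact lt_of_lt_of_le (by linarith) (le_abs_self x)
    exact ground_state_inequality_of_le hd hκ hκd hκa (h0 x) hδ0.le hx'.le htδ
      (fun y _ => (φ.hasDerivAt_right x y).hasDerivWithinAt)
      ((φ.dir (0, 1)).continuous_slice_right x).continuousOn
  have h1 := integral_add_compl hR iS
  have h2 := integral_add_compl hR iX
  have h3 := integral_add_compl hR (iY.add iA)
  have h4 : 0 ≤ ∫ x in (Ioc (-N) N)ᶜ, X x := integral_nonneg hX0
  have h5 : ∫ x in Ioc (-N) N, (Y + A) x = (∫ x in Ioc (-N) N, Y x) + ∫ x in Ioc (-N) N, A x :=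
    integral_add iY.integrableOn iA.integrableOn
  have h6 : 0 ≤ ∫ x in Ioc (-N) N, A x := integral_nonneg hA0
  rw [h5] at h3
  simp only [Pi.add_apply] at h3
  rw [← h1, ← h2, ← h3]
  linarith

/-- Coercivity in the Sobolev norm needs some gradient on the left. For `t < 0` the form provides it
directly; otherwise the bound at a level `t₁` between `t` and `κ²` is applied to a fraction `1 - s`
of the form and the gradient is taken from the rest. -/
theorem boundedBelowFiniteRank_robinForm (hd : 0 < d) (hα : MemLp α ⊤ volume)
    (h0 : ∀ x, 0 ≤ α x) (hlim : Tendsto α (cocompact ℝ) (𝓝 α₀)) (hκ : 0 ≤ κ)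
    (hκd : κ * d < Real.pi) (hκa : κ * Real.sin (κ * d / 2) = α₀ * Real.cos (κ * d / 2)) {t : ℝ}
    (htκ : t < κ ^ 2) :
    IsFormOperator.BoundedBelowFiniteRank (comp d 0) (robinForm d hα) t := by
  have h0' : ∀ᵐ x, 0 ≤ α x := Eventually.of_forall h0
  rcases lt_or_ge t 0 with htn | ht
  · refine IsFormOperator.boundedBelowFiniteRank_of_vectors (J := Fin 0) (fun _ => 0)
      (c := min 1 (-t)) (C := 0) (lt_min one_pos (by linarith)) le_rfl fun U => ?_
    have h1 := norm_sq_add_norm_sq_le_robinForm hα h0' U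
    have h2 := Sobolev.norm_sq_eq U
    have h3 := mul_le_mul_of_nonneg_right (min_le_left 1 (-t))
      (by positivity : 0 ≤ ‖comp d 1 U‖ ^ 2 + ‖comp d 2 U‖ ^ 2)
    have h4 := mul_le_mul_of_nonneg_right (min_le_right 1 (-t)) (sq_nonneg ‖comp d 0 U‖)
    rw [h2, zero_mul]
    linarith
  · set t₁ := (t + κ ^ 2) / 2 with ht₁
    have ht₁0 : 0 < t₁ := by linarith
    obtain ⟨m, v, C, hC, h⟩ := exists_robinForm_lower_bound hd hα h0 hlim hκ hκd hκa ht₁0.le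
      (by linarith : t₁ < κ ^ 2)
    -- Chosen so that `(1 - s) t₁ = t + (t₁ - t) / 2`, leaving half of the gap for `‖u‖²`.
    set s := (t₁ - t) / (2 * t₁) with hs
    have hs0 : 0 < s := div_pos (by linarith) (by positivity)
    have hst : s * t₁ = (t₁ - t) / 2 := by rw [hs]; field_simp
    have hs1 : s ≤ 1 := by
      rw [hs, div_le_one (by positivity)]; linarith
    refine IsFormOperator.boundedBelowFiniteRank_of_vectors v (c := min s ((t₁ - t) / 2))
      (lt_min hs0 (by linarith)) hC fun U => ?_
    have h1 := norm_sq_add_norm_sq_le_robinForm hα h0' U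
    have h2 := Sobolev.norm_sq_eq U
    have h3 := mul_le_mul_of_nonneg_right (min_le_left s ((t₁ - t) / 2))
      (by positivity : 0 ≤ ‖comp d 1 U‖ ^ 2 + ‖comp d 2 U‖ ^ 2)
    have h4 := mul_le_mul_of_nonneg_right (min_le_right s ((t₁ - t) / 2))
      (sq_nonneg ‖comp d 0 U‖)
    have h5 := mul_le_mul_of_nonneg_left (h U) (sub_nonneg.2 hs1)
    have h6 := mul_le_mul_of_nonneg_left h1 hs0.le
    have h7 : 0 ≤ s * (C * ∑ j, ‖⟪v j, comp d 0 U⟫_ℂ‖ ^ 2) := by positivity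
    have h8 : (1 - s) * (t₁ * ‖comp d 0 U‖ ^ 2) =
        t * ‖comp d 0 U‖ ^ 2 + (t₁ - t) / 2 * ‖comp d 0 U‖ ^ 2 := by
      linear_combination -‖comp d 0 U‖ ^ 2 * hst
    rw [h2]
    linarith

end LowerBound

end

noncomputable section

open scoped InnerProductSpace ComplexConjugate
open Sobolev

/-! ### Longitudinal wave packets -/

section WavePacket

lemma exists_bump : ∃ χ χ' χ'' : ℝ → ℝ, ContDiff ℝ ∞ χ ∧ Continuous χ' ∧ Continuous χ'' ∧
    HasCompactSupport χ ∧ HasCompactSupport χ' ∧ HasCompactSupport χ'' ∧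
    (∀ x, HasDerivAt χ (χ' x) x) ∧ (∀ x, HasDerivAt χ' (χ'' x) x) ∧
    (∀ x, 2 ≤ |x| → χ x = 0) ∧ χ 0 = 1 := by
  let χ : ContDiffBump (0 : ℝ) := ⟨1, 2, one_pos, one_lt_two⟩
  have hχ : ContDiff ℝ ∞ χ := χ.contDiff
  have hχ1 : ContDiff ℝ ∞ (deriv χ) := hχ.iterate_deriv 1
  have hχ2 : ContDiff ℝ ∞ (deriv (deriv χ)) := hχ.iterate_deriv 2
  exact ⟨χ, deriv χ, deriv (deriv χ), hχ, hχ1.continuous, hχ2.continuous, χ.hasCompactSupport,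
    χ.hasCompactSupport.deriv, χ.hasCompactSupport.deriv.deriv,
    fun x => (hχ.differentiable (by simp) x).hasDerivAt,
    fun x => (hχ1.differentiable (by simp) x).hasDerivAt,
    fun x hx => χ.zero_of_le_dist (by rwa [Real.dist_eq, sub_zero]),
    χ.one_of_mem_closedBall (Metric.mem_closedBall_self χ.rIn_pos.le)⟩

/-- A smooth approximate solution of `f'' + k² f = 0` supported in a given half-line. -/
lemma exists_wavePacket (k N : ℝ) {ε : ℝ} (hε : 0 < ε) :
    ∃ f f' f'' : ℝ → ℂ, ContDiff ℝ ∞ f ∧ HasCompactSupport f ∧ (∀ x, HasDerivAt f (f' x) x) ∧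
      (∀ x, HasDerivAt f' (f'' x) x) ∧ (∀ x ≤ N, f x = 0) ∧ 0 < ∫ x, ‖f x‖ ^ 2 ∧
      ∫ x, ‖f'' x + (k : ℂ) ^ 2 * f x‖ ^ 2 ≤ ε ^ 2 * ∫ x, ‖f x‖ ^ 2 := by
  obtain ⟨χ, χ', χ'', hχ, cχ', cχ'', s0, s1, s2, d0, d1, hχ0, hχ1⟩ := exists_bump
  -- For the packet `χ (s (x - a)) exp (i k x)` with `s ≤ 1`, the residual `f'' + k² f` contains
  -- only derivatives of `χ`, and its square is at most `s² G (s (x - a))`.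
  set G : ℝ → ℝ := fun t => 2 * χ'' t ^ 2 + 8 * k ^ 2 * χ' t ^ 2 with hG
  have hGc : Continuous G := ((cχ''.pow 2).const_mul 2).add
    ((cχ'.pow 2).const_mul _)
  have hGs : HasCompactSupport G :=
    (s2.comp_left (g := fun t => 2 * t ^ 2) (by simp)).add
      (s1.comp_left (g := fun t => 8 * k ^ 2 * t ^ 2) (by simp))
  have hGi : Integrable G := hGc.integrable_of_hasCompactSupport hGs
  have hG0 (t : ℝ) : 0 ≤ G t := by positivity
  have hB : 0 ≤ ∫ t, G t := integral_nonneg hG0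
  have hX : 0 < ∫ t, χ t ^ 2 := by
    have hc : Continuous fun t => χ t ^ 2 := hχ.continuous.pow 2
    have hcs : HasCompactSupport fun t => χ t ^ 2 := s0.comp_left (g := fun t => t ^ 2) (by simp)
    refine (integral_pos_iff_support_of_nonneg (fun t => sq_nonneg (χ t))
      (hc.integrable_of_hasCompactSupport hcs)).2 ?_
    refine hc.isOpen_support.measure_pos volume ⟨0, ?_⟩
    simp [hχ1]
  set B := ∫ t, G t
  set X := ∫ t, χ t ^ 2
  -- After rescaling, the residual has square integral at most `s B` and the packet has `X / s`, so
  -- `s ≤ 1` and `s B ≤ ε² X` suffice. The `1` in `B + 1` avoids a division by zero.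
  set s := min 1 (ε ^ 2 * X / (B + 1)) with hs
  have hs0 : 0 < s := lt_min one_pos (by positivity)
  have hs1 : s ≤ 1 := min_le_left _ _
  have hsB : s * B ≤ ε ^ 2 * X := by
    have h1 : s * (B + 1) ≤ ε ^ 2 * X := (le_div_iff₀ (by linarith)).1 (min_le_right _ _)
    linarith
  -- The packet lives within distance `2 / s` of its centre `a`, hence to the right of `N`.
  set a := N + 2 / s with ha
  have hl (x : ℝ) : HasDerivAt (fun x => s * (x - a)) s x := by
    simpa using ((hasDerivAt_id x).sub_const a).const_mul s
  set e : ℝ → ℂ := fun x => Complex.exp (Complex.I * k * x) with he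
  have hen (x : ℝ) : ‖e x‖ = 1 := by
    have : Complex.I * k * x = ((k * x : ℝ) : ℂ) * Complex.I := by push_cast; ring
    rw [he]; simp only [this, Complex.norm_exp_ofReal_mul_I]
  have hed (x : ℝ) : HasDerivAt e (Complex.I * k * e x) x := by
    have h1 : HasDerivAt (fun x : ℝ => Complex.I * k * (x : ℂ)) (Complex.I * k) x := by
      simpa using (Complex.ofRealCLM.hasDerivAt (x := x)).const_mul (Complex.I * k)
    exact h1.cexp.congr_deriv (mul_comm _ _)
  have hes : ContDiff ℝ ∞ e :=
    (contDiff_const.mul Complex.ofRealCLM.contDiff).cexp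
  have hχf : ContDiff ℝ ∞ fun x => χ (s * (x - a)) :=
    hχ.comp (contDiff_const.mul (contDiff_id.sub contDiff_const))
  have c0 (x : ℝ) : HasDerivAt (fun x => (χ (s * (x - a)) : ℂ))
      ((χ' (s * (x - a)) * s : ℝ) : ℂ) x := ((d0 _).comp x (hl x)).ofReal_comp
  have c1 (x : ℝ) : HasDerivAt (fun x => (χ' (s * (x - a)) : ℂ))
      ((χ'' (s * (x - a)) * s : ℝ) : ℂ) x := ((d1 _).comp x (hl x)).ofReal_comp
  have hz (x : ℝ) (hx : 2 / s ≤ |x - a|) : χ (s * (x - a)) = 0 := by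
    refine hχ0 _ ?_
    rw [abs_mul, abs_of_pos hs0]
    exact (div_le_iff₀' hs0).1 hx
  have hint : ∫ x, ‖(χ (s * (x - a)) : ℂ) * e x‖ ^ 2 = s⁻¹ * X := by
    have e1 (x : ℝ) : ‖(χ (s * (x - a)) : ℂ) * e x‖ ^ 2 = (fun t => χ t ^ 2) (s * (x - a)) := by
      rw [norm_mul, hen, mul_one, Complex.norm_real, Real.norm_eq_abs, sq_abs]
    simp_rw [e1]
    rw [integral_sub_right_eq_self (fun x => χ (s * x) ^ 2) a,
      Measure.integral_comp_mul_left (fun t => χ t ^ 2) s, abs_of_pos (inv_pos.2 hs0), smul_eq_mul]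
  refine ⟨fun x => χ (s * (x - a)) * e x,
    fun x => ((χ' (s * (x - a)) : ℂ) * s + Complex.I * k * χ (s * (x - a))) * e x,
    fun x => ((χ'' (s * (x - a)) : ℂ) * s ^ 2 +
      2 * Complex.I * k * (s * χ' (s * (x - a))) - k ^ 2 * χ (s * (x - a))) * e x,
    (Complex.ofRealCLM.contDiff.comp hχf).mul hes, ?_, fun x => ?_, fun x => ?_, fun x hx => ?_,
    ?_, ?_⟩
  · refine HasCompactSupport.intro (isCompact_closedBall a (2 / s)) fun x hx => ?_
    rw [Metric.mem_closedBall, not_le, Real.dist_eq] at hx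
    rw [hz x hx.le, Complex.ofReal_zero, zero_mul]
  · refine ((c0 x).mul (hed x)).congr_deriv ?_
    push_cast; ring
  · refine ((((c1 x).mul_const (s : ℂ)).add ((c0 x).const_mul (Complex.I * k))).mul
      (hed x)).congr_deriv ?_
    simp only [Pi.add_apply]
    push_cast
    linear_combination (k ^ 2 * χ (s * (x - a)) * e x : ℂ) * Complex.I_sq
  · have : 2 / s ≤ |x - a| := by
      rw [abs_sub_comm]
      exact le_trans (by linarith) (le_abs_self _)
    simp only [hz x this, Complex.ofReal_zero, zero_mul]
  · rw [hint]; positivity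
  · rw [hint]
    have hb (x : ℝ) : ‖((χ'' (s * (x - a)) : ℂ) * s ^ 2 +
        2 * Complex.I * k * (s * χ' (s * (x - a))) - k ^ 2 * χ (s * (x - a))) * e x +
        (k : ℂ) ^ 2 * (χ (s * (x - a)) * e x)‖ ^ 2 ≤ s ^ 2 * G (s * (x - a)) := by
      set p := χ'' (s * (x - a)) with hp
      set q := χ' (s * (x - a)) with hq
      have e1 : ((p : ℂ) * s ^ 2 + 2 * Complex.I * k * (s * q) - k ^ 2 * χ (s * (x - a))) * e x +
          (k : ℂ) ^ 2 * (χ (s * (x - a)) * e x) =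
          (s : ℂ) * (((p * s : ℝ) : ℂ) + ((2 * k * q : ℝ) : ℂ) * Complex.I) * e x := by
        push_cast; ring
      rw [e1, norm_mul, norm_mul, hen, mul_one, mul_pow, Complex.norm_real, Real.norm_eq_abs,
        sq_abs, Complex.sq_norm, Complex.normSq_add_mul_I]
      refine mul_le_mul_of_nonneg_left ?_ (sq_nonneg s)
      simp only [hG, ← hp, ← hq]
      have h1 : s ^ 2 ≤ 1 := pow_le_one₀ hs0.le hs1
      have h2 := mul_le_mul_of_nonneg_left h1 (sq_nonneg p)
      have h3 := sq_nonneg (k * q)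
      have h4 := sq_nonneg p
      linarith
    have hi : Integrable fun x => s ^ 2 * G (s * (x - a)) :=
      ((hGi.comp_mul_left' hs0.ne').comp_sub_right a).const_mul _
    refine (integral_mono_of_nonneg (Eventually.of_forall fun x => sq_nonneg _) hi
      (Eventually.of_forall hb)).trans ?_
    rw [integral_const_mul, integral_sub_right_eq_self (fun x => G (s * x)) a,
      Measure.integral_comp_mul_left G s, abs_of_pos (inv_pos.2 hs0), smul_eq_mul]
    have e2 : s ^ 2 * (s⁻¹ * B) = s⁻¹ * (s * (s * B)) := by ring
    rw [e2, mul_left_comm (ε ^ 2)]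
    refine mul_le_mul_of_nonneg_left ?_ (by positivity)
    exact (mul_le_of_le_one_left (by positivity) hs1).trans hsB

end WavePacket

/-! ### Approximate eigenvectors -/

section WeylVector

variable {d κ α₀ : ℝ} {α : ℝ → ℝ}

namespace TestPlane

variable {f g : ℝ → ℂ} {hf : ContDiff ℝ ∞ f} {hfs : HasCompactSupport f} {hg : ContDiff ℝ ∞ g}
  {hgs : HasCompactSupport g}

lemma tensor_dir_left {f' : ℂ} {x : ℝ} (h : HasDerivAt f f' x) (y : ℝ) :
    (tensor hf hfs hg hgs).dir (1, 0) (x, y) = f' * g y :=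
  ((tensor hf hfs hg hgs).hasDerivAt_left x y).unique (h.mul_const (g y))

lemma tensor_dir_right {g' : ℂ} (x : ℝ) {y : ℝ} (h : HasDerivAt g g' y) :
    (tensor hf hfs hg hgs).dir (0, 1) (x, y) = f x * g' :=
  ((tensor hf hfs hg hgs).hasDerivAt_right x y).unique (h.const_mul (f x))

end TestPlane

/-- The form equation for a test function, integrated by parts. -/
lemma inner_robinForm_jet_sub (hd : 0 < d) (hα : MemLp α ⊤ volume) (l : ℝ) (φ : TestPlane)
    (W : Sobolev d) :
    ⟪robinForm d hα (φ.jet d), W⟫_ℂ - l * ⟪comp d 0 (φ.jet d), comp d 0 W⟫_ℂ =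
      -⟪TestPlane.toStrip d ((φ.dir (1, 0)).dir (1, 0) + (φ.dir (0, 1)).dir (0, 1) + (l : ℂ) • φ),
        comp d 0 W⟫_ℂ +
      ⟪mulOp hα (TestPlane.toLine 0 φ) - TestPlane.toLine 0 (φ.dir (0, 1)), trace d 0 W⟫_ℂ +
      ⟪mulOp hα (TestPlane.toLine d φ) + TestPlane.toLine d (φ.dir (0, 1)), trace d d W⟫_ℂ := by
  have hl : (0 : ℝ) ∈ Icc 0 d := left_mem_Icc.2 hd.le
  have hr : d ∈ Icc 0 d := right_mem_Icc.2 hd.le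
  have g1 := green_left hd ((φ.dir (1, 0)).jet d) W
  have g2 := green_right hd ((φ.dir (0, 1)).jet d) W
  rw [trace_jet hd hl, trace_jet hd hr] at g2
  simp only [comp_zero_jet, comp_one_jet, comp_two_jet] at g1 g2
  rw [inner_robinForm, trace_jet hd hl, trace_jet hd hr, comp_zero_jet, comp_one_jet, comp_two_jet,
    map_add, map_add, map_smul, inner_add_left, inner_add_left, inner_smul_left, Complex.conj_ofReal,
    inner_sub_left, inner_add_left]
  linear_combination g1 + g2

lemma norm_mulOp_sub_smul_le (hα : MemLp α ⊤ volume) {a ε : ℝ} {f : Lp ℂ 2 (volume : Measure ℝ)}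
    (h : ∀ᵐ x, f x ≠ 0 → |α x - a| ≤ ε) : ‖mulOp hα f - (a : ℂ) • f‖ ≤ ε * ‖f‖ := by
  refine Lp.norm_le_mul_norm_of_ae_le_mul ?_
  filter_upwards [h, coeFn_mulOp hα f, Lp.coeFn_sub (mulOp hα f) ((a : ℂ) • f),
    Lp.coeFn_smul (a : ℂ) f] with x h1 h2 h3 h4
  rw [h3, Pi.sub_apply, h2, h4, Pi.smul_apply, smul_eq_mul, ← sub_mul, norm_mul,
    ← Complex.ofReal_sub, Complex.norm_real, Real.norm_eq_abs]
  by_cases hx : f x = 0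
  · simp [hx]
  · exact mul_le_mul_of_nonneg_right (h1 hx) (norm_nonneg _)

/-- A smooth compactly supported function which agrees with the transversal ground state near
`[0, d]`. -/
lemma exists_ground_cutoff (hd : 0 < d) (κ : ℝ) : ∃ w : ℝ → ℂ, ContDiff ℝ ∞ w ∧
    HasCompactSupport w ∧ ∀ y ∈ Icc 0 d, ∀ᶠ z in 𝓝 y, w z = (Real.cos (κ * (z - d / 2)) : ℝ) := by
  let ζ : ContDiffBump (d / 2) := ⟨d, 2 * d, hd, by linarith⟩
  refine ⟨fun y => (ζ y : ℂ) * (Real.cos (κ * (y - d / 2)) : ℝ),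
    (Complex.ofRealCLM.contDiff.comp ζ.contDiff).mul (Complex.ofRealCLM.contDiff.comp
      (Real.contDiff_cos.comp (contDiff_const.mul (contDiff_id.sub contDiff_const)))),
    (ζ.hasCompactSupport.comp_left (g := fun t : ℝ => (t : ℂ)) Complex.ofReal_zero).mul_right,
    fun y hy => ?_⟩
  have hmem : y ∈ Metric.ball (d / 2) d := by
    rw [Metric.mem_ball, Real.dist_eq, abs_lt]
    constructor <;> linarith [hy.1, hy.2]
  filter_upwards [Metric.isOpen_ball.mem_nhds hmem] with z hz
  rw [ζ.one_of_mem_closedBall (Metric.ball_subset_closedBall hz), Complex.ofReal_one, one_mul]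

/-- The product of `f` with the cut-off ground state. The cut-off is `1` in a neighbourhood of every
point of `[0, d]`, so the `y`-derivatives are exact up to the boundary. -/
lemma exists_ground_test (hd : 0 < d) (κ : ℝ) {f f' f'' : ℝ → ℂ} (hf : ContDiff ℝ ∞ f)
    (hfs : HasCompactSupport f) (hf1 : ∀ x, HasDerivAt f (f' x) x)
    (hf2 : ∀ x, HasDerivAt f' (f'' x) x) : ∃ φ : TestPlane, ∀ x, ∀ y ∈ Icc 0 d,
      φ (x, y) = f x * (Real.cos (κ * (y - d / 2)) : ℝ) ∧
      φ.dir (0, 1) (x, y) = f x * ((-κ * Real.sin (κ * (y - d / 2)) : ℝ) : ℂ) ∧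
      (φ.dir (1, 0)).dir (1, 0) (x, y) = f'' x * (Real.cos (κ * (y - d / 2)) : ℝ) ∧
      (φ.dir (0, 1)).dir (0, 1) (x, y) =
        f x * ((-κ ^ 2 * Real.cos (κ * (y - d / 2)) : ℝ) : ℂ) := by
  obtain ⟨w, hw, hws, hwe⟩ := exists_ground_cutoff hd κ
  set φ := TestPlane.tensor hf hfs hw hws with hφ
  have hwd {y : ℝ} (h : ∀ᶠ z in 𝓝 y, w z = (Real.cos (κ * (z - d / 2)) : ℝ)) :
      HasDerivAt w ((-κ * Real.sin (κ * (y - d / 2)) : ℝ) : ℂ) y :=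
    (hasDerivAt_cos_ground κ d y).ofReal_comp.congr_of_eventuallyEq h
  refine ⟨φ, fun x y hy => ⟨congrArg (f x * ·) (hwe y hy).self_of_nhds,
    TestPlane.tensor_dir_right x (hwd (hwe y hy)), ?_, ?_⟩⟩
  · refine ((φ.dir (1, 0)).hasDerivAt_left x y).unique ?_
    have e : (fun x => φ.dir (1, 0) (x, y)) = fun x => f' x * w y :=
      funext fun x => TestPlane.tensor_dir_left (hf1 x) y
    rw [e, ← (hwe y hy).self_of_nhds]
    exact (hf2 x).mul_const (w y)
  · refine ((φ.dir (0, 1)).hasDerivAt_right x y).unique ?_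
    refine (((hasDerivAt_sin_ground κ d y).ofReal_comp).const_mul (f x)).congr_of_eventuallyEq ?_
    filter_upwards [(hwe y hy).eventually_nhds] with z hz
    exact TestPlane.tensor_dir_right x (hwd hz)

lemma norm_sq_toStrip_of_eq_mul (hd : 0 ≤ d) {q : ℝ → ℂ} {u : ℝ → ℝ} {ψ : TestPlane}
    (h : ∀ x, ∀ y ∈ Icc 0 d, ψ (x, y) = q x * (u y : ℂ)) :
    ‖TestPlane.toStrip d ψ‖ ^ 2 = (∫ x, ‖q x‖ ^ 2) * ∫ y in 0..d, u y ^ 2 := by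
  rw [TestPlane.norm_sq_toStrip_eq hd, ← integral_mul_const]
  refine integral_congr_ae (Eventually.of_forall fun x => ?_)
  simp only
  rw [← intervalIntegral.integral_const_mul]
  refine intervalIntegral.integral_congr fun y hy => ?_
  rw [uIcc_of_le hd] at hy
  rw [h x y hy, norm_mul, mul_pow, Complex.norm_real, Real.norm_eq_abs, sq_abs]

lemma toLine_eq_smul {c : ℝ} {b : ℂ} {φ ψ : TestPlane} (h : ∀ x, ψ (x, c) = b * φ (x, c)) :
    TestPlane.toLine c ψ = b • TestPlane.toLine c φ := by
  rw [← map_smul]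
  exact toL2_congr (hc := ψ.continuous_slice_left c)
    (hs := hasCompactSupport_slice_left ψ.hasCompactSupport c)
    (hc' := TestPlane.continuous_slice_left (b • φ) c)
    (hs' := hasCompactSupport_slice_left (TestPlane.hasCompactSupport _) c)
    (Eventually.of_forall h)

lemma norm_mulOp_toLine_sub_le (hα : MemLp α ⊤ volume) {a ε c : ℝ} (φ : TestPlane)
    (h : ∀ x, φ (x, c) ≠ 0 → |α x - a| ≤ ε) :
    ‖mulOp hα (TestPlane.toLine c φ) - (a : ℂ) • TestPlane.toLine c φ‖ ≤
      ε * ‖TestPlane.toLine c φ‖ := by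
  refine norm_mulOp_sub_smul_le hα ?_
  filter_upwards [coeFn_toL2 (μ := volume) (φ.continuous_slice_left c)
    (hasCompactSupport_slice_left φ.hasCompactSupport c)] with x hx hne
  have hx' : TestPlane.toLine c φ x = φ (x, c) := hx
  exact h x (hx' ▸ hne)

lemma norm_sq_toLine_le_of_norm_le {c : ℝ} {f : ℝ → ℂ} (hf : Continuous f)
    (hfs : HasCompactSupport f) {φ : TestPlane} (h : ∀ x, ‖φ (x, c)‖ ≤ ‖f x‖) :
    ‖TestPlane.toLine c φ‖ ^ 2 ≤ ∫ x, ‖f x‖ ^ 2 := by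
  rw [TestPlane.norm_sq_toLine]
  have hc : Continuous fun x => ‖f x‖ ^ 2 := hf.norm.pow 2
  have hcs : HasCompactSupport fun x => ‖f x‖ ^ 2 :=
    hfs.comp_left (g := fun z : ℂ => ‖z‖ ^ 2) (by simp)
  exact integral_mono (φ.integrable_norm_sq_slice_left c)
    (hc.integrable_of_hasCompactSupport hcs) fun x => pow_le_pow_left₀ (norm_nonneg _) (h x) 2

/-- `Ψ` is a wave packet with `k² = l - κ²` times the transversal ground state. The ground state
satisfies the Robin condition with `α₀` exactly, so the error consists of the packet's residual in
the strip and of `(α - α₀) Ψ` on each boundary line, which is small because the packet is far out.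
-/
theorem exists_approximate_eigenvector (hd : 0 < d) (hα : MemLp α ⊤ volume)
    (hlim : Tendsto α (cocompact ℝ) (𝓝 α₀)) (hκ : 0 ≤ κ)
    (hκd : κ * d < Real.pi) (hκa : κ * Real.sin (κ * d / 2) = α₀ * Real.cos (κ * d / 2)) {l : ℝ}
    (hl : κ ^ 2 ≤ l) {ε : ℝ} (hε : 0 < ε) :
    ∃ Ψ : Sobolev d, comp d 0 Ψ ≠ 0 ∧ ∀ W, ‖⟪robinForm d hα Ψ, W⟫_ℂ -
      l * ⟪comp d 0 Ψ, comp d 0 W⟫_ℂ‖ ≤ ε * ‖comp d 0 Ψ‖ * ‖W‖ := by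
  have h0m : (0 : ℝ) ∈ Icc 0 d := left_mem_Icc.2 hd.le
  have hdm : d ∈ Icc 0 d := right_mem_Icc.2 hd.le
  set k := √(l - κ ^ 2)
  have hk2 : k ^ 2 = l - κ ^ 2 := Real.sq_sqrt (by linarith)
  set w2 := ∫ y in 0..d, Real.cos (κ * (y - d / 2)) ^ 2
  have hw2pos : 0 < w2 := by
    refine intervalIntegral.intervalIntegral_pos_of_pos_on
      (Continuous.intervalIntegrable (by fun_prop) _ _) (fun y hy => ?_) hd
    have := cos_pos_of_mem_Icc hκ hκd (Ioo_subset_Icc_self hy)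
    positivity
  have htc : 0 ≤ traceConst d := Real.sqrt_nonneg _
  -- The error budget is `ε / 2` for the strip and `ε / 4` for each line. The factor `√w2` relates
  -- the norm of `f` on a line to that of `Ψ` on the strip, and `traceConst d` bounds the trace of
  -- the test vector; adding `1` keeps the quotient `traceConst d / (traceConst d + 1)` at most `1`.
  set ε₂ := ε * √w2 / (4 * (traceConst d + 1)) with hε₂
  have hw2s : 0 < √w2 := Real.sqrt_pos.2 hw2pos
  have hε₂0 : 0 < ε₂ := by positivity
  obtain ⟨r, hr⟩ := Metric.mem_cocompact_iff_closedBall_compl_subset (0 : ℝ) |>.1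
    (hlim.eventually (Metric.closedBall_mem_nhds α₀ hε₂0))
  obtain ⟨f, f', f'', hf, hfs, hf1, hf2, hf0, hfpos, hfe⟩ := exists_wavePacket k |r| (half_pos hε)
  obtain ⟨φ, hφ⟩ := exists_ground_test hd κ hf hfs hf1 hf2
  have hval (x : ℝ) {y : ℝ} (hy : y ∈ Icc 0 d) := (hφ x y hy).1
  have hn2 : ‖TestPlane.toStrip d φ‖ ^ 2 = (∫ x, ‖f x‖ ^ 2) * w2 :=
    norm_sq_toStrip_of_eq_mul hd.le fun x y hy => hval x hy
  set E := (φ.dir (1, 0)).dir (1, 0) + (φ.dir (0, 1)).dir (0, 1) + (l : ℂ) • φ with hE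
  have hE2 : ‖TestPlane.toStrip d E‖ ^ 2 = (∫ x, ‖f'' x + (k : ℂ) ^ 2 * f x‖ ^ 2) * w2 := by
    refine norm_sq_toStrip_of_eq_mul hd.le fun x y hy => ?_
    change (φ.dir (1, 0)).dir (1, 0) (x, y) + (φ.dir (0, 1)).dir (0, 1) (x, y) +
      (l : ℂ) * φ (x, y) = _
    have hk2' : (k : ℂ) ^ 2 = l - κ ^ 2 := by exact_mod_cast hk2
    rw [(hφ x y hy).2.2.1, (hφ x y hy).2.2.2, hval x hy, hk2']
    push_cast
    ring
  have hsq (c : ℝ) (hc : c ∈ Icc 0 d) : ‖TestPlane.toLine c φ‖ ^ 2 ≤ ∫ x, ‖f x‖ ^ 2 := by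
    refine norm_sq_toLine_le_of_norm_le hf.continuous hfs fun x => ?_
    rw [hval x hc, norm_mul, Complex.norm_real, Real.norm_eq_abs]
    exact mul_le_of_le_one_right (norm_nonneg _) (Real.abs_cos_le_one _)
  have hα' (c : ℝ) (hc : c ∈ Icc 0 d) := norm_mulOp_toLine_sub_le hα (a := α₀) (ε := ε₂) (c := c) φ
    fun x hne => by
      rw [hval x hc] at hne
      have hrx : |r| < x := by
        by_contra! h
        exact left_ne_zero_of_mul hne (hf0 x h)
      refine hr (show x ∈ (Metric.closedBall (0 : ℝ) r)ᶜ from ?_)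
      rw [mem_compl_iff, mem_closedBall_zero_iff, Real.norm_eq_abs, not_le]
      exact (le_abs_self r).trans_lt (hrx.trans_le (le_abs_self x))
  have eκ : ((κ : ℂ) * (Real.sin (κ * d / 2) : ℝ)) = α₀ * (Real.cos (κ * d / 2) : ℝ) := by
    exact_mod_cast hκa
  have hb0 : TestPlane.toLine 0 (φ.dir (0, 1)) = (α₀ : ℂ) • TestPlane.toLine 0 φ := by
    refine toLine_eq_smul fun x => ?_
    have e1 : κ * (0 - d / 2) = -(κ * d / 2) := by ring
    rw [(hφ x 0 h0m).2.1, hval x h0m, e1, Real.sin_neg, Real.cos_neg, neg_mul_neg,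
      Complex.ofReal_mul, eκ]
    ring
  have hbd : TestPlane.toLine d (φ.dir (0, 1)) = (-α₀ : ℂ) • TestPlane.toLine d φ := by
    refine toLine_eq_smul fun x => ?_
    have e1 : κ * (d - d / 2) = κ * d / 2 := by ring
    rw [(hφ x d hdm).2.1, hval x hdm, e1, neg_mul, Complex.ofReal_neg, Complex.ofReal_mul, eκ]
    ring
  have hform := inner_robinForm_jet_sub hd hα l φ
  rw [hb0, hbd, ← hE, neg_smul, ← sub_eq_add_neg] at hform
  clear_value E w2 k
  set F := ∫ x, ‖f x‖ ^ 2
  have hn0 : 0 ≤ ‖TestPlane.toStrip d φ‖ := norm_nonneg _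
  have hEn : ‖TestPlane.toStrip d E‖ ≤ ε / 2 * ‖TestPlane.toStrip d φ‖ := by
    refine abs_le_of_sq_le_sq' ?_ (by positivity) |>.2
    rw [hE2, mul_pow, hn2, ← mul_assoc]
    exact mul_le_mul_of_nonneg_right hfe hw2pos.le
  have hline (c : ℝ) (hc : c ∈ Icc 0 d) :
      ‖mulOp hα (TestPlane.toLine c φ) - (α₀ : ℂ) • TestPlane.toLine c φ‖ * traceConst d ≤
        ε / 4 * ‖TestPlane.toStrip d φ‖ := by
    have h2 : √w2 * ‖TestPlane.toLine c φ‖ ≤ ‖TestPlane.toStrip d φ‖ := by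
      refine abs_le_of_sq_le_sq' ?_ hn0 |>.2
      rw [mul_pow, Real.sq_sqrt hw2pos.le, hn2, mul_comm F]
      exact mul_le_mul_of_nonneg_left (hsq c hc) hw2pos.le
    have h3 : ε₂ * ‖TestPlane.toLine c φ‖ * traceConst d =
        ε / 4 * (√w2 * ‖TestPlane.toLine c φ‖) * (traceConst d / (traceConst d + 1)) := by
      rw [hε₂]; field_simp
    have h4 : traceConst d / (traceConst d + 1) ≤ 1 := by
      rw [div_le_one (by positivity)]; linarith
    refine (mul_le_mul_of_nonneg_right (hα' c hc) htc).trans ?_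
    rw [h3]
    refine (mul_le_of_le_one_right (by positivity) h4).trans ?_
    exact mul_le_mul_of_nonneg_left h2 (by positivity)
  refine ⟨φ.jet d, ?_, fun W => ?_⟩
  · rw [comp_zero_jet, ← norm_pos_iff]
    exact hn0.lt_of_ne fun h => (mul_pos hfpos hw2pos).ne' (by rw [← hn2, ← h]; ring)
  · rw [hform W, comp_zero_jet]
    have b1 : ‖⟪TestPlane.toStrip d E, comp d 0 W⟫_ℂ‖ ≤
        ε / 2 * ‖TestPlane.toStrip d φ‖ * ‖W‖ :=
      (norm_inner_le_norm _ _).trans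
        (mul_le_mul hEn (norm_comp_le 0 W) (norm_nonneg _) (by positivity))
    have b2 (c : ℝ) (hc : c ∈ Icc 0 d) :
        ‖⟪mulOp hα (TestPlane.toLine c φ) - (α₀ : ℂ) • TestPlane.toLine c φ, trace d c W⟫_ℂ‖ ≤
          ε / 4 * ‖TestPlane.toStrip d φ‖ * ‖W‖ := by
      refine (norm_inner_le_norm _ _).trans ((mul_le_mul_of_nonneg_left (norm_trace_le hd hc W)
        (norm_nonneg _)).trans ?_)
      rw [← mul_assoc]
      exact mul_le_mul_of_nonneg_right (hline c hc) (norm_nonneg _)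
    refine (norm_add₃_le).trans ?_
    rw [norm_neg]
    linarith [b2 0 h0m, b2 d hdm]

end WeylVector

end

theorem theorem3p1 (d : ℝ) (hd : 0 < d)
    (α : ℝ → ℝ) (hα : MemW1Infty α) (hpos : ∀ x, 0 < α x)
    (α₀ : ℝ) (hlim : Tendsto α (cocompact ℝ) (𝓝 α₀)) :
    IsLeast (transversalEigenvalues d α₀) (lowestTransversalEigenvalue d α₀) ∧
    essentialSpectrum (robinLaplacian d α) =
      (fun t : ℝ => (t : ℂ)) '' Ici (lowestTransversalEigenvalue d α₀) := by
  have h0 (x : ℝ) : 0 ≤ α x := (hpos x).le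
  -- The limit may be zero although `α` is positive; then `κ = 0` and the threshold is `0`.
  have hα₀ : 0 ≤ α₀ := ge_of_tendsto' hlim h0
  obtain ⟨κ, hκ, hκd, hκa⟩ := exists_ground_frequency hd hα₀
  have hleast := isLeast_transversalEigenvalues hd hκ hκd hκa
  have hE : lowestTransversalEigenvalue d α₀ = κ ^ 2 := hleast.csInf_eq
  rw [hE]
  exact ⟨hleast, (isFormOperator_robinLaplacian hd hα h0).essentialSpectrum_eq (κ ^ 2)
    (fun t ht => boundedBelowFiniteRank_robinForm hd hα.1 h0 hlim hκ hκd hκa ht)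
    fun l hl ε hε => exists_approximate_eigenvector hd hα.1 hlim hκ hκd hκa hl hε⟩
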